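/- **Setting.** Fix integers $N_{\rm b},N_{\rm c}$ and $\nu\ge 2$. Each atomic species $Z$ has a nuclear charge (also written $Z$) and orbitals $\phi_{Z,a}:\mathbb R^3\to\mathbb R$ ($a=1,\dots,N_{\rm b}$), and there are feature functions $\Xi_c:\mathbb R^3\to\mathbb R$ ($c=1,\dots,N_{\rm c}$). All of these are $C^\nu$ and, for all $|\alpha|\le\nu$, satisfy $|\partial^\alpha\phi_{Z,a}(x)|\le c_\phi e^{-\eta_\phi|x|}$ and $|\partial^\alpha\Xi_c(x)|\le c_\Xi e^{-\eta_\Xi|x|}$ with positive constants. The function $\varepsilon_{\rm xc}:[0,\infty)\to\mathbb R$ is twice differentiable on $(0,\infty)$, satisfies $-c_2\rho^{4/3}\le\varepsilon_{\rm xc}(\rho)\le -c_1\rho^{4/3}$ for all sufficiently small $\rho\ge0$ (with $c_1,c_2>0$), and $-C\rho^{1/3}\le\varepsilon_{\rm xc}'(\rho)\le0$ on $(0,\infty)$. Fix $\mu\in\mathbb R$. For $M\ge1$ atoms with species $Z_\ell$, positions $\bm r=(\bm r_\ell)\in(\mathbb R^3)^M$ and features $\widehat v=(\widehat v_{mc})\in\mathbb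 R^{M\times N_{\rm c}}$, put $\phi_{\ell a}=\phi_{Z_\ell,a}(\cdot-\bm r_\ell)$, $\Xi_{mc}=\Xi_c(\cdot-\bm r_m)$, $r_{\ell k}=|\bm r_\ell-\bm r_k|$, and $$[H_0]_{\ell k,ab}=\tfrac12\int\nabla\phi_{\ell a}\cdot\nabla\phi_{kb},\qquad v_{\ell k,ab}=\sum_{mc}\widehat v_{mc}\int\phi_{\ell a}\phi_{kb}\Xi_{mc},\qquad \mathcal H=H_0+v .$$ For $\beta\in(0,\infty]$ let $F(x)=(1+e^{\beta(x-\mu)})^{-1}$ if $\beta<\infty$, $F=\chi_{(-\infty,\mu)}+\frac12\chi_{\{\mu\}}$ if $\beta=\infty$, and $S(x)=x\log x+(1-x)\log(1-x)$. Put $\rho(\bm r,\widehat v;x)=2\phi(x)^{\rm T}F(\mathcal H)\phi(x)$, $V^{\rm nuc}(x)=-\sum_i Z_i/|x-\bm r_i|$, $v_{\rm C}\rho(x)=\int\rho(y)/|x-y|\,{\rm d}y$, $E_{\rm el}[\rho]=\int[\rho V^{\rm nuc}+\frac12\rho\, v_{\rm C}\rho]$ and $$\mathcal G(\bm r,\widehat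 v)={\rm Tr}\big[(H_0-\mu)F(\mathcal H)+\beta^{-1}S(F(\mathcal H))\big]+\int\big[\rho V^{\rm nuc}+\tfrac12\rho\, v_{\rm C}\rho+\varepsilon_{\rm xc}(\rho)\big]$$ (no entropy term if $\beta=\infty$). Let $\mathsf g_-={\rm dist}(\mu,\sigma(\mathcal H)\cap(-\infty,\mu])$, $\mathsf g_+={\rm dist}(\mu,\sigma(\mathcal H)\cap[\mu,\infty))$ (with ${\rm dist}(\mu,\emptyset)=\infty$) and $\mathsf g=\mathsf g_-+\mathsf g_+$. Call a partition $\mathbb R^3=\bigcup_\ell\mathcal N_\ell$ into pairwise disjoint measurable sets *admissible for* $\bm r$ if ${\rm dist}(\bm r_m,\mathcal N_\ell)\ge\frac12r_{\ell m}$ for all $\ell,m$ (no condition for those $\ell$ with $\mathcal N_\ell=\emptyset$). Given such a partition, define, for all $(\bm r',\widehat v')$ in place of $(\bm r,\widehat v)$ with the $\mathcal N_\ell$ kept fixed, $$E_\ell=E_\ell^{\rm band}+\int_{\mathcal N_\ell}\varepsilon_{\rm xc}(\rho),\quad E^{\rm band}_\ell={\rm tr}\big[(H_0-\mu)F(\mathcal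 H)+\beta^{-1}S(F(\mathcal H))\big]_{\ell\ell},\quad \rho_\ell(x)=2\sum_{k}\phi_\ell(x)^{\rm T}F(\mathcal H)_{\ell k}\phi_k(x).$$ **Theorem (Locality).** Let $\mathfrak m>0$ and $B\in\mathbb R$. There are $\eta>0$ and $C$, depending on $(\beta,\mathsf g_-,\mathsf g_+)$ and on the fixed data $\phi,\Xi,Z\mapsto$ charge, $\varepsilon_{\rm xc},\mu,\mathfrak m,B$, but not otherwise on $M$, the species, $\bm r$ or $\widehat v$, such that the following holds for all $M\ge 1$, all species, all $\bm r$ with $r_{ij}\ge\mathfrak m$ for $i\ne j$, all $\widehat v$ with $\|\widehat v\|_{\ell^\infty}\le B$, and all $\beta\in(0,\infty]$ such that $\beta<\infty$ or $\mathsf g_\pm>0$. 1. There is a partition admissible for $\bm r$, and for every such partition $$\mathcal G=\sum_\ell E_\ell+E_{\rm el}[\rho],\qquad \rho=\sum_\ell\rho_\ell$$ hold identically in the positions and features (all integrals being convergent). 2. For every such partition, $E_\ell$ and $\rho_\ell(\cdot\,;x)$ are differentiable at $(\bm r,\widehat v)$ and, for all $\ell,k$ and $x\in\mathbb R^3$,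 $$\Big|\frac{\partial E_\ell}{\partial\bm r_k}\Big|+\Big|\frac{\partial E_\ell}{\partial\widehat v_k}\Big|\le Ce^{-\eta r_{\ell k}},\qquad \Big|\frac{\partial\rho_\ell(x)}{\partial\bm r_k}\Big|+\Big|\frac{\partial\rho_\ell(x)}{\partial\widehat v_k}\Big|\le Ce^{-\eta[|x-\bm r_\ell|+r_{\ell k}+|\bm r_k-x|]}.$$ 3. For $\beta<\infty$, $\eta\sim\beta^{-1}+\min\{\mathsf g_-,\mathsf g_+\}$ as $\beta^{-1}+\mathsf g\to0$; for $\beta=\infty$, $\eta\sim\mathsf g$ as $\mathsf g\to0$. (Here $f\sim g$ means $c_1g\le f\le c_2g$ near the limit with positive constants depending only on the fixed data.) 4. (Higher derivatives.) Let $1\le j\le\nu-1$. With $\eta,C$ now depending also on $j$, and $\eta$ again as in 3, the functions $E^{\rm band}_\ell$ and $\rho_\ell(\cdot\,;x)$ are $C^j$ near $(\bm r,\widehat v)$, and for all $\ell,k_1,\dots,k_j$ and $x$ their mixed derivatives of order $j$ with respect to $(\bm r_{k_1},\widehat v_{k_1}),\dots,(\bm r_{k_j},\widehat v_{k_j})$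 are bounded by $Ce^{-\eta\sum_ir_{\ell k_i}}$ and $Ce^{-\eta[|x-\bm r_\ell|+\sum_i(r_{\ell k_i}+|\bm r_{k_i}-x|)]}$, respectively. If $j=2$ and $\varepsilon_{\rm xc}\in C^2((0,\infty))$ with $|\varepsilon_{\rm xc}''(\rho)|\le C'\rho^{-2/3}$, the same regularity and the bound $Ce^{-\eta(r_{\ell k_1}+r_{\ell k_2})}$ hold for $E_\ell$ itself, for every partition admissible for $\bm r$. -/

import Mathlib

open MeasureTheory Matrix
open scoped ENNReal

noncomputable section

/-- Physical space. -/
abbrev R3 : Type := EuclideanSpace ℝ (Fin 3)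

/-- The fixed data of the tight-binding / machine-learning model: for each atomic species in `S`,
`Nb` orbitals and a nuclear charge; `Nc` feature functions; and an LDA exchange-correlation energy
density (only its values on `[0, ∞)` matter). -/
structure TBModel (S : Type*) (Nb Nc : ℕ) where
  orbital : S → Fin Nb → R3 → ℝ
  feature : Fin Nc → R3 → ℝ
  charge : S → ℝ
  exc : ℝ → ℝ

/-- `f` is `ν` times continuously differentiable and all its derivatives up to order `ν` are
bounded by `c * exp (-η |x|)`. -/
def ExpLocalised (ν : ℕ) (c η : ℝ) (f : R3 → ℝ) : Prop :=
  ContDiff ℝ ν f ∧ ∀ n ≤ ν, ∀ x, ‖iteratedFDeriv ℝ n f x‖ ≤ c * Real.exp (-η * ‖x‖)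

/-- Assumptions on the exchange-correlation energy density: twice differentiable on `(0, ∞)`,
`exc ∼ -ρ ^ (4/3)` near zero and `-ρ ^ (1/3) ≲ exc' ≤ 0` on `(0, ∞)`. -/
structure AdmissibleExc (exc : ℝ → ℝ) : Prop where
  differentiableOn : DifferentiableOn ℝ exc (Set.Ioi 0)
  differentiableOn_deriv : DifferentiableOn ℝ (deriv exc) (Set.Ioi 0)
  near_zero : ∃ c₁ c₂ δ : ℝ, 0 < c₁ ∧ 0 < c₂ ∧ 0 < δ ∧ ∀ ρ, 0 ≤ ρ → ρ < δ →
    c₁ * ρ ^ (4 / 3 : ℝ) ≤ -exc ρ ∧ -exc ρ ≤ c₂ * ρ ^ (4 / 3 : ℝ)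
  deriv_bound : ∃ C : ℝ, ∀ ρ, 0 < ρ →
    -(C * ρ ^ (1 / 3 : ℝ)) ≤ deriv exc ρ ∧ deriv exc ρ ≤ 0

/-- The control on the second derivative of the exchange-correlation energy density that
corresponds to the behaviour `-ρ ^ (4/3)`; used for second derivatives of site energies only. -/
def SecondOrderExc (exc : ℝ → ℝ) : Prop :=
  ContDiffOn ℝ 2 exc (Set.Ioi 0) ∧
    ∃ C : ℝ, ∀ ρ, 0 < ρ → |deriv (deriv exc) ρ| ≤ C * ρ ^ (-(2 / 3) : ℝ)

/-- Fermi-Dirac occupation numbers. For `β = ∞` this is `χ_{(-∞,μ)} + ½ χ_{μ}`. -/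
def fermiDirac (β : ℝ≥0∞) (μ x : ℝ) : ℝ :=
  if β = ⊤ then (if x < μ then 1 else if x = μ then 1 / 2 else 0)
  else (1 + Real.exp (β.toReal * (x - μ)))⁻¹

/-- Fermi-Dirac entropy (with `0 log 0 = 0`). -/
def fermiEntropy (x : ℝ) : ℝ := x * Real.log x + (1 - x) * Real.log (1 - x)

namespace TBModel

variable {S : Type*} {Nb Nc : ℕ}

/-- Standing assumptions: exponentially localised orbitals and feature functions, of smoothness
`ν`, and an admissible exchange-correlation energy density. -/
structure Admissible (𝓜 : TBModel S Nb Nc) (ν : ℕ) : Prop where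
  orbital : ∃ c η : ℝ, 0 < c ∧ 0 < η ∧ ∀ s a, ExpLocalised ν c η (𝓜.orbital s a)
  feature : ∃ c η : ℝ, 0 < c ∧ 0 < η ∧ ∀ a, ExpLocalised ν c η (𝓜.feature a)
  exc : AdmissibleExc 𝓜.exc

variable (𝓜 : TBModel S Nb Nc) {M : ℕ} (Z : Fin M → S)

/-- The vector of all atom-centred orbitals `φ_{ℓa} = φ_{Z_ℓ,a}(· - r_ℓ)`. -/
def phi (r : Fin M → R3) (i : Fin M × Fin Nb) (x : R3) : ℝ :=
  𝓜.orbital (Z i.1) i.2 (x - r i.1)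

/-- `[H₀]_{ℓk,ab} = ½ ∫ ∇φ_{ℓa} · ∇φ_{kb}`. -/
def H0 (r : Fin M → R3) : Matrix (Fin M × Fin Nb) (Fin M × Fin Nb) ℝ :=
  Matrix.of fun i j =>
    (1 / 2) * ∫ x, inner ℝ (gradient (𝓜.phi Z r i) x) (gradient (𝓜.phi Z r j) x)

/-- The effective potential `v = ∑_{mc} v̂_{mc} ∫ φ ⊗ φ Ξ_c(· - r_m)`. -/
def potential (r : Fin M → R3) (v : Fin M → Fin Nc → ℝ) :
    Matrix (Fin M × Fin Nb) (Fin M × Fin Nb) ℝ :=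
  Matrix.of fun i j => ∑ m, ∑ c, v m c *
    ∫ x, 𝓜.phi Z r i x * 𝓜.phi Z r j x * 𝓜.feature c (x - r m)

/-- `H = H₀ + v`. -/
def hamiltonian (r : Fin M → R3) (v : Fin M → Fin Nc → ℝ) :
    Matrix (Fin M × Fin Nb) (Fin M × Fin Nb) ℝ :=
  𝓜.H0 Z r + 𝓜.potential Z r v

/-- The Hamiltonian is symmetric, so that the functional calculus below is the usual spectral one
(and not the junk value for matrices that are not self-adjoint). -/
theorem hamiltonian_isHermitian (r : Fin M → R3) (v : Fin M → Fin Nc → ℝ) :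
    (𝓜.hamiltonian Z r v).IsHermitian := by
  ext i j
  simp only [hamiltonian, H0, potential, Matrix.conjTranspose_apply, Matrix.add_apply,
    Matrix.of_apply, star_trivial]
  congr 1
  · simp only [real_inner_comm]
  · simp only [mul_comm (𝓜.phi Z r j _)]

/-- `F_{β,μ}(H₀ + v)`, through the functional calculus of symmetric matrices. -/
def fermiMatrix (β : ℝ≥0∞) (μ : ℝ) (r : Fin M → R3) (v : Fin M → Fin Nc → ℝ) :
    Matrix (Fin M × Fin Nb) (Fin M × Fin Nb) ℝ :=
  cfc (fermiDirac β μ) (𝓜.hamiltonian Z r v)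

/-- `g₋ = dist(μ, σ(H) ∩ (-∞, μ])`, equal to `∞` if there is no such spectrum. -/
def gapMinus (μ : ℝ) (r : Fin M → R3) (v : Fin M → Fin Nc → ℝ) : ℝ≥0∞ :=
  Metric.infEDist μ (spectrum ℝ (𝓜.hamiltonian Z r v) ∩ Set.Iic μ)

/-- `g₊ = dist(μ, σ(H) ∩ [μ, ∞))`, equal to `∞` if there is no such spectrum. -/
def gapPlus (μ : ℝ) (r : Fin M → R3) (v : Fin M → Fin Nc → ℝ) : ℝ≥0∞ :=
  Metric.infEDist μ (spectrum ℝ (𝓜.hamiltonian Z r v) ∩ Set.Ici μ)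

/-- The matrix `(H₀ - μ) F + β⁻¹ S(F)` with `F = F_{β,μ}(H₀ + v)`; at `β = ∞` there is no entropy
contribution because `∞⁻¹ = 0`. -/
def bandMatrix (β : ℝ≥0∞) (μ : ℝ) (r : Fin M → R3) (v : Fin M → Fin Nc → ℝ) :
    Matrix (Fin M × Fin Nb) (Fin M × Fin Nb) ℝ :=
  (𝓜.H0 Z r - μ • 1) * 𝓜.fermiMatrix Z β μ r v +
    (β⁻¹).toReal • cfc fermiEntropy (𝓜.fermiMatrix Z β μ r v)

/-- The electron density `ρ(r, v̂; x) = 2 φ(x)ᵀ F_{β,μ}(H₀ + v) φ(x)`. -/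
def density (β : ℝ≥0∞) (μ : ℝ) (r : Fin M → R3) (v : Fin M → Fin Nc → ℝ) (x : R3) : ℝ :=
  2 * ((fun i => 𝓜.phi Z r i x) ⬝ᵥ (𝓜.fermiMatrix Z β μ r v *ᵥ fun i => 𝓜.phi Z r i x))

/-- The potential `V^nuc(x) = -∑_i Z_i / |x - r_i|` of the nuclei. -/
def nuclearPotential (r : Fin M → R3) (x : R3) : ℝ :=
  -∑ i, 𝓜.charge (Z i) / ‖x - r i‖

/-- The Coulomb potential `v_C ρ(x) = ∫ ρ(y) / |x - y| dy`. -/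
def _root_.coulombPotential (ρ : R3 → ℝ) (x : R3) : ℝ := ∫ y, ρ y / ‖x - y‖

/-- `E_el[ρ] = ∫ (ρ V^nuc + ½ ρ v_C ρ)`. -/
def electrostatic (r : Fin M → R3) (ρ : R3 → ℝ) : ℝ :=
  ∫ x, (ρ x * 𝓜.nuclearPotential Z r x + (1 / 2) * (ρ x * coulombPotential ρ x))

/-- The grand-canonical free energy `𝒢(r, v̂)`. -/
def freeEnergy (β : ℝ≥0∞) (μ : ℝ) (r : Fin M → R3) (v : Fin M → Fin Nc → ℝ) : ℝ :=
  (𝓜.bandMatrix Z β μ r v).trace +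
    ∫ x, (𝓜.density Z β μ r v x * 𝓜.nuclearPotential Z r x +
      (1 / 2) * (𝓜.density Z β μ r v x * coulombPotential (𝓜.density Z β μ r v) x) +
      𝓜.exc (𝓜.density Z β μ r v x))

/-- `tr [(H₀ - μ) F + β⁻¹ S(F)]_{ℓℓ}`, the trace of the diagonal block of atom `ℓ`. -/
def bandSiteEnergy (β : ℝ≥0∞) (μ : ℝ) (ℓ : Fin M) (r : Fin M → R3)
    (v : Fin M → Fin Nc → ℝ) : ℝ :=
  ∑ a, 𝓜.bandMatrix Z β μ r v (ℓ, a) (ℓ, a)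

/-- The site energy `E_ℓ = tr [(H₀ - μ) F + β⁻¹ S(F)]_{ℓℓ} + ∫_{𝒩_ℓ} exc(ρ)`. -/
def siteEnergy (β : ℝ≥0∞) (μ : ℝ) (𝒩 : Fin M → Set R3) (ℓ : Fin M) (r : Fin M → R3)
    (v : Fin M → Fin Nc → ℝ) : ℝ :=
  𝓜.bandSiteEnergy Z β μ ℓ r v + ∫ x in 𝒩 ℓ, 𝓜.exc (𝓜.density Z β μ r v x)

/-- The atomic density `ρ_ℓ(r, v̂; x) = 2 ∑_k φ_ℓ(x)ᵀ F_{ℓk} φ_k(x)`. -/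
def siteDensity (β : ℝ≥0∞) (μ : ℝ) (ℓ : Fin M) (r : Fin M → R3) (v : Fin M → Fin Nc → ℝ)
    (x : R3) : ℝ :=
  2 * ∑ k, ∑ a, ∑ b,
    𝓜.phi Z r (ℓ, a) x * 𝓜.fermiMatrix Z β μ r v (ℓ, a) (k, b) * 𝓜.phi Z r (k, b) x

/-- The decomposition `𝒢 = ∑_ℓ E_ℓ + E_el[ρ]`, `ρ = ∑_ℓ ρ_ℓ` at `(r, v̂)`, together with the
convergence of all the integrals that occur in it. -/
structure Decomposes (β : ℝ≥0∞) (μ : ℝ) (𝒩 : Fin M → Set R3) (r : Fin M → R3)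
    (v : Fin M → Fin Nc → ℝ) : Prop where
  integrable_nuclear :
    Integrable fun x => 𝓜.density Z β μ r v x * 𝓜.nuclearPotential Z r x
  integrable_coulomb : ∀ x, Integrable fun y => 𝓜.density Z β μ r v y / ‖x - y‖
  integrable_hartree :
    Integrable fun x => 𝓜.density Z β μ r v x * coulombPotential (𝓜.density Z β μ r v) x
  integrable_exc : Integrable fun x => 𝓜.exc (𝓜.density Z β μ r v x)
  energy : 𝓜.freeEnergy Z β μ r v =
    (∑ ℓ, 𝓜.siteEnergy Z β μ 𝒩 ℓ r v) + 𝓜.electrostatic Z r (𝓜.density Z β μ r v)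
  density : ∀ x, 𝓜.density Z β μ r v x = ∑ ℓ, 𝓜.siteDensity Z β μ ℓ r v x

end TBModel

/-- A partition `ℝ³ = ⋃ 𝒩_ℓ` into disjoint measurable sets, indexed by the atoms, with
`dist(r_m, 𝒩_ℓ) ≥ ½ |r_ℓ - r_m|` (for instance Voronoi cells). -/
structure IsSitePartition {M : ℕ} (r : Fin M → R3) (𝒩 : Fin M → Set R3) : Prop where
  measurableSet : ∀ ℓ, MeasurableSet (𝒩 ℓ)
  disjoint : Pairwise (Function.onFun Disjoint 𝒩)
  cover : ⋃ ℓ, 𝒩 ℓ = Set.univ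
  dist_ge : ∀ ℓ m, ∀ x ∈ 𝒩 ℓ, (1 / 2) * dist (r ℓ) (r m) ≤ dist (r m) x

/-- Finite Fermi-temperature, or zero Fermi-temperature and a spectral gap at `μ`. -/
def FiniteTempOrGap (β gm gp : ℝ≥0∞) : Prop := 0 < β ∧ (β < ⊤ ∨ (0 < gm ∧ 0 < gp))

/-- A positive exponent, as a function of `β` and the gaps, with
`η ∼ β⁻¹ + min {gm, gp}` as `β⁻¹ + g → 0` if `β < ∞`, and `η ∼ g` as `g → 0` if `β = ∞`,
where `g = gm + gp`. -/
def IsDecayRate (η : ℝ≥0∞ → ℝ≥0∞ → ℝ≥0∞ → ℝ) : Prop :=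
  (∀ β gm gp, FiniteTempOrGap β gm gp → 0 < η β gm gp) ∧
  ∃ c₁ c₂ δ : ℝ, 0 < c₁ ∧ 0 < c₂ ∧ 0 < δ ∧ ∀ β gm gp, FiniteTempOrGap β gm gp →
    β⁻¹ + (gm + gp) < ENNReal.ofReal δ →
    (β < ⊤ → c₁ * (β⁻¹ + min gm gp).toReal ≤ η β gm gp ∧
      η β gm gp ≤ c₂ * (β⁻¹ + min gm gp).toReal) ∧
    (β = ⊤ → c₁ * (gm + gp).toReal ≤ η β gm gp ∧ η β gm gp ≤ c₂ * (gm + gp).toReal)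

/-- `∂f/∂r_k`, as a linear functional (its operator norm is the Euclidean norm of the gradient). -/
def partialPos {M Nc : ℕ} (f : (Fin M → R3) → (Fin M → Fin Nc → ℝ) → ℝ) (k : Fin M)
    (r : Fin M → R3) (v : Fin M → Fin Nc → ℝ) : R3 →L[ℝ] ℝ :=
  fderiv ℝ (fun s => f (Function.update r k s) v) (r k)

/-- `∂f/∂v̂_k`, as a linear functional. -/
def partialFeat {M Nc : ℕ} (f : (Fin M → R3) → (Fin M → Fin Nc → ℝ) → ℝ) (k : Fin M)
    (r : Fin M → R3) (v : Fin M → Fin Nc → ℝ) : (Fin Nc → ℝ) →L[ℝ] ℝ :=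
  fderiv ℝ (fun w => f r (Function.update v k w)) (v k)

/-- The mixed derivative of order `j` of `f` with respect to
`(r_{k 0}, v̂_{k 0}), …, (r_{k (j-1)}, v̂_{k (j-1)})` is bounded by `A` (as a multilinear form). -/
def MixedDerivBound {M Nc : ℕ} (f : (Fin M → R3) → (Fin M → Fin Nc → ℝ) → ℝ) (j : ℕ)
    (k : Fin j → Fin M) (r : Fin M → R3) (v : Fin M → Fin Nc → ℝ) (A : ℝ) : Prop :=
  ∀ h : Fin j → R3 × (Fin Nc → ℝ),
    |iteratedFDeriv ℝ j (fun p : (Fin M → R3) × (Fin M → Fin Nc → ℝ) => f p.1 p.2) (r, v)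
      (fun i => (Pi.single (k i) (h i).1, Pi.single (k i) (h i).2))| ≤ A * ∏ i, ‖h i‖

end

/-! One change of variables gives the estimates of all orders. Fix a site `ℓ`, let atom `k` move at
scale `τ k = exp (η r_{ℓk})`, and regard a site quantity as a function of the rescaled displacement
`h`. If its derivatives at `h = 0` up to order `N` are bounded by `C`, then undoing the scaling
bounds the mixed derivatives by `C ∏ (τ k_i)⁻¹ = C exp (-η ∑ r_{ℓk_i})`. So it suffices to bound
jets of rescaled functions uniformly.

The property that propagates is locality of matrices indexed by atoms: the jet of the entry `(i, j)`
has scale `τ i` and a prefactor that decays exponentially in `r_{ij}`. Weights of two atoms differ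
by a factor of at most `exp (η r_{ij})`, so replacing one by the other in up to `N` derivatives
costs `exp (N η r_{ij})`, and off-diagonal decay pays for it (`JetBound.absorb_exp`). Since the
atoms are separated, sums over them are bounded independently of `M` (`sum_exp_neg_dist_le`).

The Hamiltonian is local because its entries are integrals of products of localised functions. Its
resolvent at distance `d` from the spectrum decays at a rate proportional to `d`
(`Matrix.IsHermitian.combesThomas`), and the resolvent identity carries this to derivatives
(`jetBound_shifted_inv`). By Cauchy's formula `F`, `√F` and `S ∘ F` are bounded linear functionals
of the resolvent along a contour; the whole contour is handled at once, as one element `z` of the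
Banach algebra `C(I, ℂ)` (`HasResolventRep`). The distance from contour to spectrum fixes the rate.
At finite temperature it is of the order of the larger of `β⁻¹` and the smaller gap, up to the
cut-off at `1`; at zero temperature the contour crosses the middle of the gap, so that the total gap
counts.

Band energies and atomic densities are sums of products of local entries. The exchange-correlation
term has the extra difficulty that `exc` is not smooth at zero density, while the density tends to
zero at infinity. The remedy is to write `ρ = 2 |q|²` with `q = √F(H) φ(x)`: the map `q ↦ exc (2
|q|²)` is `C¹`, and `C²` under the second-order hypothesis, with derivatives of size `|q| ^ (2/3)`,
uniformly in the dimension (`ExcSmooth`). On the cell of `ℓ` the distance from `x` to `r k` is at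
least `r_{ℓk} / 2`, so the decay of `q` in `x` absorbs the weights and still leaves an integrable
function. -/

/-! ### Jet bounds -/

section JetBound

variable {E F G A : Type*} [NormedAddCommGroup E] [NormedSpace ℝ E]
  [NormedAddCommGroup F] [NormedSpace ℝ F] [NormedAddCommGroup G] [NormedSpace ℝ G]

open Filter Topology

/-- `g` is `C^N` at `x` and its `n`-th derivative at `x` is bounded by `c * t ^ n`, `n ≤ N`. -/
structure JetBound (N : ℕ) (g : E → F) (x : E) (c t : ℝ) : Prop where
  contDiffAt : ContDiffAt ℝ N g x
  bound : ∀ n ≤ N, ‖iteratedFDeriv ℝ n g x‖ ≤ c * t ^ n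

/-- On an open set, derivatives within the set are the ordinary ones, so this transfers estimates on
sets to estimates at a point. -/
theorem ContDiffAt.exists_isOpen_contDiffOn {N : ℕ} {g : E → F} {x : E}
    (h : ContDiffAt ℝ N g x) : ∃ s, IsOpen s ∧ x ∈ s ∧ ContDiffOn ℝ N g s := by
  have h1 : ∀ᶠ y in 𝓝 x, ContDiffAt ℝ N g y := h.eventually (by simp)
  obtain ⟨s, hs, hso, hxs⟩ := eventually_nhds_iff.1 h1
  exact ⟨s, hso, hxs, fun y hy => (hs y hy).contDiffWithinAt⟩

namespace JetBound

variable {N : ℕ} {g : E → F} {x : E} {c t : ℝ}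

theorem norm_le (h : JetBound N g x c t) : ‖g x‖ ≤ c := by
  simpa using h.bound 0 (Nat.zero_le _)

theorem nonneg (h : JetBound N g x c t) : 0 ≤ c := (norm_nonneg _).trans h.norm_le

theorem mono (h : JetBound N g x c t) {c' t' : ℝ} (hc : c ≤ c') (ht0 : 0 ≤ t) (ht : t ≤ t') :
    JetBound N g x c' t' :=
  ⟨h.contDiffAt, fun n hn => (h.bound n hn).trans <|
    mul_le_mul hc (pow_le_pow_left₀ ht0 ht n) (by positivity) (h.nonneg.trans hc)⟩

theorem mono_const (h : JetBound N g x c t) {c' : ℝ} (hc : c ≤ c') (ht0 : 0 ≤ t) :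
    JetBound N g x c' t := h.mono hc ht0 le_rfl

/-- A constant factor in the scale can be moved into the prefactor. -/
theorem absorb {a : ℝ} (ha : 1 ≤ a) (ht : 0 ≤ t) (h : JetBound N g x c (a * t)) :
    JetBound N g x (c * a ^ N) t :=
  ⟨h.contDiffAt, fun n hn => (h.bound n hn).trans <| by
    rw [mul_pow, mul_assoc]
    have := h.nonneg
    gcongr⟩

theorem const (y : F) (x : E) (ht : 0 ≤ t) : JetBound N (fun _ => y) x ‖y‖ t := by
  refine ⟨contDiffAt_const, fun n _ => ?_⟩
  rcases Nat.eq_zero_or_pos n with rfl | hn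
  · simp
  · rw [iteratedFDeriv_const_of_ne hn.ne']
    simp only [Pi.zero_apply, norm_zero]
    positivity

theorem congr (h : JetBound N g x c t) {g' : E → F} (hg : g' =ᶠ[𝓝 x] g) :
    JetBound N g' x c t :=
  ⟨h.contDiffAt.congr_of_eventuallyEq hg, fun n hn => by
    rw [(hg.iteratedFDeriv ℝ n).eq_of_nhds]; exact h.bound n hn⟩

theorem sum {ι : Type*} (s : Finset ι) {g : ι → E → F} {c : ι → ℝ}
    (h : ∀ i ∈ s, JetBound N (g i) x (c i) t) :
    JetBound N (fun y => ∑ i ∈ s, g i y) x (∑ i ∈ s, c i) t := by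
  refine ⟨ContDiffAt.sum fun i hi => (h i hi).contDiffAt, fun n hn => ?_⟩
  rw [iteratedFDeriv_fun_sum_apply fun i hi =>
    (h i hi).contDiffAt.of_le (by exact_mod_cast hn), Finset.sum_mul]
  exact norm_sum_le_of_le _ fun i hi => (h i hi).bound n hn

theorem add {g' : E → F} {c' : ℝ} (h : JetBound N g x c t) (h' : JetBound N g' x c' t) :
    JetBound N (fun y => g y + g' y) x (c + c') t := by
  refine ⟨h.contDiffAt.add h'.contDiffAt, fun n hn => ?_⟩
  rw [fun_iteratedFDeriv_add_apply (h.contDiffAt.of_le (by exact_mod_cast hn))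
    (h'.contDiffAt.of_le (by exact_mod_cast hn)), add_mul]
  exact norm_add_le_of_le (h.bound n hn) (h'.bound n hn)

theorem clm (h : JetBound N g x c t) (L : F →L[ℝ] G) :
    JetBound N (fun y => L (g y)) x (‖L‖ * c) t := by
  refine ⟨L.contDiff.contDiffAt.comp x h.contDiffAt, fun n hn => ?_⟩
  have := L.norm_iteratedFDeriv_comp_left h.contDiffAt (n := n) (by exact_mod_cast hn)
  refine this.trans ?_
  rw [mul_assoc]
  exact mul_le_mul_of_nonneg_left (h.bound n hn) (norm_nonneg _)

theorem norm_iteratedFDeriv_mul_le_of_contDiffAt [NormedRing A] [NormedAlgebra ℝ A]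
    {f g : E → A} {n : ℕ} (hf : ContDiffAt ℝ n f x) (hg : ContDiffAt ℝ n g x) :
    ‖iteratedFDeriv ℝ n (fun y => f y * g y) x‖ ≤ ∑ i ∈ Finset.range (n + 1),
      (n.choose i : ℝ) * ‖iteratedFDeriv ℝ i f x‖ * ‖iteratedFDeriv ℝ (n - i) g x‖ := by
  obtain ⟨s, hs, hxs, hfs⟩ := hf.exists_isOpen_contDiffOn
  obtain ⟨u, hu, hxu, hgu⟩ := hg.exists_isOpen_contDiffOn
  have ho : IsOpen (s ∩ u) := hs.inter hu
  have hx : x ∈ s ∩ u := ⟨hxs, hxu⟩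
  have := norm_iteratedFDerivWithin_mul_le (𝕜 := ℝ) (hfs.mono Set.inter_subset_left)
    (hgu.mono Set.inter_subset_right) ho.uniqueDiffOn hx (n := n) le_rfl
  simpa only [iteratedFDerivWithin_of_isOpen _ ho hx] using this

/-- Leibniz' rule turns geometric bounds into the binomial expansion of `(t + t') ^ n`. Bounds of
the form `c * t ^ n` are thus stable under products without combinatorial constants. -/
theorem mul [NormedRing A] [NormedAlgebra ℝ A] {f g : E → A} {c' t' : ℝ}
    (hf : JetBound N f x c t) (hg : JetBound N g x c' t') :
    JetBound N (fun y => f y * g y) x (c * c') (t + t') := by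
  refine ⟨hf.contDiffAt.mul hg.contDiffAt, fun n hn => ?_⟩
  refine (norm_iteratedFDeriv_mul_le_of_contDiffAt
    (hf.contDiffAt.of_le (by exact_mod_cast hn))
    (hg.contDiffAt.of_le (by exact_mod_cast hn))).trans ?_
  rw [add_pow, Finset.mul_sum]
  refine Finset.sum_le_sum fun i hi => ?_
  have hi' : i ≤ n := Nat.lt_succ_iff.1 (Finset.mem_range.1 hi)
  calc (n.choose i : ℝ) * ‖iteratedFDeriv ℝ i f x‖ * ‖iteratedFDeriv ℝ (n - i) g x‖
      ≤ (n.choose i : ℝ) * (c * t ^ i) * (c' * t' ^ (n - i)) := by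
        have h1 := hf.bound i (hi'.trans hn)
        have h2 := hg.bound (n - i) ((Nat.sub_le _ _).trans hn)
        have h3 := (norm_nonneg _).trans h1
        gcongr
    _ = _ := by ring

theorem iteratedFDeriv_comp_affine {g : F → G} {n : ℕ} (b : F) (L : E →L[ℝ] F)
    (h : ContDiffAt ℝ n g (b + L x)) :
    iteratedFDeriv ℝ n (fun y => g (b + L y)) x =
      (iteratedFDeriv ℝ n g (b + L x)).compContinuousLinearMap fun _ => L := by
  have h' : ContDiffAt ℝ n (fun z => g (b + z)) (L x) :=
    h.comp (L x) (contDiffAt_const.add contDiffAt_id)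
  obtain ⟨s, hs, hxs, hgs⟩ := h'.exists_isOpen_contDiffOn
  have ho : IsOpen (L ⁻¹' s) := hs.preimage L.continuous
  have h3 := L.iteratedFDerivWithin_comp_right hgs hs.uniqueDiffOn ho.uniqueDiffOn
    (x := x) hxs (i := n) le_rfl
  rw [iteratedFDerivWithin_of_isOpen _ ho hxs, iteratedFDerivWithin_of_isOpen _ hs hxs,
    iteratedFDeriv_comp_add_left] at h3
  exact h3

/-- Used for moving centres and feature coefficients, where the linear part has norm at most the
weight of one atom. -/
theorem comp_affine {g : F → G} (b : F) (L : E →L[ℝ] F) {s : ℝ} (hL : ‖L‖ ≤ s)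
    (h : JetBound N g (b + L x) c t) :
    JetBound N (fun y => g (b + L y)) x c (t * s) := by
  refine ⟨h.contDiffAt.comp x (contDiffAt_const.add L.contDiff.contDiffAt), fun n hn => ?_⟩
  rw [iteratedFDeriv_comp_affine b L (h.contDiffAt.of_le (by exact_mod_cast hn))]
  refine (ContinuousMultilinearMap.norm_compContinuousLinearMap_le _ _).trans ?_
  rw [Finset.prod_const, Finset.card_univ, Fintype.card_fin, mul_pow, ← mul_assoc]
  have h1 := h.bound n hn
  have h2 : 0 ≤ c * t ^ n := (norm_nonneg _).trans h1
  gcongr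

/-- The estimate for composites wants the inner derivatives bounded by `D ^ i` without prefactor. As
`i ≥ 1`, `c ≤ (1 + c) ^ i`, and `D = (1 + c) * t` will do. -/
theorem comp {g : F → G} {q : E → F} {C : ℝ} (hg : ContDiff ℝ N g)
    (hC : ∀ n ≤ N, ‖iteratedFDeriv ℝ n g (q x)‖ ≤ C) (hq : JetBound N q x c t) (ht : 0 ≤ t) :
    JetBound N (fun y => g (q y)) x (N.factorial * C) ((1 + c) * t) := by
  refine ⟨hg.contDiffAt.comp x hq.contDiffAt, fun n hn => ?_⟩
  obtain ⟨s, hs, hxs, hqs⟩ := hq.contDiffAt.exists_isOpen_contDiffOn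
  have h1 := norm_iteratedFDerivWithin_comp_le (n := n) (D := (1 + c) * t) (C := C)
    hg.contDiffOn hqs (by exact_mod_cast hn) uniqueDiffOn_univ hs.uniqueDiffOn
    (Set.mapsTo_univ _ _) hxs
    (fun i hi => by rw [iteratedFDerivWithin_univ]; exact hC i (hi.trans hn))
    (fun i h1 hi => by
      rw [iteratedFDerivWithin_of_isOpen _ hs hxs, mul_pow]
      refine (hq.bound i (hi.trans hn)).trans ?_
      have h0 := hq.nonneg
      gcongr
      calc c ≤ 1 + c := by linarith
        _ ≤ (1 + c) ^ i := le_self_pow₀ (by linarith) (by omega))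
  rw [iteratedFDerivWithin_of_isOpen _ hs hxs] at h1
  refine h1.trans ?_
  have h0 := hq.nonneg
  have hC0 : 0 ≤ C := (norm_nonneg _).trans (hC 0 (Nat.zero_le _))
  gcongr

/-- The jet of a function that is `C^N` at a point is bounded on a neighbourhood. -/
theorem eventually_of_contDiffAt {g : E → F} (h : ContDiffAt ℝ N g x) :
    ∃ c, 0 ≤ c ∧ ∀ᶠ y in 𝓝 x, JetBound N g y c 1 := by
  have h1 : ∀ n ∈ Finset.range (N + 1), ∀ᶠ y in 𝓝 x,
      ‖iteratedFDeriv ℝ n g y‖ ≤ ‖iteratedFDeriv ℝ n g x‖ + 1 := fun n hn => by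
    have hn' : n ≤ N := Nat.lt_succ_iff.1 (Finset.mem_range.1 hn)
    have : ContDiffAt ℝ 0 (iteratedFDeriv ℝ n g) x :=
      h.iteratedFDeriv_right (by rw [zero_add]; exact_mod_cast hn')
    have := this.continuousAt.norm.eventually_lt continuousAt_const (lt_add_one _)
    exact this.mono fun y hy => hy.le
  refine ⟨∑ n ∈ Finset.range (N + 1), (‖iteratedFDeriv ℝ n g x‖ + 1), by positivity, ?_⟩
  filter_upwards [h.eventually (by simp), (Finset.eventually_all _).2 h1] with y hy hy'
  refine ⟨hy, fun n hn => ?_⟩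
  rw [one_pow, mul_one]
  have hn' := Finset.mem_range.2 (Nat.lt_succ_iff.2 hn)
  exact (hy' n hn').trans (Finset.single_le_sum
    (f := fun n => ‖iteratedFDeriv ℝ n g x‖ + 1) (fun i _ => by positivity) hn')

/-! ### Differentiation under the integral sign -/

section Integral

variable {X : Type*} [NormedAddCommGroup X] [NormedSpace ℝ X]

/-- A partial derivative is the joint derivative restricted to one factor. Its continuity in the
integration variable supplies the measurability needed for integrals. -/
theorem continuous_iteratedFDeriv_partial {J : X → E → F} {h : E} {n : ℕ}
    (hJ : ∀ x, ContDiffAt ℝ n (Function.uncurry J) (x, h)) :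
    Continuous fun x => iteratedFDeriv ℝ n (J x) h := by
  have h1 : ∀ x, iteratedFDeriv ℝ n (J x) h =
      (iteratedFDeriv ℝ n (Function.uncurry J) (x, h)).compContinuousLinearMap
        fun _ => ContinuousLinearMap.inr ℝ X E := fun x => by
    have := iteratedFDeriv_comp_affine (x := h) (g := Function.uncurry J) (n := n) (x, 0)
      (ContinuousLinearMap.inr ℝ X E) (by simpa using hJ x)
    simpa using this
  simp_rw [h1]
  refine (ContinuousMultilinearMap.compContinuousLinearMapL (𝕜 := ℝ) (ι := Fin n)
    fun _ => ContinuousLinearMap.inr ℝ X E).continuous.comp ?_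
  refine continuous_iff_continuousAt.2 fun x => ?_
  have h2 : ContDiffAt ℝ 0 (iteratedFDeriv ℝ n (Function.uncurry J)) (x, h) :=
    (hJ x).iteratedFDeriv_right (by simp)
  exact h2.continuousAt.comp (f := fun x => (x, h)) (by fun_prop)

/-- Differentiation under the integral sign, to order `N`. -/
theorem integral [MeasurableSpace X] [BorelSpace X] [SecondCountableTopology X]
    [CompleteSpace F] {m : Measure X} {J : X → E → F} {x₀ : E} {U : Set E}
    (hU : U ∈ 𝓝 x₀) {b c : X → ℝ} {C t : ℝ}
    (hJ : ∀ x, ∀ h ∈ U, ContDiffAt ℝ N (Function.uncurry J) (x, h))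
    (hb : ∀ᵐ x ∂m, ∀ h ∈ U, ∀ n ≤ N, ‖iteratedFDeriv ℝ n (J x) h‖ ≤ b x) (hbi : Integrable b m)
    (hc : ∀ᵐ x ∂m, JetBound N (J x) x₀ (c x) t) (hci : Integrable c m) (hC : ∫ x, c x ∂m ≤ C)
    (ht : 0 ≤ t) :
    JetBound N (fun h => ∫ x, J x h ∂m) x₀ C t := by
  obtain ⟨V, hVU, hVo, hxV⟩ := mem_nhds_iff.1 hU
  have hJx : ∀ x, ∀ h ∈ V, ContDiffAt ℝ N (J x) h := fun x h hh =>
    (hJ x h (hVU hh)).comp (f := fun h => (x, h)) h (contDiffAt_const.prodMk contDiffAt_id)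
  have hmeas : ∀ n ≤ N, ∀ h ∈ V, AEStronglyMeasurable (fun x => iteratedFDeriv ℝ n (J x) h) m :=
    fun n hn h hh => (continuous_iteratedFDeriv_partial fun x =>
      (hJ x h (hVU hh)).of_le (by exact_mod_cast hn)).aestronglyMeasurable
  have hint : ∀ n ≤ N, ∀ h ∈ V, Integrable (fun x => iteratedFDeriv ℝ n (J x) h) m :=
    fun n hn h hh => hbi.mono' (hmeas n hn h hh) (hb.mono fun x hx => hx h (hVU hh) n hn)
  -- The integrated derivatives form a Taylor series on `V`. The majorant `b`, uniform near `x₀`,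
  -- serves only to justify this; the final estimate comes from `c`, which concerns `x₀` alone.
  have key : HasFTaylorSeriesUpToOn N (fun h => ∫ x, J x h ∂m)
      (fun h n => ∫ x, iteratedFDeriv ℝ n (J x) h ∂m) V := by
    refine ⟨fun h hh => ?_, fun n hn h hh => ?_, fun n hn h hh => ?_⟩
    · rw [ContinuousMultilinearMap.curry0,
        ContinuousMultilinearMap.integral_apply (hint 0 (Nat.zero_le _) h hh)]
      simp
    · have hn' : n < N := by exact_mod_cast hn
      refine HasFDerivAt.hasFDerivWithinAt ?_
      have e1 : ∀ x, ∀ y ∈ V, HasFDerivAt (fun h => iteratedFDeriv ℝ n (J x) h)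
          (iteratedFDeriv ℝ (n + 1) (J x) y).curryLeft y := fun x y hy => by
        have d : DifferentiableAt ℝ (iteratedFDeriv ℝ n (J x)) y :=
          ((hJx x y hy).iteratedFDeriv_right (m := 1) (i := n)
            (by rw [add_comm]; exact_mod_cast hn')).differentiableAt (by simp)
        exact d.hasFDerivAt
      have hV : V ∈ 𝓝 h := hVo.mem_nhds hh
      have e2 := hasFDerivAt_integral_of_dominated_of_fderiv_le (𝕜 := ℝ) (μ := m)
        (F := fun h x => iteratedFDeriv ℝ n (J x) h) (x₀ := h) (bound := b)
        (F' := fun h x => (iteratedFDeriv ℝ (n + 1) (J x) h).curryLeft) hV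
        (by filter_upwards [hV] with y hy using hmeas n hn'.le y hy) (hint n hn'.le h hh)
        ((continuousMultilinearCurryLeftEquiv ℝ (fun _ : Fin (n + 1) => E)
          F).continuous.comp_aestronglyMeasurable (hmeas (n + 1) hn' h hh))
        (hb.mono fun x hx y hy => by
          rw [ContinuousMultilinearMap.curryLeft_norm]; exact hx y (hVU hy) (n + 1) hn')
        hbi (Eventually.of_forall fun x y hy => e1 x y hy)
      have e3 : (∫ x, (iteratedFDeriv ℝ (n + 1) (J x) h).curryLeft ∂m) =
          (∫ x, iteratedFDeriv ℝ (n + 1) (J x) h ∂m).curryLeft := by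
        have i1 := hint (n + 1) hn' h hh
        let Lc : (E [×(n + 1)]→L[ℝ] F) →L[ℝ] (E →L[ℝ] (E [×n]→L[ℝ] F)) :=
          (continuousMultilinearCurryLeftEquiv ℝ (fun _ : Fin (n + 1) => E)
            F).toContinuousLinearEquiv.toContinuousLinearMap
        exact ContinuousLinearMap.integral_comp_comm (𝕜 := ℝ) (Fₗ := E →L[ℝ] (E [×n]→L[ℝ] F)) Lc i1
      rw [e3] at e2
      exact e2
    · have hn' : n ≤ N := by exact_mod_cast hn
      refine ContinuousAt.continuousWithinAt ?_
      have hV : V ∈ 𝓝 h := hVo.mem_nhds hh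
      refine continuousAt_of_dominated
        (by filter_upwards [hV] with y hy using hmeas n hn' y hy)
        (by filter_upwards [hV] with y hy using hb.mono fun x hx => hx y (hVU hy) n hn') hbi ?_
      refine Eventually.of_forall fun x => ?_
      have : ContDiffAt ℝ 0 (iteratedFDeriv ℝ n (J x)) h :=
        (hJx x h hh).iteratedFDeriv_right (by rw [zero_add]; exact_mod_cast hn')
      exact this.continuousAt
  refine ⟨key.contDiffOn.contDiffAt (hVo.mem_nhds hxV), fun n hn => ?_⟩
  have h1 := key.eq_iteratedFDerivWithin_of_uniqueDiffOn (m := n) (by exact_mod_cast hn)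
    hVo.uniqueDiffOn hxV
  rw [iteratedFDerivWithin_of_isOpen _ hVo hxV] at h1
  rw [← h1]
  refine (norm_integral_le_of_norm_le (hci.mul_const (t ^ n))
    (hc.mono fun x hx => hx.bound n hn)).trans ?_
  rw [integral_mul_const]
  gcongr

end Integral

end JetBound

end JetBound

/-! ### Exponential integrals and packing -/

/-- From `y ^ 4 / 4! ≤ exp y` at `y = a * (1 + s)`. The power `4` exceeds the dimension `3`, so the
right-hand side is integrable. -/
theorem Real.exp_neg_mul_le_one_add_rpow {a s : ℝ} (ha : 0 < a) (hs : 0 ≤ s) :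
    Real.exp (-(a * s)) ≤ Real.exp a * (24 / a ^ 4) * (1 + s) ^ (-4 : ℝ) := by
  have h1 := Real.pow_div_factorial_le_exp (a * (1 + s)) (by positivity) 4
  have h2 : (1 + s) ^ (-4 : ℝ) = ((1 + s) ^ 4)⁻¹ := by
    rw [Real.rpow_neg (by positivity)]
    norm_cast
  rw [h2, Real.exp_neg, mul_assoc]
  have h3 : Real.exp (a * (1 + s)) = Real.exp a * Real.exp (a * s) := by
    rw [← Real.exp_add]; ring_nf
  rw [h3, mul_pow] at h1
  norm_num [Nat.factorial] at h1
  rw [div_le_iff₀ (by norm_num)] at h1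
  have h4 := Real.exp_pos (a * s)
  rw [inv_le_iff_one_le_mul₀ h4]
  have h5 : 0 < a ^ 4 * (1 + s) ^ 4 := by positivity
  calc 1 = (a ^ 4 * (1 + s) ^ 4) / (a ^ 4 * (1 + s) ^ 4) := (div_self h5.ne').symm
    _ ≤ (Real.exp a * Real.exp (a * s) * 24) / (a ^ 4 * (1 + s) ^ 4) := by gcongr
    _ = _ := by field_simp

theorem integrable_exp_neg_mul_norm {a : ℝ} (ha : 0 < a) :
    Integrable fun x : R3 => Real.exp (-(a * ‖x‖)) := by
  have h : Integrable fun x : R3 => (1 + ‖x‖) ^ (-4 : ℝ) :=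
    integrable_one_add_norm (by simp; norm_num)
  refine (h.const_mul (Real.exp a * (24 / a ^ 4))).mono' (by fun_prop) ?_
  refine Filter.Eventually.of_forall fun x => ?_
  rw [Real.norm_of_nonneg (Real.exp_pos _).le]
  exact Real.exp_neg_mul_le_one_add_rpow ha (norm_nonneg x)

theorem integrable_exp_neg_mul_dist {a : ℝ} (ha : 0 < a) (r : R3) :
    Integrable fun x : R3 => Real.exp (-(a * dist x r)) := by
  simpa only [dist_eq_norm] using (integrable_exp_neg_mul_norm ha).comp_sub_right r

/-- `∫ exp (-a |x|) dx`. -/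
noncomputable def expIntegral (a : ℝ) : ℝ := ∫ x : R3, Real.exp (-(a * ‖x‖))

theorem expIntegral_nonneg (a : ℝ) : 0 ≤ expIntegral a :=
  integral_nonneg fun _ => (Real.exp_pos _).le

theorem integral_exp_neg_mul_dist (a : ℝ) (r : R3) :
    ∫ x : R3, Real.exp (-(a * dist x r)) = expIntegral a := by
  simp only [dist_eq_norm, expIntegral]
  exact integral_sub_right_eq_self (fun x : R3 => Real.exp (-(a * ‖x‖))) r

/-- An upper bound for `∑ j, exp (-a |x - r j|)` over `𝔪`-separated points. -/
noncomputable def packingConst (a 𝔪 : ℝ) : ℝ :=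
  Real.exp (a * (𝔪 / 2)) * expIntegral a / volume.real (Metric.ball (0 : R3) (𝔪 / 2))

theorem packingConst_nonneg (a 𝔪 : ℝ) : 0 ≤ packingConst a 𝔪 := by
  have := expIntegral_nonneg a
  unfold packingConst
  positivity

/-- Balls of radius `𝔪 / 2` about the atoms are disjoint, and on each of them the exponential
changes by a factor of at most `exp (a * (𝔪 / 2))`. So the sum is bounded by an integral over space,
whatever the number of atoms. -/
theorem sum_exp_neg_dist_le {a 𝔪 : ℝ} (ha : 0 < a) (h𝔪 : 0 < 𝔪) {M : ℕ} {r : Fin M → R3}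
    (hr : ∀ i j, i ≠ j → 𝔪 ≤ dist (r i) (r j)) (x : R3) :
    ∑ j, Real.exp (-(a * dist x (r j))) ≤ packingConst a 𝔪 := by
  have hV : 0 < volume.real (Metric.ball (0 : R3) (𝔪 / 2)) := by
    rw [Measure.real, ENNReal.toReal_pos_iff]
    exact ⟨Metric.measure_ball_pos _ _ (by positivity), measure_ball_lt_top⟩
  rw [packingConst, le_div_iff₀ hV, Finset.sum_mul]
  have hint : Integrable fun y : R3 => Real.exp (-(a * dist y x)) :=
    integrable_exp_neg_mul_dist ha x
  have h1 : ∀ j, Real.exp (-(a * dist x (r j))) * volume.real (Metric.ball (0 : R3) (𝔪 / 2)) ≤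
      Real.exp (a * (𝔪 / 2)) * ∫ y in Metric.ball (r j) (𝔪 / 2), Real.exp (-(a * dist y x)) := by
    intro j
    have hb : volume.real (Metric.ball (0 : R3) (𝔪 / 2)) =
        volume.real (Metric.ball (r j) (𝔪 / 2)) := by
      rw [Measure.real, Measure.real, Measure.addHaar_ball_center volume (r j)]
    rw [hb, mul_comm (Real.exp _), ← smul_eq_mul (a := volume.real _), ← setIntegral_const,
      ← integral_const_mul]
    refine setIntegral_mono_on ?_ (hint.const_mul _).integrableOn measurableSet_ball ?_
    · exact integrableOn_const measure_ball_lt_top.ne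
    · intro y hy
      rw [← Real.exp_add]
      refine Real.exp_le_exp.2 ?_
      have h2 : dist y x ≤ dist y (r j) + dist x (r j) := dist_triangle_right _ _ _
      have h3 : dist y (r j) < 𝔪 / 2 := hy
      nlinarith
  refine (Finset.sum_le_sum fun j _ => h1 j).trans ?_
  rw [← Finset.mul_sum, ← integral_iUnion_fintype (fun j => measurableSet_ball) ?_
    fun j => hint.integrableOn, ← integral_exp_neg_mul_dist a x]
  · exact mul_le_mul_of_nonneg_left (setIntegral_le_integral hint
      (Filter.Eventually.of_forall fun y => (Real.exp_pos _).le)) (Real.exp_pos _).le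
  · intro i j hij
    exact Metric.ball_disjoint_ball (by linarith [hr i j hij])

theorem sum_exp_neg_dist_prod_le {a 𝔪 : ℝ} (ha : 0 < a) (h𝔪 : 0 < 𝔪) {M Nb : ℕ}
    {r : Fin M → R3} (hr : ∀ i j, i ≠ j → 𝔪 ≤ dist (r i) (r j)) (x : R3) :
    ∑ j : Fin M × Fin Nb, Real.exp (-(a * dist x (r j.1))) ≤ Nb * packingConst a 𝔪 := by
  rw [Fintype.sum_prod_type]
  simp only [Finset.sum_const, Finset.card_univ, Fintype.card_fin, nsmul_eq_mul]
  rw [← Finset.mul_sum]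
  gcongr
  exact sum_exp_neg_dist_le ha h𝔪 hr x

/-! ### Weighted displacements of a configuration -/

section Moved

open Filter Topology

/-- The space of displacements of positions and features. -/
abbrev Conf (M Nc : ℕ) : Type := (Fin M → R3) × (Fin M → Fin Nc → ℝ)

/-- Positions displaced by `h`, with atom `k` moving at scale `τ k`. -/
def movedPos {M Nc : ℕ} (r : Fin M → R3) (τ : Fin M → ℝ) (h : Conf M Nc) : Fin M → R3 :=
  fun k => r k + τ k • h.1 k

/-- Features displaced by `h`, with atom `k` moving at scale `τ k`. -/
def movedFeat {M Nc : ℕ} (v : Fin M → Fin Nc → ℝ) (τ : Fin M → ℝ) (h : Conf M Nc) :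
    Fin M → Fin Nc → ℝ :=
  fun k => v k + τ k • h.2 k

/-- Scales that vary at exponential rate at most `η` from atom to atom. -/
structure IsWeight {M : ℕ} (r : Fin M → R3) (η : ℝ) (τ : Fin M → ℝ) : Prop where
  one_le : ∀ k, 1 ≤ τ k
  le_mul : ∀ i j, τ j ≤ τ i * Real.exp (η * dist (r i) (r j))

theorem isWeight_exp {M : ℕ} (r : Fin M → R3) {η : ℝ} (hη : 0 ≤ η) (ℓ : Fin M) :
    IsWeight r η fun k => Real.exp (η * dist (r ℓ) (r k)) := by
  refine ⟨fun k => Real.one_le_exp (by positivity), fun i j => ?_⟩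
  rw [← Real.exp_add, ← mul_add]
  exact Real.exp_le_exp.2 (mul_le_mul_of_nonneg_left (dist_triangle _ _ _) hη)

variable {M Nc N : ℕ} {r : Fin M → R3} {v : Fin M → Fin Nc → ℝ} {η : ℝ} {τ : Fin M → ℝ}

theorem IsWeight.pos (hτ : IsWeight r η τ) (k : Fin M) : 0 < τ k :=
  zero_lt_one.trans_le (hτ.one_le k)

@[simp] theorem movedPos_zero : movedPos r τ (0 : Conf M Nc) = r := by
  ext k : 1; simp [movedPos]

@[simp] theorem movedFeat_zero : movedFeat v τ (0 : Conf M Nc) = v := by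
  ext k : 1; simp [movedFeat]

theorem ExpLocalised.jetBound {c a : ℝ} {f : R3 → ℝ} (hf : ExpLocalised N c a f) (x : R3) :
    JetBound N f x (c * Real.exp (-(a * ‖x‖))) 1 :=
  ⟨hf.1.contDiffAt, fun n hn => by
    rw [one_pow, mul_one, ← neg_mul]; exact hf.2 n hn x⟩

theorem ExpLocalised.mono {ν : ℕ} {c c' a a' : ℝ} {f : R3 → ℝ} (hf : ExpLocalised ν c a f)
    (hN : N ≤ ν) (hc : c ≤ c') (ha : a' ≤ a) : ExpLocalised N c' a' f := by
  refine ⟨hf.1.of_le (by exact_mod_cast hN), fun n hn x => (hf.2 n (hn.trans hN) x).trans ?_⟩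
  have h0 := (norm_nonneg _).trans (hf.2 n (hn.trans hN) x)
  have h1 : 0 ≤ c := nonneg_of_mul_nonneg_left h0 (Real.exp_pos _)
  have h2 : 0 ≤ c' := h1.trans hc
  gcongr

theorem ExpLocalised.fderiv_apply {c a : ℝ} {f : R3 → ℝ} (hf : ExpLocalised (N + 1) c a f)
    {e : R3} (he : ‖e‖ ≤ 1) : ExpLocalised N c a fun x => fderiv ℝ f x e := by
  -- The kinetic energy contains gradients of the orbitals; here one order of smoothness is spent,
  -- which is why jets of order `N` require `N + 1 ≤ ν`.
  have h1 : ContDiff ℝ N (fderiv ℝ f) := hf.1.fderiv_right (by norm_cast)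
  refine ⟨h1.clm_apply contDiff_const, fun n hn x => ?_⟩
  refine (norm_iteratedFDeriv_clm_apply_const (N := N) h1.contDiffAt
    (by exact_mod_cast hn)).trans ?_
  rw [norm_iteratedFDeriv_fderiv]
  exact (mul_le_of_le_one_left (norm_nonneg _) he).trans (hf.2 (n + 1) (by omega) x)

/-- With this trivial third factor of rate zero, kinetic integrals become three-centre integrals as
well. -/
theorem expLocalised_one : ExpLocalised N 1 0 fun _ => 1 := by
  refine ⟨contDiff_const, fun n _ x => ?_⟩
  simpa using (JetBound.const (N := N) (1 : ℝ) x (t := 1) zero_le_one).bound n ‹_›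

/-- The centre depends affinely on `h`, with linear part of norm at most `τ k`. The bound is needed
at every `h`, not only at zero, to dominate integrands on a neighbourhood. -/
theorem jetBound_centred {c a : ℝ} {f : R3 → ℝ} (hf : ExpLocalised N c a f)
    (hτ : IsWeight r η τ) (k : Fin M) (x : R3) (h : Conf M Nc) :
    JetBound N (fun h => f (x - movedPos r τ h k)) h
      (c * Real.exp (-(a * dist x (movedPos r τ h k)))) (τ k) := by
  let L : Conf M Nc →L[ℝ] R3 := -(τ k • ((ContinuousLinearMap.proj k).comp
    (ContinuousLinearMap.fst ℝ (Fin M → R3) (Fin M → Fin Nc → ℝ))))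
  have hL : ‖L‖ ≤ τ k := by
    refine L.opNorm_le_bound (hτ.pos k).le fun h => ?_
    have h1 : ‖L h‖ = τ k * ‖h.1 k‖ := by
      simp [L, norm_smul, abs_of_pos (hτ.pos k)]
    rw [h1]
    exact mul_le_mul_of_nonneg_left ((norm_le_pi_norm _ _).trans (norm_fst_le h)) (hτ.pos k).le
  have e : ∀ h, x - movedPos r τ h k = (x - r k) + L h := fun h => by
    simp [movedPos, L]; abel
  have := (hf.jetBound (x - movedPos r τ h k))
  rw [e h] at this
  have := this.comp_affine (x - r k) L hL
  rw [one_mul, ← e h, ← dist_eq_norm] at this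
  simpa only [← e] using this

theorem contDiff_centred {c a : ℝ} {f : R3 → ℝ} (hf : ExpLocalised N c a f) (k : Fin M) :
    ContDiff ℝ N fun p : R3 × Conf M Nc => f (p.1 - movedPos r τ p.2 k) := by
  refine hf.1.comp ?_
  unfold movedPos
  fun_prop

theorem JetBound.id_real (x : ℝ) : JetBound N (fun y : ℝ => y) x (|x| + 1) 1 := by
  refine ⟨contDiffAt_id, fun n _ => ?_⟩
  rw [one_pow, mul_one]
  rcases n with _ | _ | n
  · simp
  · rw [norm_iteratedFDeriv_one, fderiv_fun_id]
    have := abs_nonneg x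
    have := ContinuousLinearMap.norm_id_le (𝕜 := ℝ) (E := ℝ)
    linarith
  · have : fderiv ℝ (fun y : ℝ => y) = fun _ => ContinuousLinearMap.id ℝ ℝ :=
      funext fun _ => fderiv_fun_id
    rw [← norm_iteratedFDeriv_fderiv, this, iteratedFDeriv_const_of_ne (by omega)]
    simp only [Pi.zero_apply, norm_zero]
    positivity

theorem jetBound_feature (hτ : IsWeight r η τ) (m : Fin M) (c : Fin Nc) :
    JetBound N (fun h : Conf M Nc => movedFeat v τ h m c) 0 (‖v‖ + 1) (τ m) := by
  let L : Conf M Nc →L[ℝ] ℝ := τ m • ((ContinuousLinearMap.proj c).comp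
    ((ContinuousLinearMap.proj m).comp
      (ContinuousLinearMap.snd ℝ (Fin M → R3) (Fin M → Fin Nc → ℝ))))
  have hL : ‖L‖ ≤ τ m := by
    refine L.opNorm_le_bound (hτ.pos m).le fun h => ?_
    have h1 : ‖L h‖ = τ m * ‖h.2 m c‖ := by
      simp [L, abs_of_pos (hτ.pos m)]
    rw [h1]
    exact mul_le_mul_of_nonneg_left (((norm_le_pi_norm _ _).trans (norm_le_pi_norm _ _)).trans
      (norm_snd_le h)) (hτ.pos m).le
  have := (JetBound.id_real (N := N) (v m c + L 0)).comp_affine (v m c) L hL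
  rw [map_zero, add_zero, one_mul] at this
  refine this.mono_const ?_ (hτ.pos m).le
  have := (norm_le_pi_norm (v m) c).trans (norm_le_pi_norm v m)
  rw [Real.norm_eq_abs] at this
  linarith

theorem integrable_threeCentre {f₁ f₂ f₃ : R3 → ℝ} {c₁ c₂ c₃ a a₃ : ℝ} (ha : 0 < a)
    (ha₃ : 0 ≤ a₃) (h₁ : ExpLocalised N c₁ a f₁) (h₂ : ExpLocalised N c₂ a f₂)
    (h₃ : ExpLocalised N c₃ a₃ f₃) (p q s : R3) :
    Integrable fun x => f₁ (x - p) * f₂ (x - q) * f₃ (x - s) := by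
  have b : ∀ {f : R3 → ℝ} {c a : ℝ}, 0 ≤ a → ExpLocalised N c a f → ∀ x, ‖f x‖ ≤ c := by
    intro f c a ha h x
    have h0 := (h.jetBound x).norm_le
    have h1 := nonneg_of_mul_nonneg_left (norm_nonneg _ |>.trans h0) (Real.exp_pos _)
    exact h0.trans (mul_le_of_le_one_right h1 (Real.exp_le_one_iff.2 (by
      have := mul_nonneg ha (norm_nonneg x); linarith)))
  have m : ∀ {f : R3 → ℝ} {c a : ℝ} (p : R3), ExpLocalised N c a f →
      Continuous fun x => f (x - p) := fun p h =>
    h.1.continuous.comp (continuous_id.sub continuous_const)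
  refine (((integrable_exp_neg_mul_dist ha p).const_mul c₁).mul_const (c₂ * c₃)).mono'
    (((m p h₁).mul (m q h₂)).mul (m s h₃)).aestronglyMeasurable ?_
  refine Eventually.of_forall fun x => ?_
  rw [norm_mul, norm_mul, mul_assoc, dist_eq_norm]
  have e1 := (h₁.jetBound (x - p)).norm_le
  have e2 := b ha.le h₂ (x - q)
  have e3 := b ha₃ h₃ (x - s)
  exact mul_le_mul e1 (mul_le_mul e2 e3 (norm_nonneg _) ((norm_nonneg _).trans e2))
    (by positivity) ((norm_nonneg _).trans e1)

/-- Jets of integrals of products of three localised functions that move with their centres. -/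
theorem jetBound_threeCentre {f₁ f₂ f₃ : R3 → ℝ} {c₁ c₂ c₃ a a₃ : ℝ} (ha : 0 < a)
    (ha₃ : 0 ≤ a₃) (ha₃' : a₃ ≤ a) (h₁ : ExpLocalised N c₁ a f₁) (h₂ : ExpLocalised N c₂ a f₂)
    (h₃ : ExpLocalised N c₃ a₃ f₃) (hτ : IsWeight r η τ) (i j m : Fin M) :
    JetBound N (fun h : Conf M Nc => ∫ x, f₁ (x - movedPos r τ h i) * f₂ (x - movedPos r τ h j) *
        f₃ (x - movedPos r τ h m)) 0
      (c₁ * c₂ * c₃ * expIntegral (a / 3) * Real.exp (-(a / 3 * dist (r i) (r j))) *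
        Real.exp (-(a₃ / 3 * dist (r i) (r m)))) (τ i + τ j + τ m) := by
  have c0 : ∀ {f : R3 → ℝ} {c a : ℝ}, ExpLocalised N c a f → 0 ≤ c := fun {f c a} h =>
    nonneg_of_mul_nonneg_left (norm_nonneg _ |>.trans (h.jetBound 0).norm_le) (Real.exp_pos _)
  have k1 := c0 h₁
  have k2 := c0 h₂
  have k3 := c0 h₃
  have ti := hτ.pos i
  have tj := hτ.pos j
  have tm := hτ.pos m
  have hjet : ∀ x (h : Conf M Nc), JetBound N (fun h : Conf M Nc =>
      f₁ (x - movedPos r τ h i) * f₂ (x - movedPos r τ h j) * f₃ (x - movedPos r τ h m)) h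
      (c₁ * Real.exp (-(a * dist x (movedPos r τ h i))) *
        (c₂ * Real.exp (-(a * dist x (movedPos r τ h j)))) *
        (c₃ * Real.exp (-(a₃ * dist x (movedPos r τ h m))))) (τ i + τ j + τ m) := fun x h =>
    ((jetBound_centred h₁ hτ i x h).mul (jetBound_centred h₂ hτ j x h)).mul
      (jetBound_centred h₃ hτ m x h)
  -- The majorant `b` may depend badly on the weights, as in `exp (a * τ i)`, because it does not
  -- enter the estimate.
  refine JetBound.integral (m := volume) (U := Metric.ball 0 1) (Metric.ball_mem_nhds _ one_pos)
    (b := fun x => c₁ * c₂ * c₃ * Real.exp (a * τ i) * (1 + (τ i + τ j + τ m)) ^ N *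
      Real.exp (-(a * dist x (r i))))
    (c := fun x => c₁ * c₂ * c₃ * Real.exp (-(a / 3 * dist (r i) (r j))) *
        Real.exp (-(a₃ / 3 * dist (r i) (r m))) * Real.exp (-(a / 3 * dist x (r i)))) ?_ ?_ ?_ ?_ ?_
    ?_ (by positivity)
  · intro x h _
    exact (((contDiff_centred h₁ i).mul (contDiff_centred h₂ j)).mul
      (contDiff_centred h₃ m)).contDiffAt
  · refine Eventually.of_forall fun x h hh n hn => ((hjet x h).bound n hn).trans ?_
    have d1 : dist x (r i) ≤ dist x (movedPos r τ h i) + τ i := by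
      refine (dist_triangle _ (movedPos r τ h i) _).trans ?_
      have : dist (movedPos r τ h i) (r i) ≤ τ i := by
        rw [dist_eq_norm, movedPos, add_sub_cancel_left, norm_smul, Real.norm_of_nonneg ti.le]
        have : ‖h‖ < 1 := by simpa using hh
        exact mul_le_of_le_one_right ti.le
          (((norm_le_pi_norm _ _).trans (norm_fst_le h)).trans this.le)
      linarith
    have e1 : Real.exp (-(a * dist x (movedPos r τ h i))) ≤
        Real.exp (a * τ i) * Real.exp (-(a * dist x (r i))) := by
      rw [← Real.exp_add]
      exact Real.exp_le_exp.2 (by nlinarith)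
    have e2 : Real.exp (-(a * dist x (movedPos r τ h j))) ≤ 1 :=
      Real.exp_le_one_iff.2 (by simp only [neg_nonpos]; positivity)
    have e3 : Real.exp (-(a₃ * dist x (movedPos r τ h m))) ≤ 1 :=
      Real.exp_le_one_iff.2 (by simp only [neg_nonpos]; positivity)
    have e4 : (τ i + τ j + τ m) ^ n ≤ (1 + (τ i + τ j + τ m)) ^ N :=
      (pow_le_pow_left₀ (by positivity) (by linarith) n).trans
        (pow_le_pow_right₀ (by linarith) hn)
    calc _ ≤ c₁ * (Real.exp (a * τ i) * Real.exp (-(a * dist x (r i)))) * (c₂ * 1) * (c₃ * 1) *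
          (1 + (τ i + τ j + τ m)) ^ N := by gcongr
      _ = _ := by ring
  · exact (integrable_exp_neg_mul_dist ha _).const_mul _
  · refine Eventually.of_forall fun x => ?_
    have h0 := hjet x 0
    simp only [movedPos_zero] at h0
    refine h0.mono_const ?_ (by positivity)
    -- The decay about `r i` is split into thirds: one is combined with the decay about `r j`, one
    -- with the decay about `r m` (this uses `a₃ ≤ a`), and the last is kept for integration over
    -- `x`.
    have e : Real.exp (-(a * dist x (r i))) * Real.exp (-(a * dist x (r j))) *
        Real.exp (-(a₃ * dist x (r m))) ≤ Real.exp (-(a / 3 * dist (r i) (r j))) *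
        Real.exp (-(a₃ / 3 * dist (r i) (r m))) * Real.exp (-(a / 3 * dist x (r i))) := by
      simp only [← Real.exp_add]
      refine Real.exp_le_exp.2 ?_
      have t1 := dist_triangle_left (r i) (r j) x
      have t2 := dist_triangle_left (r i) (r m) x
      have p1 := dist_nonneg (x := x) (y := r i)
      have p2 := dist_nonneg (x := x) (y := r j)
      have p3 := dist_nonneg (x := x) (y := r m)
      have q1 := mul_le_mul_of_nonneg_left t1 ha.le
      have q2 := mul_le_mul_of_nonneg_left t2 ha₃
      have q3 := mul_le_mul_of_nonneg_right ha₃' p1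
      have q4 := mul_nonneg ha.le p2
      have q5 := mul_nonneg ha₃ p3
      have q6 := mul_nonneg ha.le p1
      linarith
    calc _ = c₁ * c₂ * c₃ * (Real.exp (-(a * dist x (r i))) * Real.exp (-(a * dist x (r j))) *
        Real.exp (-(a₃ * dist x (r m)))) := by ring
      _ ≤ c₁ * c₂ * c₃ * (Real.exp (-(a / 3 * dist (r i) (r j))) *
        Real.exp (-(a₃ / 3 * dist (r i) (r m))) * Real.exp (-(a / 3 * dist x (r i)))) := by gcongr
      _ = _ := by ring
  · exact (integrable_exp_neg_mul_dist (by positivity) _).const_mul _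
  · rw [integral_const_mul, integral_exp_neg_mul_dist]
    exact le_of_eq (by ring)

end Moved

/-! ### Locality of the Hamiltonian -/

section HamiltonianJets

open Filter Topology

variable {S : Type*} {Nb Nc N : ℕ} {M : ℕ} {r : Fin M → R3} {η : ℝ} {τ : Fin M → ℝ}

theorem JetBound.const_mul {E : Type*} [NormedAddCommGroup E] [NormedSpace ℝ E] {g : E → ℝ}
    {x : E} {c t : ℝ} (h : JetBound N g x c t) (ht : 0 ≤ t) (k : ℝ) :
    JetBound N (fun y => k * g y) x (|k| * c) t := by
  refine (h.clm (k • ContinuousLinearMap.id ℝ ℝ)).mono_const ?_ ht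
  refine mul_le_mul_of_nonneg_right ?_ h.nonneg
  refine (norm_smul_le k (ContinuousLinearMap.id ℝ ℝ)).trans ?_
  exact mul_le_of_le_one_right (norm_nonneg _) ContinuousLinearMap.norm_id_le

/-- The basic exchange of scales: a ratio `K * exp s` between two scales enters at most `N` times,
and moves into the prefactor. -/
theorem JetBound.absorb_exp {E F : Type*} [NormedAddCommGroup E] [NormedSpace ℝ E]
    [NormedAddCommGroup F] [NormedSpace ℝ F] {g : E → F} {x : E} {c T t K s : ℝ}
    (h : JetBound N g x c T) (hT0 : 0 ≤ T) (ht : 0 ≤ t) (hK : 1 ≤ K) (hs : 0 ≤ s)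
    (hT : T ≤ K * t * Real.exp s) : JetBound N g x (c * K ^ N * Real.exp (N * s)) t := by
  have h1 : 1 ≤ K * Real.exp s := one_le_mul_of_one_le_of_one_le hK (Real.one_le_exp hs)
  have := (h.mono le_rfl hT0 (t' := (K * Real.exp s) * t) (hT.trans (le_of_eq (by ring)))).absorb
    h1 ht
  rwa [mul_pow, ← Real.exp_nat_mul, ← mul_assoc] at this

/-- The sum in brackets is the scale of a three-centre integral; the additional `τ m` is that of the
feature coefficient multiplying it. -/
theorem IsWeight.sum_three_le (hτ : IsWeight r η τ) (hη : 0 ≤ η) (i j m : Fin M) :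
    τ m + (τ i + τ j + τ m) ≤ 4 * τ i * Real.exp (η * (dist (r i) (r j) + dist (r i) (r m))) := by
  have h1 : ∀ k, ∀ d, dist (r i) (r k) ≤ d → τ k ≤ τ i * Real.exp (η * d) := fun k d hd =>
    (hτ.le_mul i k).trans (mul_le_mul_of_nonneg_left (Real.exp_le_exp.2
      (mul_le_mul_of_nonneg_left hd hη)) (hτ.pos i).le)
  have dj := dist_nonneg (x := r i) (y := r j)
  have dm := dist_nonneg (x := r i) (y := r m)
  have a1 := h1 m (dist (r i) (r j) + dist (r i) (r m)) (by linarith)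
  have a2 := h1 j (dist (r i) (r j) + dist (r i) (r m)) (by linarith)
  have a3 := h1 i (dist (r i) (r j) + dist (r i) (r m)) (by rw [dist_self]; linarith)
  linarith

/-- Expanding the product of gradients in the standard basis gives three integrals to which the
three-centre estimate applies. -/
theorem TBModel.H0_eq_sum {𝓜 : TBModel S Nb Nc} {c a : ℝ} (ha : 0 < a)
    (h𝓜 : ∀ s b, ExpLocalised (N + 1) c a (𝓜.orbital s b)) (Z : Fin M → S) (r : Fin M → R3)
    (i j : Fin M × Fin Nb) :
    𝓜.H0 Z r i j = (1 / 2) * ∑ e : Fin 3, ∫ x,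
      fderiv ℝ (𝓜.orbital (Z i.1) i.2) (x - r i.1) (EuclideanSpace.basisFun (Fin 3) ℝ e) *
      fderiv ℝ (𝓜.orbital (Z j.1) j.2) (x - r j.1) (EuclideanSpace.basisFun (Fin 3) ℝ e) *
      (fun _ => 1 : R3 → ℝ) (x - r i.1) := by
  rw [TBModel.H0, Matrix.of_apply, ← integral_finsetSum]
  · congr 1
    refine integral_congr_ae (Eventually.of_forall fun x => ?_)
    have h1 : ∀ i : Fin M × Fin Nb, fderiv ℝ (𝓜.phi Z r i) x =
        fderiv ℝ (𝓜.orbital (Z i.1) i.2) (x - r i.1) := fun i => by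
      unfold TBModel.phi
      exact fderiv_comp_sub (f := 𝓜.orbital (Z i.1) i.2) (x := x) (r i.1)
    simp only [mul_one]
    rw [← (EuclideanSpace.basisFun (Fin 3) ℝ).sum_inner_mul_inner]
    refine Finset.sum_congr rfl fun e _ => ?_
    rw [inner_gradient_left, inner_gradient_right, h1, h1]
    simp
  · intro e _
    have he : ‖EuclideanSpace.basisFun (Fin 3) ℝ e‖ ≤ 1 := by simp
    exact integrable_threeCentre ha le_rfl ((h𝓜 _ _).fderiv_apply he)
      ((h𝓜 _ _).fderiv_apply he) expLocalised_one (r i.1) (r j.1) (r i.1)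

/-- Locality of the entries of the Hamiltonian: jets of order `N < ν`, at scales that vary slowly
enough, decay exponentially away from the diagonal. -/
theorem TBModel.exists_hamiltonian_jet {𝓜 : TBModel S Nb Nc} {ν : ℕ} (h𝓜 : 𝓜.Admissible ν)
    (hN : N + 1 ≤ ν) {𝔪 : ℝ} (h𝔪 : 0 < 𝔪) (B : ℝ) :
    ∃ a C : ℝ, 0 < a ∧ 0 < C ∧ (∀ s b, ExpLocalised N C a (𝓜.orbital s b)) ∧
    ∀ (M : ℕ) (Z : Fin M → S) (r : Fin M → R3) (v : Fin M → Fin Nc → ℝ),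
      (∀ i j, i ≠ j → 𝔪 ≤ dist (r i) (r j)) → ‖v‖ ≤ B →
      ∀ (η : ℝ) (τ : Fin M → ℝ), 0 ≤ η → N * η ≤ a → IsWeight r η τ →
      ∀ i j, JetBound N (fun h : Conf M Nc => 𝓜.H0 Z (movedPos r τ h) i j) 0
          (C * Real.exp (-(a * dist (r i.1) (r j.1)))) (τ i.1) ∧
        JetBound N (fun h : Conf M Nc =>
          𝓜.hamiltonian Z (movedPos r τ h) (movedFeat v τ h) i j) 0
          (C * Real.exp (-(a * dist (r i.1) (r j.1)))) (τ i.1) := by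
  obtain ⟨cφ, ηφ, hcφ, hηφ, hφ⟩ := h𝓜.orbital
  obtain ⟨cΞ, ηΞ, hcΞ, hηΞ, hΞ⟩ := h𝓜.feature
  set c := max cφ cΞ with hc
  set b := min ηφ ηΞ with hb
  have hc0 : 0 < c := lt_max_of_lt_left hcφ
  have hb0 : 0 < b := lt_min hηφ hηΞ
  have hφ' : ∀ s e, ExpLocalised (N + 1) c b (𝓜.orbital s e) := fun s e =>
    (hφ s e).mono hN (le_max_left _ _) (min_le_left _ _)
  have hφ'' : ∀ s e, ExpLocalised N c b (𝓜.orbital s e) := fun s e =>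
    (hφ' s e).mono (Nat.le_succ _) le_rfl le_rfl
  have hΞ' : ∀ e, ExpLocalised N c b (𝓜.feature e) := fun e =>
    (hΞ e).mono ((Nat.le_succ _).trans hN) (le_max_right _ _) (min_le_right _ _)
  set I := expIntegral (b / 3) with hI
  have hI0 : 0 ≤ I := expIntegral_nonneg _
  set C0 := 3 * (c * c * 1 * I * 4 ^ N) with hC0
  set P := packingConst (b / 6) 𝔪 with hP
  have hP0 : 0 ≤ P := packingConst_nonneg _ _
  set C1 := P * (Nc * ((|B| + 1) * (c * c * c * I) * 4 ^ N)) with hC1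
  have C00 : 0 ≤ C0 := by positivity
  have C10 : 0 ≤ C1 := by positivity
  -- Three-centre integrals decay at rate `b / 3`. One half of this pays for replacing all weights
  -- by `τ i`, since `N * η ≤ b / 6`; the other half is the final rate `b / 6`, and also makes the
  -- sum over feature centres converge.
  refine ⟨b / 6, c + C0 + C1, by positivity, by positivity, fun s e =>
    (hφ'' s e).mono le_rfl (by linarith) (by linarith), ?_⟩
  intro M Z r v hr hv η τ hη hNη hτ
  have H0jet : ∀ i j, JetBound N (fun h : Conf M Nc => 𝓜.H0 Z (movedPos r τ h) i j) 0
      (C0 * Real.exp (-(b / 6 * dist (r i.1) (r j.1)))) (τ i.1) := by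
    intro i j
    have h1 : ∀ e : Fin 3, JetBound N (fun h : Conf M Nc => ∫ x,
        fderiv ℝ (𝓜.orbital (Z i.1) i.2) (x - movedPos r τ h i.1)
          (EuclideanSpace.basisFun (Fin 3) ℝ e) *
        fderiv ℝ (𝓜.orbital (Z j.1) j.2) (x - movedPos r τ h j.1)
          (EuclideanSpace.basisFun (Fin 3) ℝ e) *
        (fun _ => 1 : R3 → ℝ) (x - movedPos r τ h i.1)) 0
        (c * c * 1 * I * 4 ^ N * Real.exp (-(b / 6 * dist (r i.1) (r j.1)))) (τ i.1) := by
      intro e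
      have he : ‖EuclideanSpace.basisFun (Fin 3) ℝ e‖ ≤ 1 := by simp
      have := jetBound_threeCentre (Nc := Nc) hb0 le_rfl hb0.le ((hφ' (Z i.1) i.2).fderiv_apply he)
        ((hφ' (Z j.1) j.2).fderiv_apply he) expLocalised_one hτ i.1 j.1 i.1
      have h3 := hτ.sum_three_le hη i.1 j.1 i.1
      rw [dist_self, add_zero] at h3
      have ti := hτ.pos i.1
      have tj := hτ.pos j.1
      have d0 := dist_nonneg (x := r i.1) (y := r j.1)
      have := this.absorb_exp (K := 4) (s := η * dist (r i.1) (r j.1)) (by positivity) ti.le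
        (by norm_num) (by positivity) (by linarith)
      refine this.mono_const ?_ ti.le
      have e1 : Real.exp (-(b / 3 * dist (r i.1) (r j.1))) *
          Real.exp (N * (η * dist (r i.1) (r j.1))) ≤
          Real.exp (-(b / 6 * dist (r i.1) (r j.1))) := by
        rw [← Real.exp_add]
        refine Real.exp_le_exp.2 ?_
        nlinarith
      rw [dist_self, mul_zero, neg_zero, Real.exp_zero, mul_one]
      calc _ = c * c * 1 * I * 4 ^ N * (Real.exp (-(b / 3 * dist (r i.1) (r j.1))) *
          Real.exp (N * (η * dist (r i.1) (r j.1)))) := by ring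
        _ ≤ _ := by gcongr
    have h2 := (JetBound.sum Finset.univ fun e _ => h1 e).const_mul (hτ.pos _).le (1 / 2)
    simp only [TBModel.H0_eq_sum hb0 hφ']
    refine h2.mono_const ?_ (hτ.pos _).le
    rw [Finset.sum_const, Finset.card_univ, Fintype.card_fin, hC0]
    have h0 : 0 ≤ c * c * 1 * I * 4 ^ N * Real.exp (-(b / 6 * dist (r i.1) (r j.1))) := by
      positivity
    norm_num
    linarith
  have Vjet : ∀ i j, JetBound N (fun h : Conf M Nc =>
      𝓜.potential Z (movedPos r τ h) (movedFeat v τ h) i j) 0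
      (C1 * Real.exp (-(b / 6 * dist (r i.1) (r j.1)))) (τ i.1) := by
    intro i j
    have h1 : ∀ (m : Fin M) (e : Fin Nc), JetBound N (fun h : Conf M Nc => movedFeat v τ h m e *
        ∫ x, 𝓜.phi Z (movedPos r τ h) i x * 𝓜.phi Z (movedPos r τ h) j x *
          𝓜.feature e (x - movedPos r τ h m)) 0
        ((|B| + 1) * (c * c * c * I) * 4 ^ N * Real.exp (-(b / 6 * dist (r i.1) (r j.1))) *
          Real.exp (-(b / 6 * dist (r i.1) (r m)))) (τ i.1) := by
      intro m e
      have J := (jetBound_feature (N := N) (v := v) hτ m e).mul (jetBound_threeCentre (Nc := Nc) hb0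
        hb0.le le_rfl (hφ'' (Z i.1) i.2) (hφ'' (Z j.1) j.2) (hΞ' e) hτ i.1 j.1 m)
      have ti := hτ.pos i.1
      have tj := hτ.pos j.1
      have tm := hτ.pos m
      have d0 := dist_nonneg (x := r i.1) (y := r j.1)
      have d1 := dist_nonneg (x := r i.1) (y := r m)
      have J := J.absorb_exp (K := 4) (s := η * (dist (r i.1) (r j.1) + dist (r i.1) (r m)))
        (by positivity) ti.le (by norm_num) (by positivity) (hτ.sum_three_le hη i.1 j.1 m)
      refine J.mono_const ?_ ti.le
      have e1 : Real.exp (-(b / 3 * dist (r i.1) (r j.1))) *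
          Real.exp (-(b / 3 * dist (r i.1) (r m))) *
          Real.exp (N * (η * (dist (r i.1) (r j.1) + dist (r i.1) (r m)))) ≤
          Real.exp (-(b / 6 * dist (r i.1) (r j.1))) *
          Real.exp (-(b / 6 * dist (r i.1) (r m))) := by
        rw [← Real.exp_add, ← Real.exp_add, ← Real.exp_add]
        refine Real.exp_le_exp.2 ?_
        nlinarith
      have hB : ‖v‖ + 1 ≤ |B| + 1 := by linarith [le_abs_self B]
      calc _ = (‖v‖ + 1) * (c * c * c * I) * 4 ^ N * (Real.exp (-(b / 3 * dist (r i.1) (r j.1))) *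
          Real.exp (-(b / 3 * dist (r i.1) (r m))) *
          Real.exp (N * (η * (dist (r i.1) (r j.1) + dist (r i.1) (r m))))) := by ring
        _ ≤ (|B| + 1) * (c * c * c * I) * 4 ^ N * (Real.exp (-(b / 6 * dist (r i.1) (r j.1))) *
          Real.exp (-(b / 6 * dist (r i.1) (r m)))) := by gcongr
        _ = _ := by ring
    have h2 := JetBound.sum Finset.univ fun m _ => JetBound.sum Finset.univ fun e _ => h1 m e
    simp only [TBModel.potential, Matrix.of_apply]
    refine h2.mono_const ?_ (hτ.pos _).le
    simp only [Finset.sum_const, Finset.card_univ, Fintype.card_fin, nsmul_eq_mul]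
    rw [← Finset.mul_sum, ← Finset.mul_sum]
    have h3 := sum_exp_neg_dist_le (a := b / 6) (by positivity) h𝔪 hr (r i.1)
    rw [hC1]
    calc _ ≤ (Nc : ℝ) * ((|B| + 1) * (c * c * c * I) * 4 ^ N *
        Real.exp (-(b / 6 * dist (r i.1) (r j.1))) * P) := by gcongr
      _ = _ := by ring
  intro i j
  have e0 := Real.exp_pos (-(b / 6 * dist (r i.1) (r j.1)))
  refine ⟨(H0jet i j).mono_const (by gcongr; linarith) (hτ.pos _).le,
    ((H0jet i j).add (Vjet i j)).mono_const ?_ (hτ.pos _).le⟩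
  rw [← add_mul]
  gcongr
  linarith

end HamiltonianJets

/-! ### Resolvents of symmetric matrices -/

section Resolvent

open Filter Topology

variable {ι : Type*} [Fintype ι] [DecidableEq ι]

theorem Matrix.IsHermitian.eq_eigenvectorUnitary_mul {H : Matrix ι ι ℝ} (hH : H.IsHermitian) :
    H = (hH.eigenvectorUnitary : Matrix ι ι ℝ) * diagonal hH.eigenvalues *
      (hH.eigenvectorUnitary : Matrix ι ι ℝ)ᵀ := by
  conv_lhs => rw [hH.spectral_theorem]
  rw [Unitary.conjStarAlgAut_apply]
  rfl

theorem Matrix.IsHermitian.cfc_eq_mul {H : Matrix ι ι ℝ} (hH : H.IsHermitian) (f : ℝ → ℝ) :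
    cfc f H = (hH.eigenvectorUnitary : Matrix ι ι ℝ) *
      diagonal (fun k => f (hH.eigenvalues k)) *
      (hH.eigenvectorUnitary : Matrix ι ι ℝ)ᵀ := by
  rw [hH.cfc_eq, Matrix.IsHermitian.cfc, Unitary.conjStarAlgAut_apply]
  rfl

theorem Matrix.IsHermitian.eigenvectorUnitary_mul_transpose {H : Matrix ι ι ℝ}
    (hH : H.IsHermitian) : (hH.eigenvectorUnitary : Matrix ι ι ℝ) *
      (hH.eigenvectorUnitary : Matrix ι ι ℝ)ᵀ = 1 :=
  Unitary.mul_star_self_of_mem hH.eigenvectorUnitary.2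

theorem Matrix.IsHermitian.transpose_mul_eigenvectorUnitary {H : Matrix ι ι ℝ}
    (hH : H.IsHermitian) : (hH.eigenvectorUnitary : Matrix ι ι ℝ)ᵀ *
      (hH.eigenvectorUnitary : Matrix ι ι ℝ) = 1 :=
  Unitary.star_mul_self_of_mem hH.eigenvectorUnitary.2

/-- `z - H`, over a commutative algebra. -/
def Matrix.shifted {A : Type*} [CommRing A] [Algebra ℝ A] (z : A) (H : Matrix ι ι ℝ) :
    Matrix ι ι A :=
  z • (1 : Matrix ι ι A) - H.map (algebraMap ℝ A)

/-! ### Resolvents with values in a commutative algebra -/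

section Algebra

variable {A : Type*} [CommRing A] [Algebra ℝ A]

/-- Diagonalisation by the real eigenvector matrix works over any algebra in which all `z - λ_k` are
invertible. With functions on a contour as the algebra, a single inverse collects the resolvents at
all its points. -/
theorem Matrix.IsHermitian.shifted_mul {H : Matrix ι ι ℝ} (hH : H.IsHermitian) {z : A}
    {g : ι → A} (hg : ∀ k, (z - algebraMap ℝ A (hH.eigenvalues k)) * g k = 1) :
    H.shifted z * ((hH.eigenvectorUnitary : Matrix ι ι ℝ).map (algebraMap ℝ A) * diagonal g *
      ((hH.eigenvectorUnitary : Matrix ι ι ℝ)ᵀ).map (algebraMap ℝ A)) = 1 := by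
  set U := (hH.eigenvectorUnitary : Matrix ι ι ℝ) with hU
  have h1 : U.map (algebraMap ℝ A) * (Uᵀ).map (algebraMap ℝ A) = 1 := by
    rw [← Matrix.map_mul, hH.eigenvectorUnitary_mul_transpose,
      Matrix.map_one _ (map_zero _) (map_one _)]
  have h2 : (Uᵀ).map (algebraMap ℝ A) * U.map (algebraMap ℝ A) = 1 := by
    rw [← Matrix.map_mul, hH.transpose_mul_eigenvectorUnitary,
      Matrix.map_one _ (map_zero _) (map_one _)]
  have h3 : H.shifted z = U.map (algebraMap ℝ A) *
      diagonal (fun k => z - algebraMap ℝ A (hH.eigenvalues k)) *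
      (Uᵀ).map (algebraMap ℝ A) := by
    have e1 : diagonal (fun k => z - algebraMap ℝ A (hH.eigenvalues k)) =
        z • (1 : Matrix ι ι A) - (diagonal hH.eigenvalues).map (algebraMap ℝ A) := by
      rw [diagonal_map (map_zero _), Matrix.smul_one_eq_diagonal, diagonal_sub]
    rw [e1, mul_sub, sub_mul, Matrix.mul_smul, Matrix.smul_mul, mul_one, h1, ← Matrix.map_mul,
      ← Matrix.map_mul, ← hH.eq_eigenvectorUnitary_mul]
    rfl
  rw [h3]
  calc _ = U.map (algebraMap ℝ A) * diagonal (fun k => z - algebraMap ℝ A (hH.eigenvalues k)) *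
      ((Uᵀ).map (algebraMap ℝ A) * U.map (algebraMap ℝ A)) * diagonal g *
      (Uᵀ).map (algebraMap ℝ A) := by simp only [Matrix.mul_assoc]
    _ = 1 := by
      rw [h2, mul_one, Matrix.mul_assoc (U.map _), diagonal_mul_diagonal]
      simp only [hg, diagonal_one, mul_one, h1]

theorem Matrix.IsHermitian.shifted_inv_apply {H : Matrix ι ι ℝ} (hH : H.IsHermitian) {z : A}
    {g : ι → A} (hg : ∀ k, (z - algebraMap ℝ A (hH.eigenvalues k)) * g k = 1) (i j : ι) :
    (H.shifted z)⁻¹ i j = ∑ k, ((hH.eigenvectorUnitary : Matrix ι ι ℝ) i k *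
      (hH.eigenvectorUnitary : Matrix ι ι ℝ) j k) • g k := by
  rw [Matrix.inv_eq_right_inv (hH.shifted_mul hg), Matrix.mul_apply]
  refine Finset.sum_congr rfl fun k _ => ?_
  rw [Matrix.mul_diagonal, Matrix.map_apply, Matrix.map_apply, Matrix.transpose_apply,
    Algebra.smul_def, map_mul]
  ring

theorem Matrix.IsHermitian.isUnit_det_shifted {H : Matrix ι ι ℝ} (hH : H.IsHermitian) {z : A}
    {g : ι → A} (hg : ∀ k, (z - algebraMap ℝ A (hH.eigenvalues k)) * g k = 1) :
    IsUnit (H.shifted z).det :=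
  Matrix.isUnit_det_of_right_inverse (hH.shifted_mul hg)

/-- Functional calculus from a representation of the function by resolvents. -/
theorem Matrix.IsHermitian.cfc_apply_eq {H : Matrix ι ι ℝ} (hH : H.IsHermitian) {z : A}
    {g : ι → A} (hg : ∀ k, (z - algebraMap ℝ A (hH.eigenvalues k)) * g k = 1)
    (Λ : A →ₗ[ℝ] ℝ) {f : ℝ → ℝ} (hf : ∀ k, f (hH.eigenvalues k) = Λ (g k)) (i j : ι) :
    cfc f H i j = Λ ((H.shifted z)⁻¹ i j) := by
  rw [hH.cfc_eq_mul, Matrix.mul_apply, hH.shifted_inv_apply hg, map_sum]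
  refine Finset.sum_congr rfl fun k _ => ?_
  rw [Matrix.mul_diagonal, Matrix.transpose_apply, map_smul, ← hf, smul_eq_mul]
  ring

end Algebra

/-- The Euclidean norm of a complex vector. -/
noncomputable def vecNorm (w : ι → ℂ) : ℝ := ‖(WithLp.toLp 2 w : EuclideanSpace ℂ ι)‖

omit [DecidableEq ι] in
theorem vecNorm_sq (w : ι → ℂ) : vecNorm w ^ 2 = ∑ i, ‖w i‖ ^ 2 :=
  EuclideanSpace.norm_sq_eq _

omit [DecidableEq ι] in
theorem vecNorm_nonneg (w : ι → ℂ) : 0 ≤ vecNorm w := norm_nonneg _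

omit [DecidableEq ι] in
theorem norm_le_vecNorm (w : ι → ℂ) (i : ι) : ‖w i‖ ≤ vecNorm w :=
  PiLp.norm_apply_le (WithLp.toLp 2 w : EuclideanSpace ℂ ι) i

omit [DecidableEq ι] in
theorem vecNorm_add_le (w w' : ι → ℂ) : vecNorm (w + w') ≤ vecNorm w + vecNorm w' :=
  norm_add_le (WithLp.toLp 2 w : EuclideanSpace ℂ ι) (WithLp.toLp 2 w')

theorem vecNorm_mulVec_of_isometry {V : Matrix ι ι ℂ} (hV : Vᴴ * V = 1) (w : ι → ℂ) :
    vecNorm (V *ᵥ w) = vecNorm w := by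
  have h : ∀ w : ι → ℂ, ((vecNorm w ^ 2 : ℝ) : ℂ) = star w ⬝ᵥ w := fun w => by
    rw [vecNorm_sq, dotProduct]
    push_cast
    exact Finset.sum_congr rfl fun i _ => (Complex.conj_mul' _).symm
  have h2 : vecNorm (V *ᵥ w) ^ 2 = vecNorm w ^ 2 := by
    have : ((vecNorm (V *ᵥ w) ^ 2 : ℝ) : ℂ) = ((vecNorm w ^ 2 : ℝ) : ℂ) := by
      rw [h, h, star_mulVec, dotProduct_mulVec, vecMul_vecMul, hV, vecMul_one]
    exact_mod_cast this
  exact (pow_left_inj₀ (vecNorm_nonneg _) (vecNorm_nonneg _) two_ne_zero).1 h2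

/-- The resolvent of a symmetric matrix is bounded by the distance to the spectrum. -/
theorem Matrix.IsHermitian.mul_vecNorm_le {H : Matrix ι ι ℝ} (hH : H.IsHermitian) {z : ℂ} {d : ℝ}
    (hd0 : 0 ≤ d) (hd : ∀ x ∈ spectrum ℝ H, d ≤ ‖z - x‖) (w : ι → ℂ) :
    d * vecNorm w ≤ vecNorm (H.shifted z *ᵥ w) := by
  set U := (hH.eigenvectorUnitary : Matrix ι ι ℝ) with hU
  set V := U.map (algebraMap ℝ ℂ) with hV
  have hVH : Vᴴ = (Uᵀ).map (algebraMap ℝ ℂ) := by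
    ext i j; simp [hV]
  have h1 : V * Vᴴ = 1 := by
    rw [hVH, ← Matrix.map_mul, hH.eigenvectorUnitary_mul_transpose,
      Matrix.map_one _ (map_zero _) (map_one _)]
  have h2 : Vᴴ * V = 1 := by
    rw [hVH, ← Matrix.map_mul, hH.transpose_mul_eigenvectorUnitary,
      Matrix.map_one _ (map_zero _) (map_one _)]
  have h3 : Vᴴ * H.shifted z = diagonal (fun k => z - (hH.eigenvalues k : ℂ)) * Vᴴ := by
    have e1 : diagonal (fun k => z - (hH.eigenvalues k : ℂ)) =
        z • (1 : Matrix ι ι ℂ) - (diagonal hH.eigenvalues).map (algebraMap ℝ ℂ) := by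
      rw [diagonal_map (map_zero _), Matrix.smul_one_eq_diagonal, diagonal_sub]
      rfl
    have e2 : H.map (algebraMap ℝ ℂ) = V * (diagonal hH.eigenvalues).map (algebraMap ℝ ℂ) * Vᴴ := by
      conv_lhs => rw [hH.eq_eigenvectorUnitary_mul]
      rw [Matrix.map_mul, Matrix.map_mul, hVH]
    rw [e1, Matrix.shifted, e2, mul_sub, sub_mul, ← Matrix.mul_assoc, ← Matrix.mul_assoc, h2, one_mul,
      Matrix.mul_smul, Matrix.smul_mul, mul_one, one_mul]
  have hVs : (Vᴴ)ᴴ * Vᴴ = 1 := by rw [conjTranspose_conjTranspose, h1]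
  rw [← vecNorm_mulVec_of_isometry hVs w, ← vecNorm_mulVec_of_isometry hVs (H.shifted z *ᵥ w),
    mulVec_mulVec, h3, ← mulVec_mulVec]
  refine (sq_le_sq₀ (mul_nonneg hd0 (vecNorm_nonneg _)) (vecNorm_nonneg _)).1 ?_
  rw [mul_pow, vecNorm_sq, vecNorm_sq, Finset.mul_sum]
  refine Finset.sum_le_sum fun k _ => ?_
  rw [mulVec_diagonal, norm_mul, mul_pow]
  gcongr
  exact hd _ (hH.eigenvalues_mem_spectrum_real k)

omit [DecidableEq ι] in
/-- Schur's test. -/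
theorem vecNorm_mulVec_le {W : Matrix ι ι ℂ} {k : ι → ι → ℝ} {s : ℝ} (hs : 0 ≤ s)
    (hW : ∀ i j, ‖W i j‖ ≤ k i j) (hsymm : ∀ i j, k i j = k j i) (hk : ∀ i, ∑ j, k i j ≤ s)
    (w : ι → ℂ) : vecNorm (W *ᵥ w) ≤ s * vecNorm w := by
  have k0 : ∀ i j, 0 ≤ k i j := fun i j => (norm_nonneg _).trans (hW i j)
  refine (sq_le_sq₀ (vecNorm_nonneg _) (mul_nonneg hs (vecNorm_nonneg _))).1 ?_
  rw [mul_pow, vecNorm_sq, vecNorm_sq]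
  have h1 : ∀ i, ‖(W *ᵥ w) i‖ ^ 2 ≤ s * ∑ j, k i j * ‖w j‖ ^ 2 := fun i => by
    have e1 : ‖(W *ᵥ w) i‖ ≤ ∑ j, Real.sqrt (k i j) * (Real.sqrt (k i j) * ‖w j‖) := by
      refine (norm_sum_le _ _).trans (Finset.sum_le_sum fun j _ => ?_)
      rw [norm_mul, ← mul_assoc, Real.mul_self_sqrt (k0 i j)]
      exact mul_le_mul_of_nonneg_right (hW i j) (norm_nonneg _)
    refine (pow_le_pow_left₀ (norm_nonneg _) e1 2).trans ?_
    refine (Finset.sum_mul_sq_le_sq_mul_sq _ _ _).trans ?_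
    have e2 : ∑ j, Real.sqrt (k i j) ^ 2 = ∑ j, k i j :=
      Finset.sum_congr rfl fun j _ => Real.sq_sqrt (k0 i j)
    have e3 : ∑ j, (Real.sqrt (k i j) * ‖w j‖) ^ 2 = ∑ j, k i j * ‖w j‖ ^ 2 :=
      Finset.sum_congr rfl fun j _ => by rw [mul_pow, Real.sq_sqrt (k0 i j)]
    rw [e2, e3]
    exact mul_le_mul_of_nonneg_right (hk i)
      (Finset.sum_nonneg fun j _ => mul_nonneg (k0 i j) (by positivity))
  refine (Finset.sum_le_sum fun i _ => h1 i).trans ?_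
  rw [← Finset.mul_sum, Finset.sum_comm, sq s, mul_assoc]
  refine mul_le_mul_of_nonneg_left ?_ hs
  rw [Finset.mul_sum]
  refine Finset.sum_le_sum fun j _ => ?_
  rw [← Finset.sum_mul]
  refine mul_le_mul_of_nonneg_right ?_ (by positivity)
  simp_rw [hsymm _ j]
  exact hk j

/-- Combes-Thomas estimate. -/
theorem Matrix.IsHermitian.combesThomas {H : Matrix ι ι ℝ} (hH : H.IsHermitian) {p : ι → R3}
    {C a α s d : ℝ} (ha : 0 < a) (hα : 0 ≤ α) (hαa : α ≤ a / 2) (hC : 0 ≤ C)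
    (hHb : ∀ i j, |H i j| ≤ C * Real.exp (-(a * dist (p i) (p j))))
    (hs : ∀ i, ∑ j, Real.exp (-(a / 4 * dist (p i) (p j))) ≤ s)
    (hαd : C * α * (4 / a) * s ≤ d / 2) (hd0 : 0 < d) {z : ℂ}
    (hd : ∀ x ∈ spectrum ℝ H, d ≤ ‖z - x‖) {u : ι → ℂ} {j : ι}
    (hu : H.shifted z *ᵥ u = Pi.single j 1) (i : ι) :
    ‖u i‖ ≤ 2 / d * Real.exp (-(α * dist (p i) (p j))) := by
  set E : ι → ℝ := fun i => Real.exp (α * dist (p i) (p j)) with hE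
  set w : ι → ℂ := fun i => (E i : ℂ) * u i with hw
  set W : Matrix ι ι ℂ := Matrix.of fun i m =>
    ((H i m * (Real.exp (α * dist (p i) (p j) - α * dist (p m) (p j)) - 1) : ℝ) : ℂ) with hW
  -- Conjugation by the exponential weight `E`: the weighted solution `w = E u` solves the same
  -- equation up to a perturbation `W`, whose entries are those of `H` times `E i / E m - 1`.
  have key : H.shifted z *ᵥ w = Pi.single j 1 + W *ᵥ w := by
    ext i
    have hi := congrFun hu i
    have e1 : ∀ w : ι → ℂ, (H.shifted z *ᵥ w) i = z * w i - ∑ m, (H i m : ℂ) * w m := fun w => by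
      rw [Matrix.shifted, sub_mulVec, Matrix.smul_mulVec, one_mulVec]
      simp [mulVec, dotProduct]
    rw [e1] at hi ⊢
    have e2 : (W *ᵥ w) i = (E i : ℂ) * ∑ m, (H i m : ℂ) * u m - ∑ m, (H i m : ℂ) * w m := by
      rw [Finset.mul_sum, ← Finset.sum_sub_distrib]
      refine Finset.sum_congr rfl fun m _ => ?_
      have e3 : Real.exp (α * dist (p i) (p j) - α * dist (p m) (p j)) * E m = E i := by
        rw [← Real.exp_add]; simp [hE]
      have e4 : (Real.exp (α * dist (p i) (p j) - α * dist (p m) (p j)) : ℂ) * (E m : ℂ) =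
          (E i : ℂ) := by exact_mod_cast e3
      simp only [hW, hw, Matrix.of_apply]
      push_cast
      rw [← e4]
      push_cast
      ring
    have e5 : (Pi.single j (1 : ℂ) : ι → ℂ) i = (E i : ℂ) * (Pi.single j (1 : ℂ) : ι → ℂ) i := by
      by_cases hij : i = j
      · subst hij; simp [hE]
      · simp [hij]
    rw [Pi.add_apply, e2, e5, ← hi]
    simp only [hw]
    ring
  -- Schur's test. With `x` the distance between `i` and `m`, `|E i / E m - 1| ≤ α x exp (α x)`. The
  -- factor `x` costs `(4 / a) exp (a x / 4)`, and `α ≤ a / 2` leaves the summable kernel `exp (-(a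
  -- x / 4))`.
  have hWb : vecNorm (W *ᵥ w) ≤ d / 2 * vecNorm w := by
    refine vecNorm_mulVec_le (k := fun i m => C * α * (4 / a) *
      Real.exp (-(a / 4 * dist (p i) (p m)))) (by positivity) (fun i m => ?_)
      (fun i m => by rw [dist_comm]) (fun i => ?_) w
    · set x := dist (p i) (p m) with hx
      have x0 : 0 ≤ x := dist_nonneg
      have t : |α * dist (p i) (p j) - α * dist (p m) (p j)| ≤ α * x := by
        rw [← mul_sub, abs_mul, abs_of_nonneg hα]
        exact mul_le_mul_of_nonneg_left (abs_dist_sub_le _ _ _) hα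
      have b1 : |Real.exp (α * dist (p i) (p j) - α * dist (p m) (p j)) - 1| ≤
          α * x * Real.exp (α * x) := by
        set y := α * dist (p i) (p j) - α * dist (p m) (p j)
        have y1 : y ≤ α * x := (le_abs_self _).trans t
        have y2 : -(α * x) ≤ y := (abs_le.1 t).1
        have p0 : 0 ≤ α * x := by positivity
        have q1 : Real.exp y ≤ Real.exp (α * x) := Real.exp_le_exp.2 y1
        have q2 : 1 - α * x ≤ Real.exp (-(α * x)) := by
          have := Real.add_one_le_exp (-(α * x)); linarith
        have q3 : Real.exp (-(α * x)) ≤ Real.exp y := Real.exp_le_exp.2 y2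
        have q4 : 1 ≤ Real.exp (α * x) := Real.one_le_exp p0
        have q5 : Real.exp (α * x) * Real.exp (-(α * x)) = 1 := by rw [← Real.exp_add]; simp
        rw [abs_le]
        constructor
        · nlinarith
        · nlinarith
      have b2 : a / 4 * x ≤ Real.exp (a / 4 * x) := by
        have := Real.add_one_le_exp (a / 4 * x); linarith
      simp only [hW, Matrix.of_apply, Complex.norm_real, Real.norm_eq_abs, abs_mul]
      calc |H i m| * |Real.exp (α * dist (p i) (p j) - α * dist (p m) (p j)) - 1|
          ≤ (C * Real.exp (-(a * x))) * (α * x * Real.exp (α * x)) :=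
            mul_le_mul (hHb i m) b1 (abs_nonneg _) (by positivity)
        _ = C * α * (4 / a) * (a / 4 * x) * Real.exp (α * x - a * x) := by
            rw [sub_eq_add_neg, Real.exp_add]; field_simp
        _ ≤ C * α * (4 / a) * Real.exp (a / 4 * x) * Real.exp (-(a / 2 * x)) := by
            gcongr
            nlinarith
        _ = _ := by
            rw [mul_assoc, ← Real.exp_add]; ring_nf
    · rw [← Finset.mul_sum]
      refine le_trans ?_ hαd
      gcongr
      exact hs i
  have h1 : vecNorm (Pi.single j 1 : ι → ℂ) = 1 := by
    have : vecNorm (Pi.single j 1 : ι → ℂ) ^ 2 = 1 := by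
      rw [vecNorm_sq, Finset.sum_eq_single j] <;> simp +contextual
    exact (pow_eq_one_iff_of_nonneg (vecNorm_nonneg _) two_ne_zero).1 this
  have h2 := hH.mul_vecNorm_le hd0.le hd w
  rw [key] at h2
  have h3 := h2.trans (vecNorm_add_le _ _)
  rw [h1] at h3
  -- The perturbation takes at most half of the lower bound `d`, so `w` is bounded by `2 / d`;
  -- removing the weight `E i` gives the decay.
  have h4 : vecNorm w ≤ 2 / d := by
    rw [le_div_iff₀ hd0]; nlinarith
  have h5 := (norm_le_vecNorm w i).trans h4
  simp only [hw, norm_mul, Complex.norm_real, Real.norm_eq_abs] at h5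
  rw [abs_of_pos (Real.exp_pos _)] at h5
  rw [Real.exp_neg, ← div_eq_mul_inv, le_div_iff₀ (Real.exp_pos _), mul_comm]
  exact h5

theorem Matrix.exists_eigenvector_of_mem_spectrum {H : Matrix ι ι ℝ} {x : ℝ}
    (hx : x ∈ spectrum ℝ H) : ∃ w : ι → ℂ, 0 < vecNorm w ∧
      H.map (algebraMap ℝ ℂ) *ᵥ w = (x : ℂ) • w := by
  have h1 : ¬ IsUnit (algebraMap ℝ (Matrix ι ι ℝ) x - H) := hx
  rw [Matrix.isUnit_iff_isUnit_det, isUnit_iff_ne_zero, not_not] at h1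
  obtain ⟨u, hu0, hu⟩ := Matrix.exists_mulVec_eq_zero_iff.2 h1
  refine ⟨fun i => (u i : ℂ), ?_, ?_⟩
  · obtain ⟨i, hi⟩ := Function.ne_iff.1 hu0
    refine lt_of_lt_of_le ?_ (norm_le_vecNorm _ i)
    simpa using hi
  · ext i
    have := congrFun hu i
    rw [sub_mulVec, Pi.sub_apply, Pi.zero_apply, sub_eq_zero, Algebra.algebraMap_eq_smul_one,
      Matrix.smul_mulVec, one_mulVec, Pi.smul_apply, smul_eq_mul] at this
    have h2 : ((H *ᵥ u) i : ℂ) = (x : ℂ) * u i := by rw [← this]; push_cast; rfl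
    rw [Pi.smul_apply, smul_eq_mul, ← h2]
    simp [mulVec, dotProduct]

/-- The spectrum of a symmetric matrix is stable under perturbations. -/
theorem Matrix.IsHermitian.exists_mem_spectrum_near {H H' : Matrix ι ι ℝ} (hH : H.IsHermitian)
    {ε δ : ℝ} (hε : 0 < ε) (hδ : 0 ≤ δ) (h : ∀ i j, |H' i j - H i j| ≤ δ)
    (hδε : Fintype.card ι * δ < ε) {x : ℝ} (hx : x ∈ spectrum ℝ H') :
    ∃ y ∈ spectrum ℝ H, |x - y| < ε := by
  -- Otherwise `x - H` would be bounded below by `ε`. But on an eigenvector of `H'` with eigenvalue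
  -- `x` it acts as `H' - H`, of norm less than `ε`.
  by_contra! hcon
  obtain ⟨w, hw0, hw⟩ := Matrix.exists_eigenvector_of_mem_spectrum hx
  have h1 := hH.mul_vecNorm_le (z := (x : ℂ)) hε.le (fun y hy => by
    rw [← Complex.ofReal_sub, Complex.norm_real, Real.norm_eq_abs]; exact hcon y hy) w
  have h2 : H.shifted (x : ℂ) *ᵥ w = (H'.map (algebraMap ℝ ℂ) - H.map (algebraMap ℝ ℂ)) *ᵥ w := by
    rw [Matrix.shifted, sub_mulVec, sub_mulVec, hw, Matrix.smul_mulVec, one_mulVec]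
  have h3 : vecNorm ((H'.map (algebraMap ℝ ℂ) - H.map (algebraMap ℝ ℂ)) *ᵥ w) ≤
      (Fintype.card ι * δ) * vecNorm w := by
    refine vecNorm_mulVec_le (k := fun _ _ => δ) (by positivity) (fun i j => ?_)
      (fun _ _ => rfl) (fun i => by simp) w
    simp only [Matrix.sub_apply, Matrix.map_apply, Complex.coe_algebraMap, ← Complex.ofReal_sub,
      Complex.norm_real, Real.norm_eq_abs]
    exact h i j
  rw [h2] at h1
  nlinarith

/-- The spectrum of a symmetric matrix is bounded by its largest row sum. -/
theorem Matrix.abs_le_of_mem_spectrum {H : Matrix ι ι ℝ} {k : ι → ι → ℝ} {s : ℝ}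
    (hs : 0 ≤ s) (hH : ∀ i j, |H i j| ≤ k i j) (hsymm : ∀ i j, k i j = k j i)
    (hk : ∀ i, ∑ j, k i j ≤ s) {x : ℝ} (hx : x ∈ spectrum ℝ H) : |x| ≤ s := by
  obtain ⟨w, hw0, hw⟩ := Matrix.exists_eigenvector_of_mem_spectrum hx
  have h1 := vecNorm_mulVec_le (W := H.map (algebraMap ℝ ℂ)) hs
    (fun i j => by simpa using hH i j) hsymm hk w
  have h2 : vecNorm ((x : ℂ) • w) = |x| * vecNorm w := by
    refine (pow_left_inj₀ (vecNorm_nonneg _)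
      (mul_nonneg (abs_nonneg x) (vecNorm_nonneg _)) two_ne_zero).1 ?_
    rw [mul_pow, vecNorm_sq, vecNorm_sq, Finset.mul_sum]
    exact Finset.sum_congr rfl fun i _ => by simp [mul_pow]
  rw [hw, h2] at h1
  exact le_of_mul_le_mul_right h1 hw0

end Resolvent

/-! ### Jets of resolvents -/

section ResolventJets

open Filter Topology

variable {ι : Type*} [Fintype ι] [DecidableEq ι] {E : Type*} [NormedAddCommGroup E]
  [NormedSpace ℝ E] {A : Type*} [NormedCommRing A] [NormedAlgebra ℝ A]

theorem norm_iteratedFDeriv_smul_le_of_contDiffAt {f : E → ℝ} {g : E → A} {n : ℕ} {x : E}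
    (hf : ContDiffAt ℝ n f x) (hg : ContDiffAt ℝ n g x) :
    ‖iteratedFDeriv ℝ n (fun y => f y • g y) x‖ ≤ ∑ i ∈ Finset.range (n + 1),
      (n.choose i : ℝ) * ‖iteratedFDeriv ℝ i f x‖ * ‖iteratedFDeriv ℝ (n - i) g x‖ := by
  obtain ⟨s, hs, hxs, hfs⟩ := hf.exists_isOpen_contDiffOn
  obtain ⟨u, hu, hxu, hgu⟩ := hg.exists_isOpen_contDiffOn
  have ho : IsOpen (s ∩ u) := hs.inter hu
  have hx : x ∈ s ∩ u := ⟨hxs, hxu⟩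
  have := norm_iteratedFDerivWithin_smul_le (𝕜 := ℝ) (𝕜' := ℝ) (hfs.mono Set.inter_subset_left)
    (hgu.mono Set.inter_subset_right) ho.uniqueDiffOn hx (n := n) le_rfl
  simpa only [iteratedFDerivWithin_of_isOpen _ ho hx] using this

theorem ContDiffAt.matrix_det {n : ℕ} {T : E → Matrix ι ι A} {x : E}
    (h : ∀ i j, ContDiffAt ℝ n (fun y => T y i j) x) : ContDiffAt ℝ n (fun y => (T y).det) x := by
  simp only [Matrix.det_apply]
  refine ContDiffAt.sum fun σ _ => ?_
  have h1 : ContDiffAt ℝ n (fun y => ∏ i, T y (σ i) i) x := contDiffAt_prod fun i _ => h _ _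
  simp only [Units.smul_def, ← Int.cast_smul_eq_zsmul ℝ]
  exact h1.const_smul _

/-- By Cramer's rule the only operation beyond polynomials in the entries is the inversion of the
determinant in the complete algebra `A`. -/
theorem ContDiffAt.matrix_inv [CompleteSpace A] {n : ℕ} {T : E → Matrix ι ι A} {x : E}
    (h : ∀ i j, ContDiffAt ℝ n (fun y => T y i j) x) (hu : IsUnit (T x).det) (i j : ι) :
    ContDiffAt ℝ n (fun y => (T y)⁻¹ i j) x := by
  simp only [Matrix.inv_def, Matrix.smul_apply, smul_eq_mul, Matrix.adjugate_apply]
  refine ContDiffAt.mul ?_ ?_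
  · obtain ⟨w, hw⟩ := hu
    have h1 : ContDiffAt ℝ n Ring.inverse (T x).det := by
      rw [← hw]; exact contDiffAt_ringInverse ℝ w
    exact h1.comp x (ContDiffAt.matrix_det h)
  · refine ContDiffAt.matrix_det fun k l => ?_
    by_cases hk : k = j
    · subst hk
      simp only [Matrix.updateRow_self]
      exact contDiffAt_const
    · simp only [Matrix.updateRow_ne hk]
      exact h _ _

theorem Matrix.shifted_inv_sub {z : A} {H H' : Matrix ι ι ℝ} (hH : IsUnit (H.shifted z).det)
    (hH' : IsUnit (H'.shifted z).det) :
    (H'.shifted z)⁻¹ = (H.shifted z)⁻¹ +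
      (H.shifted z)⁻¹ * ((H' - H).map (algebraMap ℝ A)) * (H'.shifted z)⁻¹ := by
  have h1 : (H' - H).map (algebraMap ℝ A) = H.shifted z - H'.shifted z := by
    rw [Matrix.shifted, Matrix.shifted, Matrix.map_sub _ (map_sub (algebraMap ℝ A))]
    abel
  rw [h1, mul_sub, sub_mul, Matrix.nonsing_inv_mul _ hH, one_mul, Matrix.mul_assoc,
    Matrix.mul_nonsing_inv _ hH', mul_one]
  abel

variable {p : ι → R3} {H : E → Matrix ι ι ℝ} {z : A} {C K s α η : ℝ} {τ : ι → ℝ} {N : ℕ}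

theorem contDiffAt_shifted_inv [CompleteSpace A] {x : E}
    (hH : ∀ i j, ContDiffAt ℝ N (fun h => H h i j) x)
    (hu : IsUnit ((H x).shifted z).det) (i j : ι) :
    ContDiffAt ℝ N (fun h => ((H h).shifted z)⁻¹ i j) x := by
  refine ContDiffAt.matrix_inv (T := fun h => (H h).shifted z) (fun i j => ?_) hu i j
  have h1 : ∀ h, (H h).shifted z i j = z * (1 : Matrix ι ι A) i j -
      algebraMapCLM ℝ A (H h i j) := fun h => rfl
  simp only [h1]
  exact contDiffAt_const.sub ((algebraMapCLM ℝ A).contDiff.contDiffAt.comp x (hH i j))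

/-- Off-diagonal decay of the jets of a resolvent. -/
theorem jetBound_shifted_inv [CompleteSpace A] (hC : 0 ≤ C) (hK : 0 ≤ K) (hα : 0 ≤ α)
    (hη : 0 ≤ η) (hNη : N * η ≤ α / 4) (hτ : ∀ i, 0 ≤ τ i)
    (hττ : ∀ i j, τ j ≤ τ i * Real.exp (η * dist (p i) (p j)))
    (hs : ∀ i, ∑ j, Real.exp (-(α / 4 * dist (p i) (p j))) ≤ s)
    (hH : ∀ i j, JetBound N (fun h => H h i j) 0 (C * Real.exp (-(α * dist (p i) (p j)))) (τ i))
    (hu : IsUnit ((H 0).shifted z).det)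
    (hR : ∀ i j, ‖((H 0).shifted z)⁻¹ i j‖ ≤ K * Real.exp (-(α * dist (p i) (p j)))) (i j : ι) :
    JetBound N (fun h => ((H h).shifted z)⁻¹ i j) 0
      (K * (1 + K * C * s ^ 2 * 2 ^ N) ^ N * Real.exp (-(α / 2 * dist (p i) (p j)))) (τ i) := by
  set R : E → Matrix ι ι A := fun h => ((H h).shifted z)⁻¹ with hRdef
  have hs0 : 0 ≤ s := (Finset.sum_nonneg fun j _ => (Real.exp_pos _).le).trans (hs i)
  have hcd : ∀ i j, ContDiffAt ℝ N (fun h => R h i j) 0 :=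
    contDiffAt_shifted_inv (fun i j => (hH i j).contDiffAt) hu
  set D := 1 + K * C * s ^ 2 * 2 ^ N with hD
  have hD1 : 1 ≤ D := by
    have : 0 ≤ K * C * s ^ 2 * 2 ^ N := by positivity
    linarith
  -- the resolvent identity, locally
  have hdet : ∀ᶠ h in 𝓝 (0 : E), IsUnit ((H h).shifted z).det := by
    have h1 : ContDiffAt ℝ N (fun h => ((H h).shifted z).det) 0 :=
      ContDiffAt.matrix_det fun i j =>
        contDiffAt_const.sub ((algebraMapCLM ℝ A).contDiff.contDiffAt.comp 0 (hH i j).contDiffAt)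
    exact h1.continuousAt.eventually (Units.isOpen.mem_nhds hu)
  have hid : ∀ i j, (fun h => R h i j) =ᶠ[𝓝 0] fun h => R 0 i j + ∑ q, ∑ m,
      R 0 i m * ((H h m q - H 0 m q) • R h q j) := fun i j => by
    filter_upwards [hdet] with h hh
    have h1 := congrFun (congrFun (Matrix.shifted_inv_sub hu hh) i) j
    simp only [hRdef]
    rw [h1, Matrix.add_apply, Matrix.mul_apply]
    congr 1
    refine Finset.sum_congr rfl fun q _ => ?_
    rw [Matrix.mul_apply, Finset.sum_mul]
    refine Finset.sum_congr rfl fun m _ => ?_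
    rw [Matrix.map_apply, Matrix.sub_apply, Algebra.smul_def, mul_assoc]
  -- Induction on the order through `R h = R 0 + R 0 (H h - H 0) R h`. Since `H h - H 0` vanishes at
  -- the base point, the Leibniz term with all derivatives on `R h` drops out and only lower orders
  -- remain. Each order costs at most one factor `D`.
  have key : ∀ n, n ≤ N → ∀ i j, ‖iteratedFDeriv ℝ n (fun h => R h i j) 0‖ ≤
      K * D ^ n * Real.exp (-(α / 2 * dist (p i) (p j))) * τ i ^ n := by
    intro n
    induction n using Nat.strong_induction_on with
    | _ n ih =>
    intro hn i j
    rcases Nat.eq_zero_or_pos n with rfl | hn0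
    · rw [norm_iteratedFDeriv_zero, pow_zero, pow_zero, mul_one, mul_one]
      refine (hR i j).trans (mul_le_mul_of_nonneg_left (Real.exp_le_exp.2 ?_) hK)
      have := mul_nonneg hα (dist_nonneg (x := p i) (y := p j))
      linarith
    have hcdn : ∀ i j, ContDiffAt ℝ n (fun h => R h i j) 0 := fun i j =>
      (hcd i j).of_le (by exact_mod_cast hn)
    have hHn : ∀ m q, ContDiffAt ℝ n (fun h => H h m q - H 0 m q) 0 := fun m q =>
      ((hH m q).contDiffAt.of_le (by exact_mod_cast hn)).sub contDiffAt_const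
    have hprod : ∀ m q, ContDiffAt ℝ n (fun h => (H h m q - H 0 m q) • R h q j) 0 := fun m q =>
      (hHn m q).smul (hcdn q j)
    -- derivatives of the product
    have hterm : ∀ m q, ‖iteratedFDeriv ℝ n (fun h => (H h m q - H 0 m q) • R h q j) 0‖ ≤
        C * K * D ^ (n - 1) * 2 ^ n * τ i ^ n * Real.exp (n * (η * (dist (p i) (p m) +
          dist (p m) (p q)))) * Real.exp (-(α * dist (p m) (p q))) *
          Real.exp (-(α / 2 * dist (p q) (p j))) := by
      intro m q
      refine (norm_iteratedFDeriv_smul_le_of_contDiffAt (hHn m q) (hcdn q j)).trans ?_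
      set X := C * K * D ^ (n - 1) * τ i ^ n * Real.exp (n * (η * (dist (p i) (p m) +
          dist (p m) (p q)))) * Real.exp (-(α * dist (p m) (p q))) *
          Real.exp (-(α / 2 * dist (p q) (p j))) with hX
      have hXs : ∀ k ∈ Finset.range (n + 1), (n.choose k : ℝ) *
          ‖iteratedFDeriv ℝ k (fun h => H h m q - H 0 m q) 0‖ *
          ‖iteratedFDeriv ℝ (n - k) (fun h => R h q j) 0‖ ≤ n.choose k * X := by
        intro k hk
        have hkn : k ≤ n := Nat.lt_succ_iff.1 (Finset.mem_range.1 hk)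
        have hX0 : 0 ≤ X := by
          have := hτ i
          positivity
        rcases Nat.eq_zero_or_pos k with rfl | hk0
        · simpa using hX0
        have e1 : ‖iteratedFDeriv ℝ k (fun h => H h m q - H 0 m q) 0‖ ≤
            C * Real.exp (-(α * dist (p m) (p q))) * τ m ^ k := by
          rw [fun_iteratedFDeriv_sub_apply
            ((hH m q).contDiffAt.of_le (by exact_mod_cast hkn.trans hn)) contDiffAt_const,
            iteratedFDeriv_const_of_ne hk0.ne', Pi.zero_apply, sub_zero]
          exact (hH m q).bound k (hkn.trans hn)
        have e2 := ih (n - k) (by omega) ((Nat.sub_le _ _).trans hn) q j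
        have e3 : D ^ (n - k) ≤ D ^ (n - 1) := pow_le_pow_right₀ hD1 (by omega)
        set ρ := η * (dist (p i) (p m) + dist (p m) (p q)) with hρ
        have t1 : τ m ≤ τ i * Real.exp ρ := (hττ i m).trans (by
          have := hτ i
          have h0 := mul_nonneg hη (dist_nonneg (x := p m) (y := p q))
          gcongr
          rw [hρ, mul_add]
          linarith)
        have t2 : τ q ≤ τ i * Real.exp ρ := (hττ i q).trans (by
          have := hτ i
          gcongr
          exact mul_le_mul_of_nonneg_left (dist_triangle _ _ _) hη)
        have t3 : τ m ^ k * τ q ^ (n - k) ≤ τ i ^ n * Real.exp (n * ρ) := by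
          calc τ m ^ k * τ q ^ (n - k) ≤ (τ i * Real.exp ρ) ^ k * (τ i * Real.exp ρ) ^ (n - k) := by
                have := hτ m
                have := hτ q
                have := hτ i
                gcongr
            _ = _ := by
                rw [← pow_add, Nat.add_sub_cancel' hkn, mul_pow, ← Real.exp_nat_mul]
        rw [mul_assoc]
        refine mul_le_mul_of_nonneg_left ?_ (Nat.cast_nonneg _)
        have hτm := hτ m
        have hτq := hτ q
        have hτi := hτ i
        calc _ ≤ (C * Real.exp (-(α * dist (p m) (p q))) * τ m ^ k) *
              (K * D ^ (n - k) * Real.exp (-(α / 2 * dist (p q) (p j))) * τ q ^ (n - k)) := by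
              gcongr
          _ = (C * K * D ^ (n - k)) * (τ m ^ k * τ q ^ (n - k)) *
              (Real.exp (-(α * dist (p m) (p q))) * Real.exp (-(α / 2 * dist (p q) (p j)))) := by
              ring
          _ ≤ (C * K * D ^ (n - 1)) * (τ i ^ n * Real.exp (n * ρ)) *
              (Real.exp (-(α * dist (p m) (p q))) * Real.exp (-(α / 2 * dist (p q) (p j)))) := by
              gcongr
          _ = X := by rw [hX]; ring
      refine (Finset.sum_le_sum hXs).trans (le_of_eq ?_)
      rw [← Finset.sum_mul]
      have : (∑ k ∈ Finset.range (n + 1), (n.choose k : ℝ)) = 2 ^ n := by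
        exact_mod_cast Nat.sum_range_choose n
      rw [this, hX]
      ring
    -- multiplication by the resolvent at the base point
    have hterm2 : ∀ m q, ‖iteratedFDeriv ℝ n
        (fun h => R 0 i m * ((H h m q - H 0 m q) • R h q j)) 0‖ ≤
        K * D ^ (n - 1) * (K * C * 2 ^ n) * τ i ^ n * Real.exp (-(α / 2 * dist (p i) (p j))) *
          (Real.exp (-(α / 4 * dist (p i) (p m))) * Real.exp (-(α / 4 * dist (p m) (p q)))) := by
      intro m q
      have h1 := ((ContinuousLinearMap.mul ℝ A) (R 0 i m)).norm_iteratedFDeriv_comp_left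
        (hprod m q) (n := n) le_rfl
      have h2 : ‖(ContinuousLinearMap.mul ℝ A) (R 0 i m)‖ ≤
          K * Real.exp (-(α * dist (p i) (p m))) :=
        (ContinuousLinearMap.opNorm_mul_apply_le ℝ A _).trans (hR i m)
      refine h1.trans ((mul_le_mul h2 (hterm m q) (norm_nonneg _) (by positivity)).trans ?_)
      -- The triangle inequality uses rate `α / 2` along the chain `i, m, q, j`. Of the other `α /
      -- 2` on the first two links, `α / 4` pays for the weights and `α / 4` for summing over `m`
      -- and `q`, which gives `s ^ 2`.
      have e : Real.exp (-(α * dist (p i) (p m))) * Real.exp (n * (η * (dist (p i) (p m) +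
          dist (p m) (p q)))) * Real.exp (-(α * dist (p m) (p q))) *
          Real.exp (-(α / 2 * dist (p q) (p j))) ≤ Real.exp (-(α / 2 * dist (p i) (p j))) *
          (Real.exp (-(α / 4 * dist (p i) (p m))) * Real.exp (-(α / 4 * dist (p m) (p q)))) := by
        simp only [← Real.exp_add]
        refine Real.exp_le_exp.2 ?_
        have d1 := dist_nonneg (x := p i) (y := p m)
        have d2 := dist_nonneg (x := p m) (y := p q)
        have t := dist_triangle4 (p i) (p m) (p q) (p j)
        have hn' : (n : ℝ) * η ≤ α / 4 :=
          (mul_le_mul_of_nonneg_right (by exact_mod_cast hn) hη).trans hNη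
        have f1 := mul_le_mul_of_nonneg_right hn' (add_nonneg d1 d2)
        have f2 := mul_le_mul_of_nonneg_left t ((by positivity : 0 ≤ α / 2))
        linarith
      have hτi := hτ i
      calc _ = K * D ^ (n - 1) * (K * C * 2 ^ n) * τ i ^ n *
          (Real.exp (-(α * dist (p i) (p m))) * Real.exp (n * (η * (dist (p i) (p m) +
          dist (p m) (p q)))) * Real.exp (-(α * dist (p m) (p q))) *
          Real.exp (-(α / 2 * dist (p q) (p j)))) := by ring
        _ ≤ _ := by
          rw [mul_assoc (K * D ^ (n - 1) * (K * C * 2 ^ n) * τ i ^ n)]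
          gcongr
    have hsum : ∑ q, ∑ m, Real.exp (-(α / 4 * dist (p i) (p m))) *
        Real.exp (-(α / 4 * dist (p m) (p q))) ≤ s ^ 2 := by
      rw [Finset.sum_comm]
      simp only [← Finset.mul_sum]
      calc _ ≤ ∑ m, Real.exp (-(α / 4 * dist (p i) (p m))) * s := by
            gcongr with m
            exact hs m
        _ ≤ s * s := by rw [← Finset.sum_mul]; gcongr; exact hs i
        _ = s ^ 2 := (sq s).symm
    rw [((hid i j).iteratedFDeriv ℝ n).eq_of_nhds]
    have hc2 : ∀ m q, ContDiffAt ℝ n (fun h => R 0 i m * ((H h m q - H 0 m q) • R h q j)) 0 :=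
      fun m q => contDiffAt_const.mul (hprod m q)
    rw [fun_iteratedFDeriv_add_apply contDiffAt_const
      (ContDiffAt.sum fun q _ => ContDiffAt.sum fun m _ => hc2 m q),
      iteratedFDeriv_const_of_ne hn0.ne', Pi.zero_apply, zero_add,
      iteratedFDeriv_fun_sum_apply fun q _ => ContDiffAt.sum fun m _ => hc2 m q]
    refine (norm_sum_le_of_le (f := fun q => iteratedFDeriv ℝ n (fun h => ∑ m,
      R 0 i m * ((H h m q - H 0 m q) • R h q j)) 0) _ fun q _ => ?_).trans (b := ∑ q, ∑ m,
        K * D ^ (n - 1) * (K * C * 2 ^ n) * τ i ^ n * Real.exp (-(α / 2 * dist (p i) (p j))) *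
          (Real.exp (-(α / 4 * dist (p i) (p m))) * Real.exp (-(α / 4 * dist (p m) (p q))))) ?_
    · rw [iteratedFDeriv_fun_sum_apply fun m _ => hc2 m q]
      exact norm_sum_le_of_le _ fun m _ => hterm2 m q
    · simp only [← Finset.mul_sum]
      have hτi := hτ i
      have h2n : (2 : ℝ) ^ n ≤ 2 ^ N := pow_le_pow_right₀ (by norm_num) hn
      calc _ ≤ K * D ^ (n - 1) * (K * C * 2 ^ N) * τ i ^ n *
            Real.exp (-(α / 2 * dist (p i) (p j))) * s ^ 2 := by
            gcongr
        _ = K * D ^ (n - 1) * (K * C * s ^ 2 * 2 ^ N) * Real.exp (-(α / 2 * dist (p i) (p j))) *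
            τ i ^ n := by ring
        _ ≤ K * D ^ (n - 1) * D * Real.exp (-(α / 2 * dist (p i) (p j))) * τ i ^ n := by
            gcongr
            linarith
        _ = _ := by rw [mul_assoc K, ← pow_succ, Nat.sub_add_cancel hn0]
  refine ⟨hcd i j, fun n hn => (key n hn i j).trans ?_⟩
  have := hτ i
  gcongr

end ResolventJets

/-! ### Representation of functions by resolvents -/

section ResolventRep

open Filter Topology

/-- On a neighbourhood of `K`, the function `f` is a superposition of resolvents
`x ↦ (z - x)⁻¹` with `z` at distance at least `d` from `K`. -/
def HasResolventRep (K : Set ℝ) (d : ℝ) (f : ℝ → ℂ) : Prop :=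
  ∃ (I : Type) (_ : TopologicalSpace I) (_ : CompactSpace I) (z : C(I, ℂ))
    (Λ : C(I, ℂ) →L[ℝ] ℂ) (ε : ℝ), 0 < ε ∧ ε < d ∧ (∀ s, ∀ x ∈ K, d ≤ ‖z s - x‖) ∧
    ∀ x y, y ∈ K → |x - y| < ε → ∀ g : C(I, ℂ), (∀ s, (z s - x) * g s = 1) → f x = Λ g

variable {K : Set ℝ} {d : ℝ} {f f' : ℝ → ℂ}

theorem HasResolventRep.mono (h : HasResolventRep K d f) {d' : ℝ} (hd' : 0 < d') (hd : d' ≤ d) :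
    HasResolventRep K d' f := by
  obtain ⟨I, _, _, z, Λ, ε, h0, h1, h2, h3⟩ := h
  exact ⟨I, _, ‹_›, z, Λ, min ε (d' / 2), by positivity, (min_le_right _ _).trans_lt (by linarith),
    fun s x hx => hd.trans (h2 s x hx),
    fun x y hy hxy => h3 x y hy (hxy.trans_le (min_le_left _ _))⟩

theorem HasResolventRep.congr (h : HasResolventRep K d f) {δ : ℝ} (hδ : 0 < δ)
    (hf : ∀ x y, y ∈ K → |x - y| < δ → f' x = f x) : HasResolventRep K d f' := by
  obtain ⟨I, _, _, z, Λ, ε, h0, h1, h2, h3⟩ := h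
  exact ⟨I, _, ‹_›, z, Λ, min ε δ, by positivity, (min_le_left _ _).trans_lt h1, h2,
    fun x y hy hxy g hg => (hf x y hy (hxy.trans_le (min_le_right _ _))).trans
      (h3 x y hy (hxy.trans_le (min_le_left _ _)) g hg)⟩

/-- Composition with a continuous map, as a bounded operator on continuous functions. -/
noncomputable def ContinuousMap.compRightReal {I J : Type} [TopologicalSpace I] [CompactSpace I]
    [TopologicalSpace J] [CompactSpace J] (φ : C(I, J)) : C(J, ℂ) →L[ℝ] C(I, ℂ) :=
  LinearMap.mkContinuous
    { toFun := fun g => g.comp φ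
      map_add' := fun _ _ => rfl
      map_smul' := fun _ _ => rfl } 1 fun g => by
    rw [one_mul]
    exact (ContinuousMap.norm_le _ (norm_nonneg _)).2 fun s => g.norm_coe_le_norm _

/-- The two contours are put side by side, as a disjoint union of index spaces. -/
theorem HasResolventRep.add (h : HasResolventRep K d f) (h' : HasResolventRep K d f') :
    HasResolventRep K d fun x => f x + f' x := by
  obtain ⟨I, _, _, z, Λ, ε, h0, h1, h2, h3⟩ := h
  obtain ⟨I', _, _, z', Λ', ε', h0', h1', h2', h3'⟩ := h'
  refine ⟨I ⊕ I', inferInstance, inferInstance, ⟨Sum.elim z z', by fun_prop⟩,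
    Λ.comp (ContinuousMap.compRightReal ⟨Sum.inl, continuous_inl⟩) +
      Λ'.comp (ContinuousMap.compRightReal ⟨Sum.inr, continuous_inr⟩), min ε ε', by positivity,
    (min_le_left _ _).trans_lt h1, ?_, ?_⟩
  · rintro (s | s) x hx
    · exact h2 s x hx
    · exact h2' s x hx
  · intro x y hy hxy g hg
    have e1 := h3 x y hy (hxy.trans_le (min_le_left _ _)) (g.comp ⟨Sum.inl, continuous_inl⟩)
      fun s => hg (Sum.inl s)
    have e2 := h3' x y hy (hxy.trans_le (min_le_right _ _)) (g.comp ⟨Sum.inr, continuous_inr⟩)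
      fun s => hg (Sum.inr s)
    exact congrArg₂ (· + ·) e1 e2

/-- Integration against a continuous weight over an interval. -/
noncomputable def intervalFunctional {a b : ℝ} (hab : a ≤ b) (w : C(Set.Icc a b, ℂ)) :
    C(Set.Icc a b, ℂ) →L[ℝ] ℂ :=
  LinearMap.mkContinuous
    { toFun := fun g => ∫ u in a..b, w (Set.projIcc a b hab u) * g (Set.projIcc a b hab u)
      map_add' := fun g g' => by
        simp only [ContinuousMap.add_apply, mul_add]
        exact intervalIntegral.integral_add (Continuous.intervalIntegrable (by fun_prop) _ _)
          (Continuous.intervalIntegrable (by fun_prop) _ _)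
      map_smul' := fun c g => by
        simp only [ContinuousMap.smul_apply, mul_smul_comm, RingHom.id_apply]
        exact intervalIntegral.integral_smul _ _ } (‖w‖ * |b - a|) fun g => by
    refine (intervalIntegral.norm_integral_le_of_norm_le_const (C := ‖w‖ * ‖g‖)
      fun u _ => ?_).trans (le_of_eq (by ring))
    rw [norm_mul]
    exact mul_le_mul (w.norm_coe_le_norm _) (g.norm_coe_le_norm _) (norm_nonneg _) (norm_nonneg _)

theorem hasResolventRep_segment {a b : ℝ} (hab : a ≤ b) {γ w : ℝ → ℂ} (hγ : Continuous γ)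
    (hw : ContinuousOn w (Set.Icc a b)) (hd0 : 0 < d)
    (hd : ∀ u ∈ Set.Icc a b, ∀ x ∈ K, d ≤ ‖γ u - x‖) :
    HasResolventRep K d fun x => ∫ u in a..b, w u * (γ u - x)⁻¹ := by
  refine ⟨Set.Icc a b, inferInstance, inferInstance, ⟨fun u => γ u, by fun_prop⟩,
    intervalFunctional hab ⟨fun u => w u, hw.domRestrict⟩, d / 2, by positivity, by linarith,
    fun s x hx => hd s s.2 x hx, fun x y hy hxy g hg => ?_⟩
  simp only [intervalFunctional, LinearMap.mkContinuous_apply, LinearMap.coe_mk, AddHom.coe_mk]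
  refine intervalIntegral.integral_congr fun u hu => ?_
  rw [Set.uIcc_of_le hab] at hu
  simp only [Set.projIcc_of_mem hab hu]
  have h1 : (γ u - x) * g ⟨u, hu⟩ = 1 := hg ⟨u, hu⟩
  rw [inv_eq_of_mul_eq_one_right h1]
  rfl

/-- The integral of `g` along the boundary of `[a, b] × [-h, h]`. -/
noncomputable def rectIntegral (a b h : ℝ) (g : ℂ → ℂ) : ℂ :=
  (∫ u in a..b, g (u + (-h : ℝ) * Complex.I)) - (∫ u in a..b, g (u + h * Complex.I)) +
    Complex.I * (∫ y in (-h)..h, g (b + y * Complex.I)) -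
    Complex.I * ∫ y in (-h)..h, g (a + y * Complex.I)

theorem rectIntegral_sub {a b h : ℝ} (hab : a ≤ b) (hh : 0 ≤ h) {g g' : ℂ → ℂ} {s : Set ℂ}
    (hg : ContinuousOn g s) (hg' : ContinuousOn g' s)
    (h1 : ∀ u ∈ Set.Icc a b, (u + (-h : ℝ) * Complex.I : ℂ) ∈ s)
    (h2 : ∀ u ∈ Set.Icc a b, (u + h * Complex.I : ℂ) ∈ s)
    (h3 : ∀ y ∈ Set.Icc (-h) h, (b + y * Complex.I : ℂ) ∈ s)
    (h4 : ∀ y ∈ Set.Icc (-h) h, (a + y * Complex.I : ℂ) ∈ s) :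
    rectIntegral a b h (fun z => g z - g' z) = rectIntegral a b h g - rectIntegral a b h g' := by
  have hh' : -h ≤ h := by linarith
  have key : ∀ {c e : ℝ} (_ : c ≤ e) (γ : ℝ → ℂ), Continuous γ →
      (∀ u ∈ Set.Icc c e, γ u ∈ s) → (∫ u in c..e, (g (γ u) - g' (γ u))) =
        (∫ u in c..e, g (γ u)) - ∫ u in c..e, g' (γ u) := fun {c e} hce γ hγ hs => by
    refine intervalIntegral.integral_sub ?_ ?_
    · exact (hg.comp hγ.continuousOn hs).intervalIntegrable_of_Icc hce
    · exact (hg'.comp hγ.continuousOn hs).intervalIntegrable_of_Icc hce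
  unfold rectIntegral
  rw [key hab (fun u => u + (-h : ℝ) * Complex.I) (by fun_prop) h1,
    key hab (fun u => u + h * Complex.I) (by fun_prop) h2,
    key hh' (fun y => b + y * Complex.I) (by fun_prop) h3,
    key hh' (fun y => a + y * Complex.I) (by fun_prop) h4]
  ring

theorem rectIntegral_const_mul (a b h : ℝ) (c : ℂ) (g : ℂ → ℂ) :
    rectIntegral a b h (fun z => c * g z) = c * rectIntegral a b h g := by
  simp only [rectIntegral, intervalIntegral.integral_const_mul]
  ring

/-- Cauchy's theorem for rectangles. -/
theorem rectIntegral_eq_zero {a b h : ℝ} (hab : a ≤ b) (hh : 0 ≤ h) {g : ℂ → ℂ} {U : Set ℂ}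
    (hg : DifferentiableOn ℂ g U)
    (hU : ∀ z : ℂ, a ≤ z.re → z.re ≤ b → |z.im| ≤ h → z ∈ U) : rectIntegral a b h g = 0 := by
  have := Complex.integral_boundary_rect_eq_zero_of_differentiableOn g
    (⟨a, -h⟩ : ℂ) (⟨b, h⟩ : ℂ) (hg.mono fun z hz => by
      rw [Complex.mem_reProdIm, Set.uIcc_of_le hab, Set.uIcc_of_le (by linarith : -h ≤ h)] at hz
      exact hU z hz.1.1 hz.1.2 (abs_le.2 hz.2))
  simpa [rectIntegral] using this

/-- The sides are integrated by logarithms. Only the left side crosses the cut; there `log (-(z -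
x))` is used, and the change of branch at the two left corners contributes `π i` each. -/
theorem rectIntegral_inv_sub {a b h x : ℝ} (ha : a < x) (hb : x < b) (hh : 0 < h) :
    rectIntegral a b h (fun z => (z - x)⁻¹) = 2 * Real.pi * Complex.I := by
  have seg : ∀ {c : ℂ}, c.im ≠ 0 →
      (∫ u in a..b, ((u : ℂ) + c - x)⁻¹) = Complex.log (b + c - x) - Complex.log (a + c - x) := by
    intro c hc
    have hs : ∀ u : ℝ, (u + c - x : ℂ) ∈ Complex.slitPlane := fun u => Or.inr (by simpa using hc)
    refine intervalIntegral.integral_eq_sub_of_hasDerivAt (f := fun u : ℝ => Complex.log (u + c - x))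
      (fun u _ => ?_) (Continuous.intervalIntegrable ?_ _ _)
    · have h1 : HasDerivAt (fun u : ℝ => (u + c - x : ℂ)) 1 u :=
        ((Complex.ofRealCLM.hasDerivAt.add_const c).sub_const (x : ℂ))
      simpa using h1.clog_real (hs u)
    · exact Continuous.inv₀ (by fun_prop) fun u => Complex.slitPlane_ne_zero (hs u)
  have vert : ∀ {c : ℝ} (σ : ℂ), σ ≠ 0 → (∀ y : ℝ, σ * (c + y * Complex.I - x) ∈ Complex.slitPlane) →
      Complex.I * (∫ y in (-h)..h, (c + y * Complex.I - x : ℂ)⁻¹) =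
        Complex.log (σ * (c + h * Complex.I - x)) -
          Complex.log (σ * (c + (-h : ℝ) * Complex.I - x)) := by
    intro c σ hσ hs
    have hne : ∀ y : ℝ, (c + y * Complex.I - x : ℂ) ≠ 0 := fun y h0 =>
      Complex.slitPlane_ne_zero (hs y) (by rw [h0, mul_zero])
    rw [← intervalIntegral.integral_const_mul]
    refine intervalIntegral.integral_eq_sub_of_hasDerivAt
      (f := fun y : ℝ => Complex.log (σ * (c + y * Complex.I - x)))
      (fun u _ => ?_) (Continuous.intervalIntegrable ?_ _ _)
    · have h1 : HasDerivAt (fun y : ℝ => σ * (c + y * Complex.I - x : ℂ)) (σ * (1 * Complex.I)) u :=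
        ((((Complex.ofRealCLM.hasDerivAt (x := u)).mul_const Complex.I).const_add
          (c : ℂ)).sub_const (x : ℂ)).const_mul σ
      have h2 := h1.clog_real (hs u)
      rw [mul_div_mul_left _ _ hσ, one_mul, div_eq_mul_inv] at h2
      exact h2
    · exact continuous_const.mul (Continuous.inv₀ (by fun_prop) hne)
  unfold rectIntegral
  rw [seg (c := (-h : ℝ) * Complex.I) (by simpa using hh.ne'),
    seg (c := h * Complex.I) (by simpa using hh.ne'),
    vert (c := b) 1 one_ne_zero (fun y => Or.inl (by simpa using hb)),
    vert (c := a) (-1) (by norm_num) (fun y => Or.inl (by simpa using ha))]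
  have l1 : Complex.log (a + h * Complex.I - x) =
      Complex.log (-1 * (a + h * Complex.I - x)) + Real.pi * Complex.I := by
    have e : (a + h * Complex.I - x : ℂ) = -(-1 * (a + h * Complex.I - x)) := by ring
    have im : (-1 * (a + h * Complex.I - x) : ℂ).im < 0 := by simpa using hh
    conv_lhs => rw [e]
    rw [Complex.log, Complex.log, norm_neg, Complex.arg_neg_eq_arg_add_pi_of_im_neg im]
    push_cast
    ring
  have l2 : Complex.log (a + (-h : ℝ) * Complex.I - x) =
      Complex.log (-1 * (a + (-h : ℝ) * Complex.I - x)) - Real.pi * Complex.I := by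
    have e : (a + (-h : ℝ) * Complex.I - x : ℂ) = -(-1 * (a + (-h : ℝ) * Complex.I - x)) := by ring
    have im : 0 < (-1 * (a + (-h : ℝ) * Complex.I - x) : ℂ).im := by simpa using hh
    conv_lhs => rw [e]
    rw [Complex.log, Complex.log, norm_neg, Complex.arg_neg_eq_arg_sub_pi_of_im_pos im]
    push_cast
    ring
  rw [l1, l2]
  simp only [one_mul]
  ring

/-- Cauchy's formula for rectangles. -/
theorem rectIntegral_mul_inv_sub {a b h x : ℝ} (hh : 0 < h) (hab : a < b) {φ : ℂ → ℂ} {U : Set ℂ}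
    (hUo : IsOpen U) (hφ : DifferentiableOn ℂ φ U)
    (hU : ∀ z : ℂ, a ≤ z.re → z.re ≤ b → |z.im| ≤ h → z ∈ U) (hxa : x ≠ a) (hxb : x ≠ b) :
    rectIntegral a b h (fun z => φ z * (z - x)⁻¹) =
      if a < x ∧ x < b then 2 * Real.pi * Complex.I * φ x else 0 := by
  split_ifs with hx
  · have hxU : (x : ℂ) ∈ U := hU x (by simpa using hx.1.le) (by simpa using hx.2.le)
      (by simpa using hh.le)
    -- The divided difference of `φ` at `x` is holomorphic, so its integral vanishes; what remains
    -- is `φ x` times the integral of `(z - x)⁻¹`.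
    have h0 := rectIntegral_eq_zero hab.le hh.le
      ((Complex.differentiableOn_dslope (hUo.mem_nhds hxU)).2 hφ) hU
    set s : Set ℂ := U \ {(x : ℂ)} with hs
    have m1 : ∀ {c : ℝ}, |c| = h → ∀ u ∈ Set.Icc a b, (u + c * Complex.I : ℂ) ∈ s := by
      intro c hc u hu
      refine ⟨hU _ (by simpa using hu.1) (by simpa using hu.2) (by simpa using hc.le), ?_⟩
      intro h'
      have := congrArg Complex.im (Set.mem_singleton_iff.1 h')
      simp at this
      rw [this] at hc
      simp at hc
      exact hh.ne hc
    have m2 : ∀ {c : ℝ}, a ≤ c → c ≤ b → c ≠ x → ∀ y ∈ Set.Icc (-h) h,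
        (c + y * Complex.I : ℂ) ∈ s := by
      intro c hc1 hc2 hc3 y hy
      refine ⟨hU _ (by simpa using hc1) (by simpa using hc2) (by simpa using abs_le.2 hy), ?_⟩
      intro h'
      have := congrArg Complex.re (Set.mem_singleton_iff.1 h')
      simp at this
      exact hc3 this
    have ci : ContinuousOn (fun z : ℂ => (z - x)⁻¹) s :=
      ContinuousOn.inv₀ (by fun_prop) fun z hz => sub_ne_zero.2 hz.2
    have n1 := m1 (c := -h) (by rw [abs_neg, abs_of_pos hh])
    have n2 := m1 (c := h) (abs_of_pos hh)
    have n3 := m2 (c := b) hab.le le_rfl hxb.symm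
    have n4 := m2 (c := a) le_rfl hab.le hxa.symm
    have hsub := rectIntegral_sub hab.le hh.le (s := s) (g := fun z => φ z * (z - x)⁻¹)
      (g' := fun z => φ x * (z - x)⁻¹) ((hφ.continuousOn.mono Set.sdiff_subset).mul ci)
      (continuousOn_const.mul ci) n1 n2 n3 n4
    have hds : ∀ z ∈ s, dslope φ x z = φ z * (z - x)⁻¹ - φ x * (z - x)⁻¹ := fun z hz => by
      rw [dslope_of_ne _ hz.2, slope_def_field]
      ring
    have heq : rectIntegral a b h (dslope φ x) =
        rectIntegral a b h (fun z => φ z * (z - x)⁻¹ - φ x * (z - x)⁻¹) := by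
      have hhh : -h ≤ h := by linarith
      unfold rectIntegral
      congr 1
      · congr 1
        · congr 1
          · refine intervalIntegral.integral_congr fun u hu => hds _ (n1 u ?_)
            rwa [Set.uIcc_of_le hab.le] at hu
          · refine intervalIntegral.integral_congr fun u hu => hds _ (n2 u ?_)
            rwa [Set.uIcc_of_le hab.le] at hu
        · congr 1
          refine intervalIntegral.integral_congr fun u hu => hds _ (n3 u ?_)
          rwa [Set.uIcc_of_le hhh] at hu
      · congr 1
        refine intervalIntegral.integral_congr fun u hu => hds _ (n4 u ?_)
        rwa [Set.uIcc_of_le hhh] at hu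
    rw [heq, hsub, rectIntegral_const_mul, rectIntegral_inv_sub hx.1 hx.2 hh, sub_eq_zero] at h0
    rw [h0]
    ring
  · refine rectIntegral_eq_zero (U := U \ {(x : ℂ)}) hab.le hh.le ?_ ?_
    · exact (hφ.mono Set.sdiff_subset).mul (DifferentiableOn.inv (by fun_prop)
        fun z hz => sub_ne_zero.2 hz.2)
    · intro z h1 h2 h3
      refine ⟨hU z h1 h2 h3, fun h' => hx ?_⟩
      rw [Set.mem_singleton_iff] at h'
      rw [h'] at h1 h2
      simp only [Complex.ofReal_re] at h1 h2
      exact ⟨lt_of_le_of_ne h1 hxa.symm, lt_of_le_of_ne h2 hxb⟩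

/-- A holomorphic function on a rectangle is represented by resolvents on its boundary. -/
theorem hasResolventRep_rect {a b h : ℝ} (hd0 : 0 < d) (hab : a < b) (hdh : d ≤ h) {φ : ℂ → ℂ}
    {U : Set ℂ} (hUo : IsOpen U) (hφ : DifferentiableOn ℂ φ U)
    (hU : ∀ z : ℂ, a ≤ z.re → z.re ≤ b → |z.im| ≤ h → z ∈ U)
    (hKa : ∀ x ∈ K, d ≤ |x - a|) (hKb : ∀ x ∈ K, d ≤ |x - b|) :
    HasResolventRep K d fun x => if a < x ∧ x < b then φ x else 0 := by
  have hh : 0 < h := hd0.trans_le hdh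
  set c : ℂ := (2 * Real.pi * Complex.I)⁻¹ with hc
  have side1 : ∀ {e : ℝ}, |e| = h → HasResolventRep K d fun x =>
      ∫ u in a..b, (c * (if 0 < e then -1 else 1) * φ (u + e * Complex.I)) *
        ((u + e * Complex.I : ℂ) - x)⁻¹ := by
    intro e he
    refine hasResolventRep_segment hab.le (by fun_prop) ?_ hd0 ?_
    · refine continuousOn_const.mul (hφ.continuousOn.comp (by fun_prop) fun u hu => ?_)
      exact hU _ (by simpa using hu.1) (by simpa using hu.2) (by simpa using he.le)
    · intro u hu x hx
      refine hdh.trans ?_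
      rw [← he]
      simpa using Complex.abs_im_le_norm ((u + e * Complex.I : ℂ) - x)
  have side2 : ∀ {e : ℝ} (σ : ℂ), a ≤ e → e ≤ b → (∀ x ∈ K, d ≤ |x - e|) →
      HasResolventRep K d fun x => ∫ y in (-h)..h, (c * σ * φ (e + y * Complex.I)) *
        ((e + y * Complex.I : ℂ) - x)⁻¹ := by
    intro e σ he1 he2 hK
    refine hasResolventRep_segment (by linarith) (by fun_prop) ?_ hd0 ?_
    · refine continuousOn_const.mul (hφ.continuousOn.comp (by fun_prop) fun u hu => ?_)
      exact hU _ (by simpa using he1) (by simpa using he2) (by simpa using abs_le.2 hu)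
    · intro u hu x hx
      refine (hK x hx).trans ?_
      rw [abs_sub_comm]
      simpa using Complex.abs_re_le_norm ((e + u * Complex.I : ℂ) - x)
  have total := (((side1 (e := -h) (by rw [abs_neg, abs_of_pos hh])).add
    (side1 (e := h) (abs_of_pos hh))).add (side2 Complex.I hab.le le_rfl hKb)).add
    (side2 (-Complex.I) le_rfl hab.le hKa)
  refine total.congr hd0 fun x y hy hxy => ?_
  -- The vertical sides are at distance at least `d` from `K`, so points closer than `d` to `K`
  -- cannot lie on them and Cauchy's formula applies.
  have hxa : x ≠ a := fun h' => by
    have := hKa y hy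
    rw [h', abs_sub_comm] at hxy
    linarith
  have hxb : x ≠ b := fun h' => by
    have := hKb y hy
    rw [h', abs_sub_comm] at hxy
    linarith
  have h1 := rectIntegral_mul_inv_sub hh hab hUo hφ hU hxa hxb
  have h2 : c * rectIntegral a b h (fun z => φ z * (z - x)⁻¹) =
      if a < x ∧ x < b then φ x else 0 := by
    rw [h1]
    split_ifs
    · rw [hc, ← mul_assoc, inv_mul_cancel₀ (by simp [Real.pi_ne_zero]), one_mul]
    · exact mul_zero _
  rw [← h2]
  simp only [rectIntegral, not_lt.2 (neg_nonpos.2 hh.le), if_false, if_pos hh, mul_assoc,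
    intervalIntegral.integral_const_mul, mul_sub, mul_add]
  ring

end ResolventRep

/-! ### Fermi-Dirac functions as superpositions of resolvents -/

section Fermi

open Filter Topology

theorem ENNReal.min_one_add_le (x y : ℝ≥0∞) : min 1 (x + y) ≤ min 1 x + min 1 y := by
  rcases le_total 1 x with hx | hx
  · rw [min_eq_left hx]; exact (min_le_left _ _).trans le_self_add
  rcases le_total 1 y with hy | hy
  · rw [min_eq_left hy]; exact (min_le_left _ _).trans le_add_self
  rw [min_eq_right hx, min_eq_right hy]; exact min_le_right _ _

theorem ENNReal.min_one_ne_top (x : ℝ≥0∞) : min 1 x ≠ ⊤ :=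
  ne_top_of_le_ne_top one_ne_top (min_le_left _ _)

theorem ENNReal.toReal_min_one_le (x : ℝ≥0∞) : (min 1 x).toReal ≤ 1 := by
  simpa using ENNReal.toReal_mono one_ne_top (min_le_left 1 x)

theorem ENNReal.toReal_min_one_pos {x : ℝ≥0∞} (hx : 0 < x) : 0 < (min 1 x).toReal :=
  ENNReal.toReal_pos (lt_min one_pos hx).ne' (ENNReal.min_one_ne_top x)

/-- The scale of the exponential decay: `β⁻¹ + min {gm, gp}` at finite temperature and `gm + gp` at
zero temperature, cut off at `1`. -/
noncomputable def decayScale (β gm gp : ℝ≥0∞) : ℝ :=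
  if β = ⊤ then (min 1 (gm + gp)).toReal else (min 1 (β⁻¹ + min gm gp)).toReal

theorem decayScale_pos {β gm gp : ℝ≥0∞} (h : FiniteTempOrGap β gm gp) :
    0 < decayScale β gm gp := by
  unfold decayScale
  split_ifs with hβ
  · refine ENNReal.toReal_min_one_pos ?_
    rcases h.2 with h2 | h2
    · exact absurd hβ h2.ne
    · exact h2.1.trans_le le_self_add
  · exact ENNReal.toReal_min_one_pos ((ENNReal.inv_pos.2 hβ).trans_le le_self_add)

theorem decayScale_le_one (β gm gp : ℝ≥0∞) : decayScale β gm gp ≤ 1 := by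
  unfold decayScale
  split_ifs <;> exact ENNReal.toReal_min_one_le _

/-- Below the threshold `δ = 1` the cut-off in `decayScale` is inactive, and both comparisons are
equalities. -/
theorem isDecayRate_const_mul {c : ℝ} (hc : 0 < c) :
    IsDecayRate fun β gm gp => c * decayScale β gm gp := by
  refine ⟨fun β gm gp h => mul_pos hc (decayScale_pos h), c, c, 1, hc, hc, one_pos, ?_⟩
  intro β gm gp h hδ
  rw [ENNReal.ofReal_one] at hδ
  refine ⟨fun hβ => ?_, fun hβ => ?_⟩
  · have h1 : β⁻¹ + min gm gp ≤ 1 :=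
      (add_le_add le_rfl ((min_le_left _ _).trans le_self_add)).trans hδ.le
    have h2 : decayScale β gm gp = (β⁻¹ + min gm gp).toReal := by
      unfold decayScale
      rw [if_neg hβ.ne, min_eq_right h1]
    exact ⟨(congrArg (c * ·) h2).ge, (congrArg (c * ·) h2).le⟩
  · have h1 : gm + gp ≤ 1 := le_add_self.trans hδ.le
    have h2 : decayScale β gm gp = (gm + gp).toReal := by
      unfold decayScale
      rw [if_pos hβ, min_eq_right h1]
    exact ⟨(congrArg (c * ·) h2).ge, (congrArg (c * ·) h2).le⟩

theorem decayScale_top_le (gm gp : ℝ≥0∞) :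
    decayScale ⊤ gm gp ≤ (min 1 gm).toReal + (min 1 gp).toReal := by
  rw [decayScale, if_pos rfl, ← ENNReal.toReal_add (ENNReal.min_one_ne_top _)
    (ENNReal.min_one_ne_top _)]
  exact ENNReal.toReal_mono (ENNReal.add_ne_top.2
    ⟨ENNReal.min_one_ne_top _, ENNReal.min_one_ne_top _⟩) (ENNReal.min_one_add_le _ _)

theorem decayScale_le_of_ne_top {β : ℝ≥0∞} (hβ0 : 0 < β) (hβ : β ≠ ⊤) (gm gp : ℝ≥0∞) :
    decayScale β gm gp ≤
      min 1 (β.toReal)⁻¹ + min (min 1 gm).toReal (min 1 gp).toReal := by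
  have e1 : (min 1 β⁻¹).toReal = min 1 (β.toReal)⁻¹ := by
    rw [ENNReal.toReal_min ENNReal.one_ne_top (ENNReal.inv_ne_top.2 hβ0.ne'), ENNReal.toReal_one,
      ENNReal.toReal_inv]
  have e2 : (min 1 (min gm gp)).toReal = min (min 1 gm).toReal (min 1 gp).toReal := by
    rw [← ENNReal.toReal_min (ENNReal.min_one_ne_top _) (ENNReal.min_one_ne_top _)]
    congr 1
    rw [min_min_min_comm, min_self]
  rw [decayScale, if_neg hβ, ← e1, ← e2, ← ENNReal.toReal_add (ENNReal.min_one_ne_top _)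
    (ENNReal.min_one_ne_top _)]
  exact ENNReal.toReal_mono (ENNReal.add_ne_top.2
    ⟨ENNReal.min_one_ne_top _, ENNReal.min_one_ne_top _⟩) (ENNReal.min_one_add_le _ _)

/-- Bounded real numbers outside a gap around `μ`. -/
def gapSet (L μ a b : ℝ) : Set ℝ := {x | |x| ≤ L ∧ (x ≤ μ - a ∨ μ + b ≤ x)}

/-- Zeros of `1 + exp w` are poles of the Fermi function. Staying in the slit plane avoids them as
well as the branch cut of the logarithm; in the left half plane this holds because `|exp w| < 1`. -/
theorem one_add_exp_mem_slitPlane_of_re_neg {w : ℂ} (hw : w.re < 0) :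
    1 + Complex.exp w ∈ Complex.slitPlane := by
  refine Or.inl ?_
  have h1 : ‖Complex.exp w‖ < 1 := by rw [Complex.norm_exp]; simpa using Real.exp_lt_exp.2 hw
  have h2 := (abs_le.1 (Complex.abs_re_le_norm (Complex.exp w))).1
  rw [Complex.add_re, Complex.one_re]
  linarith

/-- Here `|Im w| ≤ 1 < π / 2`, so `exp w` has positive real part. -/
theorem one_add_exp_mem_slitPlane_of_im {w : ℂ} (hw : |w.im| ≤ 1) :
    1 + Complex.exp w ∈ Complex.slitPlane := by
  refine Or.inl ?_
  have h2 := abs_le.1 hw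
  have hpi := Real.pi_gt_three
  have h1 : 0 < Real.cos w.im := Real.cos_pos_of_mem_Ioo ⟨by linarith [h2.1], by linarith [h2.2]⟩
  rw [Complex.add_re, Complex.one_re, Complex.exp_re]
  have := mul_pos (Real.exp_pos w.re) h1
  linarith

theorem isOpen_one_add_exp_mem_slitPlane {w : ℂ → ℂ} (hw : Continuous w) :
    IsOpen {z | 1 + Complex.exp (w z) ∈ Complex.slitPlane} :=
  Complex.isOpen_slitPlane.preimage (by fun_prop)

variable {μ L a b B : ℝ}

/-- The contour adapts to whichever of temperature and smaller gap is larger; twice the larger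
bounds the sum. If the temperature wins, one rectangle in a strip of half-width at most `B⁻¹` stays
clear of the poles above and below `μ`. If the gap wins, two rectangles stop at distance `min a b /
2` on either side of `μ`, each with its own holomorphic expression `φ₀` or `φ₁` of the same
function. -/
theorem hasResolventRep_of_finite_temperature (hB : 0 < B) (ha : 0 ≤ a)
    (ha1 : a ≤ 1) (hb : 0 ≤ b) {f : ℝ → ℂ} {φ₀ φ₁ : ℂ → ℂ}
    (h₀ : DifferentiableOn ℂ φ₀ {z | 1 + Complex.exp (B * (z - μ)) ∈ Complex.slitPlane})
    (h₁ : DifferentiableOn ℂ φ₁ {z | 1 + Complex.exp (-(B * (z - μ))) ∈ Complex.slitPlane})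
    (hf₀ : ∀ x : ℝ, f x = φ₀ x) (hf₁ : ∀ x : ℝ, f x = φ₁ x) :
    HasResolventRep (gapSet L μ a b) ((min 1 B⁻¹ + min a b) / 4) f := by
  have o₀ := isOpen_one_add_exp_mem_slitPlane (w := fun z => B * (z - μ)) (by fun_prop)
  have o₁ := isOpen_one_add_exp_mem_slitPlane (w := fun z => -(B * (z - μ))) (by fun_prop)
  have hT : 0 < B⁻¹ := inv_pos.2 hB
  have hm1 : 0 < min 1 B⁻¹ := lt_min one_pos hT
  have hm2 : 0 ≤ min a b := le_min ha hb
  have hpos : 0 < (min 1 B⁻¹ + min a b) / 4 := by linarith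
  set R := |L| + |μ| + 3 with hR
  have hRx : ∀ x ∈ gapSet L μ a b, x ≤ |L| ∧ -|L| ≤ x := fun x hx =>
    ⟨(le_abs_self x).trans (hx.1.trans (le_abs_self L)), by
      have := neg_abs_le x; linarith [hx.1, le_abs_self L]⟩
  have hμ1 := le_abs_self μ
  have hμ2 := neg_abs_le μ
  have hL0 := abs_nonneg L
  have hμ0 := abs_nonneg μ
  rcases le_or_gt (min a b) (min 1 B⁻¹) with hcase | hcase
  · -- a rectangle in the strip around the real axis
    have rep := hasResolventRep_rect (K := gapSet L μ a b) (d := min 1 B⁻¹) (a := -R) (b := R)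
      (h := min 1 B⁻¹) hm1 (by linarith) le_rfl o₀ h₀ (fun z _ _ hz => by
        refine one_add_exp_mem_slitPlane_of_im ?_
        have : (B * (z - μ) : ℂ).im = B * z.im := by simp
        rw [this, abs_mul, abs_of_pos hB]
        calc B * |z.im| ≤ B * B⁻¹ := by
              gcongr
              exact hz.trans (min_le_right _ _)
          _ = 1 := mul_inv_cancel₀ hB.ne')
      (fun x hx => (min_le_left _ _).trans (by
        have := hRx x hx; rw [le_abs]; left; linarith))
      (fun x hx => (min_le_left _ _).trans (by
        have := hRx x hx; rw [le_abs]; right; linarith))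
    refine (rep.congr one_pos fun x y hy hxy => ?_).mono hpos (by linarith)
    have := hRx y hy
    have h2 := abs_lt.1 hxy
    rw [if_pos ⟨by linarith, by linarith⟩, hf₀]
  · -- two rectangles on both sides of the gap
    have hg : 0 < min a b := hm1.trans hcase
    have hga : min a b ≤ a := min_le_left _ _
    have hgb : min a b ≤ b := min_le_right _ _
    have hg1 : min a b ≤ 1 := hga.trans ha1
    set g := min a b with hgdef
    have rep₀ := hasResolventRep_rect (K := gapSet L μ a b) (d := g / 2) (a := -R) (b := μ - g / 2)
      (h := 1) (by linarith) (by linarith) (by linarith) o₀ h₀ (fun z _ hz _ => by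
        refine one_add_exp_mem_slitPlane_of_re_neg ?_
        have : (B * (z - μ) : ℂ).re = B * (z.re - μ) := by simp
        rw [this]
        exact mul_neg_of_pos_of_neg hB (by linarith))
      (fun x hx => by have := hRx x hx; rw [le_abs]; left; linarith)
      (fun x hx => by
        rw [le_abs]
        rcases hx.2 with h | h
        · right; linarith
        · left; linarith)
    have rep₁ := hasResolventRep_rect (K := gapSet L μ a b) (d := g / 2) (a := μ + g / 2) (b := R)
      (h := 1) (by linarith) (by linarith) (by linarith) o₁ h₁ (fun z hz _ _ => by
        refine one_add_exp_mem_slitPlane_of_re_neg ?_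
        have : (-(B * (z - μ)) : ℂ).re = -(B * (z.re - μ)) := by simp
        rw [this, neg_lt_zero]
        exact mul_pos hB (by linarith))
      (fun x hx => by
        rw [le_abs]
        rcases hx.2 with h | h
        · right; linarith
        · left; linarith)
      (fun x hx => by have := hRx x hx; rw [le_abs]; right; linarith)
    refine ((rep₀.add rep₁).congr (δ := g / 2) (by linarith) fun x y hy hxy => ?_).mono hpos
      (by linarith)
    have h1 := hRx y hy
    have h2 := abs_lt.1 hxy
    rcases hy.2 with h | h
    · rw [if_pos ⟨by linarith, by linarith⟩, if_neg (fun h' => by linarith [h'.1]), add_zero, hf₀]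
    · rw [if_neg (fun h' => by linarith [h'.2]), if_pos ⟨by linarith, by linarith⟩, zero_add, hf₁]

/-- Being locally constant away from `μ`, the function needs only a rectangle around the lower
spectrum. Its right side is placed at the midpoint `μ + (b - a) / 2` of the gap, at distance `(a +
b) / 2` from both parts, so the total gap sets the rate. -/
theorem hasResolventRep_of_zero_temperature (ha : 0 < a) (ha1 : a ≤ 1) (hb : 0 < b) (hb1 : b ≤ 1)
    {f : ℝ → ℂ} (hf₀ : ∀ x, x < μ → f x = 1) (hf₁ : ∀ x, μ < x → f x = 0) :
    HasResolventRep (gapSet L μ a b) ((a + b) / 4) f := by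
  set R := |L| + |μ| + 3 with hR
  have hRx : ∀ x ∈ gapSet L μ a b, x ≤ |L| ∧ -|L| ≤ x := fun x hx =>
    ⟨(le_abs_self x).trans (hx.1.trans (le_abs_self L)), by
      have := neg_abs_le x; linarith [hx.1, le_abs_self L]⟩
  have hμ1 := le_abs_self μ
  have hμ2 := neg_abs_le μ
  have hL0 := abs_nonneg L
  have hμ0 := abs_nonneg μ
  have rep := hasResolventRep_rect (K := gapSet L μ a b) (d := (a + b) / 2) (a := -R)
    (b := μ + (b - a) / 2) (h := 1) (φ := fun _ => 1) (by linarith) (by linarith) (by linarith)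
    isOpen_univ (differentiableOn_const _) (fun _ _ _ _ => Set.mem_univ _)
    (fun x hx => by have := hRx x hx; rw [le_abs]; left; linarith)
    (fun x hx => by
      rw [le_abs]
      rcases hx.2 with h | h
      · right; linarith
      · left; linarith)
  refine (rep.congr (δ := min a b / 2) (by positivity) fun x y hy hxy => ?_).mono (by linarith)
    (by linarith)
  have h1 := hRx y hy
  have h2 := abs_lt.1 hxy
  have h3 : min a b ≤ a := min_le_left _ _
  have h4 : min a b ≤ b := min_le_right _ _
  rcases hy.2 with h | h
  · rw [if_pos ⟨by linarith, by linarith⟩, hf₀ x (by linarith)]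
  · rw [if_neg (fun h' => by linarith [h'.2]), hf₁ x (by linarith)]

theorem fermiDirac_of_ne_top {β : ℝ≥0∞} (hβ : β ≠ ⊤) (μ x : ℝ) :
    fermiDirac β μ x = (1 + Real.exp (β.toReal * (x - μ)))⁻¹ := if_neg hβ

theorem fermiDirac_nonneg (β : ℝ≥0∞) (μ x : ℝ) : 0 ≤ fermiDirac β μ x := by
  unfold fermiDirac
  split_ifs <;> positivity

/-- The set of energies allowed by the gaps `gm` and `gp`. -/
abbrev allowedSet (L μ : ℝ) (gm gp : ℝ≥0∞) : Set ℝ :=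
  gapSet L μ (min 1 gm).toReal (min 1 gp).toReal

variable {β gm gp : ℝ≥0∞}

theorem hasResolventRep_of_fermi (h : FiniteTempOrGap β gm gp) {f : ℝ → ℝ}
    (htop : β = ⊤ → (∀ x, x < μ → f x = 1) ∧ ∀ x, μ < x → f x = 0)
    {φ₀ φ₁ : ℂ → ℂ}
    (h₀ : DifferentiableOn ℂ φ₀ {z | 1 + Complex.exp (β.toReal * (z - μ)) ∈ Complex.slitPlane})
    (h₁ : DifferentiableOn ℂ φ₁ {z | 1 + Complex.exp (-(β.toReal * (z - μ))) ∈ Complex.slitPlane})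
    (hf₀ : β ≠ ⊤ → ∀ x : ℝ, f x = φ₀ x) (hf₁ : β ≠ ⊤ → ∀ x : ℝ, f x = φ₁ x) :
    HasResolventRep (allowedSet L μ gm gp) (decayScale β gm gp / 4) fun x => f x := by
  have hs : 0 < decayScale β gm gp / 4 := by have := decayScale_pos h; linarith
  by_cases hβ : β = ⊤
  · have hg : 0 < gm ∧ 0 < gp := h.2.resolve_left (by rw [hβ]; exact lt_irrefl _)
    refine (hasResolventRep_of_zero_temperature (ENNReal.toReal_min_one_pos hg.1)
      (ENNReal.toReal_min_one_le _) (ENNReal.toReal_min_one_pos hg.2)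
      (ENNReal.toReal_min_one_le _) (f := fun x => f x)
      (fun x hx => by rw [(htop hβ).1 x hx]; simp)
      (fun x hx => by rw [(htop hβ).2 x hx]; simp)).mono hs ?_
    have := decayScale_top_le gm gp
    rw [hβ]
    linarith
  · refine (hasResolventRep_of_finite_temperature (ENNReal.toReal_pos h.1.ne' hβ)
      ENNReal.toReal_nonneg (ENNReal.toReal_min_one_le _) ENNReal.toReal_nonneg h₀ h₁
      (hf₀ hβ) (hf₁ hβ)).mono hs ?_
    have := decayScale_le_of_ne_top h.1 hβ gm gp
    linarith

theorem Complex.one_add_exp_ne_zero {w : ℂ} (h : 1 + Complex.exp w ∈ Complex.slitPlane) :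
    1 + Complex.exp w ≠ 0 := Complex.slitPlane_ne_zero h

theorem Complex.log_one_add_exp_ofReal (x : ℝ) :
    Complex.log (1 + Complex.exp x) = (Real.log (1 + Real.exp x) : ℝ) := by
  rw [Complex.ofReal_log (by positivity)]
  push_cast
  rfl

theorem Real.log_one_add_exp (x : ℝ) :
    Real.log (1 + Real.exp x) = x + Real.log (1 + Real.exp (-x)) := by
  have h : 1 + Real.exp x = Real.exp x * (1 + Real.exp (-x)) := by
    rw [mul_add, ← Real.exp_add]; simp [add_comm]
  rw [h, Real.log_mul (Real.exp_pos x).ne' (by positivity), Real.log_exp]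

theorem Real.inv_one_add_exp (x : ℝ) :
    (1 + Real.exp x)⁻¹ = 1 - (1 + Real.exp (-x))⁻¹ := by
  have h1 : (1 + Real.exp x) ≠ 0 := by positivity
  have h2 : (1 + Real.exp (-x)) ≠ 0 := by positivity
  have h3 : Real.exp x * Real.exp (-x) = 1 := by rw [← Real.exp_add]; simp
  field_simp
  linear_combination -h3

theorem hasResolventRep_fermiDirac (h : FiniteTempOrGap β gm gp) :
    HasResolventRep (allowedSet L μ gm gp) (decayScale β gm gp / 4)
      fun x => (fermiDirac β μ x : ℝ) := by
  refine hasResolventRep_of_fermi h (f := fermiDirac β μ)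
    (φ₀ := fun z => (1 + Complex.exp (β.toReal * (z - μ)))⁻¹)
    (φ₁ := fun z => 1 - (1 + Complex.exp (-(β.toReal * (z - μ))))⁻¹) (fun hβ => ⟨fun x hx => ?_,
    fun x hx => ?_⟩) ?_ ?_ (fun hβ x => ?_) (fun hβ x => ?_)
  · simp [fermiDirac, hβ, hx]
  · simp [fermiDirac, hβ, hx.not_gt, hx.ne']
  · exact DifferentiableOn.inv (by fun_prop) fun z hz => Complex.one_add_exp_ne_zero hz
  · exact (differentiableOn_const _).sub
      (DifferentiableOn.inv (by fun_prop) fun z hz => Complex.one_add_exp_ne_zero hz)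
  · rw [fermiDirac_of_ne_top hβ]; push_cast; rfl
  · rw [fermiDirac_of_ne_top hβ, Real.inv_one_add_exp]; push_cast; rfl

/-- As `√F = exp (-(1/2) log (1 + exp w))`, the square root is holomorphic wherever the logarithm
is. It is needed for the amplitudes. -/
theorem hasResolventRep_sqrt_fermiDirac (h : FiniteTempOrGap β gm gp) :
    HasResolventRep (allowedSet L μ gm gp) (decayScale β gm gp / 4)
      fun x => (Real.sqrt (fermiDirac β μ x) : ℝ) := by
  have hlog : ∀ {w : ℂ → ℂ}, Differentiable ℂ w → DifferentiableOn ℂ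
      (fun z => Complex.log (1 + Complex.exp (w z)))
      {z | 1 + Complex.exp (w z) ∈ Complex.slitPlane} := fun hw =>
    DifferentiableOn.clog (by fun_prop) fun z hz => hz
  have hsq : ∀ x : ℝ, Real.sqrt (1 + Real.exp x)⁻¹ =
      Real.exp (-(1 / 2) * Real.log (1 + Real.exp x)) := fun x => by
    rw [Real.sqrt_eq_rpow, Real.rpow_def_of_pos (by positivity), Real.log_inv]
    ring_nf
  refine hasResolventRep_of_fermi h (f := fun x => Real.sqrt (fermiDirac β μ x))
    (φ₀ := fun z => Complex.exp (-(1 / 2) * Complex.log (1 + Complex.exp (β.toReal * (z - μ)))))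
    (φ₁ := fun z => Complex.exp (-(1 / 2) * (β.toReal * (z - μ) +
      Complex.log (1 + Complex.exp (-(β.toReal * (z - μ)))))))
    (fun hβ => ⟨fun x hx => ?_, fun x hx => ?_⟩) ?_ ?_ (fun hβ x => ?_) (fun hβ x => ?_)
  · simp [fermiDirac, hβ, hx]
  · simp [fermiDirac, hβ, hx.not_gt, hx.ne']
  · exact ((differentiableOn_const _).mul (hlog (by fun_prop))).cexp
  · exact ((differentiableOn_const _).mul (DifferentiableOn.add (by fun_prop)
      (hlog (w := fun z => -(β.toReal * (z - μ))) (by fun_prop)))).cexp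
  · rw [fermiDirac_of_ne_top hβ, hsq]
    have := Complex.log_one_add_exp_ofReal (β.toReal * (x - μ))
    push_cast at this ⊢
    rw [this]
  · rw [fermiDirac_of_ne_top hβ, hsq, Real.log_one_add_exp]
    have := Complex.log_one_add_exp_ofReal (-(β.toReal * (x - μ)))
    push_cast at this ⊢
    rw [this]

/-- This form has no logarithm of `F` or `1 - F`: the apparent singularities of the entropy at
occupations `0` and `1` disappear, leaving those of `log (1 + exp w)`. -/
theorem fermiEntropy_inv_one_add_exp (x : ℝ) : fermiEntropy (1 + Real.exp x)⁻¹ =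
    (1 - (1 + Real.exp x)⁻¹) * x - Real.log (1 + Real.exp x) := by
  have h1 : 1 - (1 + Real.exp x)⁻¹ = (1 + Real.exp (-x))⁻¹ := by
    rw [Real.inv_one_add_exp]; ring
  rw [fermiEntropy, Real.log_inv, h1, Real.log_inv]
  have h2 := Real.log_one_add_exp x
  have h3 := Real.inv_one_add_exp x
  rw [h3, h2]
  ring

theorem hasResolventRep_fermiEntropy (h : FiniteTempOrGap β gm gp) (hβ : β ≠ ⊤) :
    HasResolventRep (allowedSet L μ gm gp) (decayScale β gm gp / 4)
      fun x => (fermiEntropy (fermiDirac β μ x) : ℝ) := by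
  have hlog : ∀ {w : ℂ → ℂ}, Differentiable ℂ w → DifferentiableOn ℂ
      (fun z => Complex.log (1 + Complex.exp (w z)))
      {z | 1 + Complex.exp (w z) ∈ Complex.slitPlane} := fun hw =>
    DifferentiableOn.clog (by fun_prop) fun z hz => hz
  refine hasResolventRep_of_fermi h (f := fun x => fermiEntropy (fermiDirac β μ x))
    (φ₀ := fun z => (1 - (1 + Complex.exp (β.toReal * (z - μ)))⁻¹) * (β.toReal * (z - μ)) -
      Complex.log (1 + Complex.exp (β.toReal * (z - μ))))
    (φ₁ := fun z => (1 + Complex.exp (-(β.toReal * (z - μ))))⁻¹ * (β.toReal * (z - μ)) -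
      (β.toReal * (z - μ) + Complex.log (1 + Complex.exp (-(β.toReal * (z - μ))))))
    (fun h => absurd h hβ) ?_ ?_ (fun hβ x => ?_) (fun hβ x => ?_)
  · exact (((differentiableOn_const _).sub (DifferentiableOn.inv (by fun_prop)
      fun z hz => Complex.one_add_exp_ne_zero hz)).mul (by fun_prop)).sub
      (hlog (w := fun z => β.toReal * (z - μ)) (by fun_prop))
  · exact ((DifferentiableOn.inv (by fun_prop)
      fun z hz => Complex.one_add_exp_ne_zero hz).mul (by fun_prop)).sub
      (DifferentiableOn.add (by fun_prop)
        (hlog (w := fun z => -(β.toReal * (z - μ))) (by fun_prop)))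
  · rw [fermiDirac_of_ne_top hβ, fermiEntropy_inv_one_add_exp]
    have := Complex.log_one_add_exp_ofReal (β.toReal * (x - μ))
    push_cast at this ⊢
    rw [this]
  · rw [fermiDirac_of_ne_top hβ, fermiEntropy_inv_one_add_exp, Real.inv_one_add_exp,
      Real.log_one_add_exp]
    have := Complex.log_one_add_exp_ofReal (-(β.toReal * (x - μ)))
    push_cast at this ⊢
    rw [this]
    ring

end Fermi

/-! ### Locality of functions of the Hamiltonian -/

section MatrixFunction

open Filter Topology

variable {ι : Type*} [Fintype ι] [DecidableEq ι]

theorem ContinuousMap.algebraMap_real_apply {I : Type*} [TopologicalSpace I] (x : ℝ) (s : I) :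
    algebraMap ℝ C(I, ℂ) x s = (x : ℂ) := by
  rw [Algebra.algebraMap_eq_smul_one]
  simp

theorem Matrix.IsHermitian.exists_resolvent_values {I : Type*} [TopologicalSpace I]
    {H : Matrix ι ι ℝ} (hH : H.IsHermitian) {z : C(I, ℂ)}
    (hz : ∀ s, ∀ x ∈ spectrum ℝ H, z s ≠ x) :
    ∃ g : ι → C(I, ℂ), ∀ k, (z - algebraMap ℝ C(I, ℂ) (hH.eigenvalues k)) * g k = 1 := by
  have h0 : ∀ k s, z s - (hH.eigenvalues k : ℂ) ≠ 0 := fun k s =>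
    sub_ne_zero.2 (hz s _ (hH.eigenvalues_mem_spectrum_real k))
  refine ⟨fun k => ⟨fun s => (z s - (hH.eigenvalues k : ℂ))⁻¹,
    (z.continuous.sub continuous_const).inv₀ (h0 k)⟩, fun k => ?_⟩
  ext s
  simp only [ContinuousMap.mul_apply, ContinuousMap.sub_apply, ContinuousMap.algebraMap_real_apply,
    ContinuousMap.coe_mk, ContinuousMap.one_apply]
  exact mul_inv_cancel₀ (h0 k s)

theorem Matrix.IsHermitian.norm_shifted_inv_le {I : Type*} [TopologicalSpace I] [CompactSpace I]
    {H : Matrix ι ι ℝ} (hH : H.IsHermitian) {p : ι → R3}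
    {C a α s d : ℝ} (ha : 0 < a) (hα : 0 ≤ α) (hαa : α ≤ a / 2) (hC : 0 ≤ C)
    (hHb : ∀ i j, |H i j| ≤ C * Real.exp (-(a * dist (p i) (p j))))
    (hs : ∀ i, ∑ j, Real.exp (-(a / 4 * dist (p i) (p j))) ≤ s)
    (hαd : C * α * (4 / a) * s ≤ d / 2) (hd0 : 0 < d) {z : C(I, ℂ)}
    (hd : ∀ t, ∀ x ∈ spectrum ℝ H, d ≤ ‖z t - x‖) (hu : IsUnit (H.shifted z).det) (i j : ι) :
    ‖(H.shifted z)⁻¹ i j‖ ≤ 2 / d * Real.exp (-(α * dist (p i) (p j))) := by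
  refine (ContinuousMap.norm_le _ (by positivity)).2 fun t => ?_
  refine hH.combesThomas ha hα hαa hC hHb hs hαd hd0 (hd t)
    (u := fun k => (H.shifted z)⁻¹ k j t) ?_ i
  have h1 := Matrix.mul_nonsing_inv (H.shifted z) hu
  ext k
  have h2 := congrArg (fun f : C(I, ℂ) => f t) (congrFun (congrFun h1 k) j)
  simp only [Matrix.mul_apply, ContinuousMap.coe_sum, Finset.sum_apply,
    ContinuousMap.mul_apply] at h2
  rw [mulVec, dotProduct]
  have h3 : ∀ l, H.shifted z k l t = H.shifted (z t) k l := fun l => by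
    simp only [Matrix.shifted, Matrix.sub_apply, Matrix.smul_apply, Matrix.map_apply,
      ContinuousMap.sub_apply, ContinuousMap.algebraMap_real_apply, Matrix.one_apply]
    split_ifs <;> simp
  simp only [h3] at h2
  rw [h2, Matrix.one_apply, Pi.single_apply]
  split_ifs <;> simp

/-- The constant depends on the representation and the decay data, but not on the size of the
matrices, so it is uniform in the number of atoms. -/
theorem HasResolventRep.exists_jetBound {K : Set ℝ} {d : ℝ} {f : ℝ → ℝ}
    (h : HasResolventRep K d fun x => (f x : ℂ)) (N : ℕ) {C a α s s' : ℝ} (ha : 0 < a)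
    (hα : 0 ≤ α) (hαa : α ≤ a / 2) (hC : 0 ≤ C) (hαd : C * α * (4 / a) * s ≤ d / 2) :
    ∃ C', 0 ≤ C' ∧ ∀ {ι E : Type} [Fintype ι] [DecidableEq ι] [NormedAddCommGroup E]
      [NormedSpace ℝ E] {p : ι → R3} {H : E → Matrix ι ι ℝ} {η : ℝ} {τ : ι → ℝ},
      (∀ h, (H h).IsHermitian) → spectrum ℝ (H 0) ⊆ K →
      (∀ i, ∑ j, Real.exp (-(a / 4 * dist (p i) (p j))) ≤ s) →
      (∀ i, ∑ j, Real.exp (-(α / 4 * dist (p i) (p j))) ≤ s') →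
      0 ≤ η → N * η ≤ α / 4 → (∀ i, 0 ≤ τ i) →
      (∀ i j, τ j ≤ τ i * Real.exp (η * dist (p i) (p j))) →
      (∀ i j, JetBound N (fun h => H h i j) 0 (C * Real.exp (-(a * dist (p i) (p j)))) (τ i)) →
      ∀ i j, JetBound N (fun h => cfc f (H h) i j) 0
        (C' * Real.exp (-(α / 2 * dist (p i) (p j)))) (τ i) := by
  obtain ⟨I, _, _, z, Λ, ε, hε, hεd, hzd, hrep⟩ := h
  have hd0 : 0 < d := hε.trans hεd
  set Λ' : C(I, ℂ) →L[ℝ] ℝ := Complex.reCLM.comp Λ with hΛ'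
  refine ⟨‖Λ'‖ * (2 / d * (1 + 2 / d * C * s' ^ 2 * 2 ^ N) ^ N), by
    have : 0 ≤ s' ^ 2 := sq_nonneg _
    positivity, ?_⟩
  intro ι E _ _ _ _ p H η τ hH hK hs hs' hη hNη hτ hττ hjet i j
  have hu : ∀ {h : E}, (∀ x ∈ spectrum ℝ (H h), ∃ y ∈ K, |x - y| < ε) → ∀ s, ∀ x ∈ spectrum ℝ (H h),
      z s ≠ x := fun hx s x hxs hzx => by
    obtain ⟨y, hy, hxy⟩ := hx x hxs
    have h1 := hzd s y hy
    rw [hzx, ← Complex.ofReal_sub, Complex.norm_real, Real.norm_eq_abs] at h1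
    linarith
  have h0 : ∀ x ∈ spectrum ℝ (H 0), ∃ y ∈ K, |x - y| < ε := fun x hx =>
    ⟨x, hK hx, by simpa using hε⟩
  obtain ⟨g, hg⟩ := (hH 0).exists_resolvent_values (hu h0)
  have hdet := (hH 0).isUnit_det_shifted hg
  have hR := (hH 0).norm_shifted_inv_le ha hα hαa hC
    (fun i j => by simpa using (hjet i j).norm_le) hs hαd hd0 (fun t x hx => hzd t x (hK hx)) hdet
  have hJ := jetBound_shifted_inv (H := H) (z := z) (C := C) hC (by positivity : 0 ≤ 2 / d) hα hη
    hNη hτ hττ hs' (fun i j => (hjet i j).mono_const (by gcongr; linarith) (hτ i)) hdet hR i j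
  refine ((hJ.clm Λ').mono_const (by simp only [mul_assoc]; exact le_rfl) (hτ i)).congr ?_
  -- For small `h` the spectrum stays within `ε` of `K`: the perturbation has row sums at most `card
  -- ι` times this threshold, which is less than `ε`. So one contour represents `f (H h)` for all
  -- these `h`.
  have hev : ∀ᶠ h in 𝓝 (0 : E), ∀ i j, |H h i j - H 0 i j| ≤ ε / (2 * (Fintype.card ι + 1)) := by
    refine eventually_all.2 fun i => eventually_all.2 fun j => ?_
    have := (hjet i j).contDiffAt.continuousAt
    have h2 := Metric.continuousAt_iff'.1 this (ε / (2 * (Fintype.card ι + 1))) (by positivity)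
    filter_upwards [h2] with h hh
    rw [Real.dist_eq] at hh
    exact hh.le
  filter_upwards [hev] with h hh
  have hsp : ∀ x ∈ spectrum ℝ (H h), ∃ y ∈ K, |x - y| < ε := fun x hx => by
    obtain ⟨y, hy, hxy⟩ := (hH 0).exists_mem_spectrum_near hε (by positivity) hh (by
      rw [← mul_div_assoc, div_lt_iff₀ (by positivity)]
      have : (0 : ℝ) ≤ Fintype.card ι := Nat.cast_nonneg _
      nlinarith) hx
    exact ⟨y, hK hy, hxy⟩
  obtain ⟨g, hg⟩ := (hH h).exists_resolvent_values (hu hsp)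
  refine (hH h).cfc_apply_eq hg Λ'.toLinearMap (fun k => ?_) i j
  obtain ⟨y, hy, hxy⟩ := hsp _ ((hH h).eigenvalues_mem_spectrum_real k)
  have h3 := hrep _ y hy hxy (g k) fun s => by
    have := congrArg (fun f : C(I, ℂ) => f s) (hg k)
    simpa only [ContinuousMap.mul_apply, ContinuousMap.sub_apply,
      ContinuousMap.algebraMap_real_apply, ContinuousMap.one_apply] using this
  have h4 := congrArg Complex.re h3
  simpa [hΛ'] using h4

end MatrixFunction

/-! ### Functions of the tight-binding Hamiltonian -/

section HamiltonianFunction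

variable {S : Type*} {Nb Nc : ℕ} {𝓜 : TBModel S Nb Nc}

theorem TBModel.spectrum_subset_allowedSet {M : ℕ} {Z : Fin M → S} {μ L : ℝ} {r : Fin M → R3}
    {v : Fin M → Fin Nc → ℝ} (hL : ∀ x ∈ spectrum ℝ (𝓜.hamiltonian Z r v), |x| ≤ L) :
    spectrum ℝ (𝓜.hamiltonian Z r v) ⊆
      allowedSet L μ (𝓜.gapMinus Z μ r v) (𝓜.gapPlus Z μ r v) := by
  intro x hx
  refine ⟨hL x hx, ?_⟩
  have key : ∀ {T : Set ℝ}, x ∈ T →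
      (min 1 (Metric.infEDist μ (spectrum ℝ (𝓜.hamiltonian Z r v) ∩ T))).toReal ≤ |μ - x| := by
    intro T hT
    rw [← Real.dist_eq, dist_edist]
    refine ENNReal.toReal_mono (edist_ne_top _ _) ((min_le_right _ _).trans ?_)
    exact Metric.infEDist_le_edist_of_mem ⟨hx, hT⟩
  rcases le_total x μ with h | h
  · left
    have := key (T := Set.Iic μ) h
    rw [abs_of_nonneg (by linarith)] at this
    have h2 : (min 1 (𝓜.gapMinus Z μ r v)).toReal ≤ μ - x := this
    linarith
  · right
    have := key (T := Set.Ici μ) h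
    rw [abs_of_nonpos (by linarith)] at this
    have h2 : (min 1 (𝓜.gapPlus Z μ r v)).toReal ≤ -(μ - x) := this
    linarith

/-- Uniform locality of the functions `F`, `√F` and `S ∘ F` of the Hamiltonian, with respect to
weighted displacements. -/
theorem TBModel.exists_matrixFunction_jet {ν N : ℕ} (h𝓜 : 𝓜.Admissible ν) (hN : N + 1 ≤ ν) (μ : ℝ)
    {𝔪 : ℝ} (h𝔪 : 0 < 𝔪) (B : ℝ) :
    ∃ a C c : ℝ, 0 < a ∧ 0 < C ∧ 0 < c ∧ c ≤ a / 4 ∧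
    (∀ s b, ExpLocalised N C a (𝓜.orbital s b)) ∧
    ∀ β gm gp : ℝ≥0∞, FiniteTempOrGap β gm gp → ∃ D, 0 ≤ D ∧
    ∀ (M : ℕ) (Z : Fin M → S) (r : Fin M → R3) (v : Fin M → Fin Nc → ℝ),
      (∀ i j, i ≠ j → 𝔪 ≤ dist (r i) (r j)) → ‖v‖ ≤ B →
      gm = 𝓜.gapMinus Z μ r v → gp = 𝓜.gapPlus Z μ r v →
      ∀ (η : ℝ) (τ : Fin M → ℝ), 0 ≤ η → N * η ≤ c * decayScale β gm gp → IsWeight r η τ →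
      ∀ i j,
        JetBound N (fun h : Conf M Nc => 𝓜.H0 Z (movedPos r τ h) i j) 0
          (C * Real.exp (-(a * dist (r i.1) (r j.1)))) (τ i.1) ∧
        ∀ f : ℝ → ℝ, f = fermiDirac β μ ∨ (f = fun x => √(fermiDirac β μ x)) ∨
            (β ≠ ⊤ ∧ f = fun x => fermiEntropy (fermiDirac β μ x)) →
          JetBound N (fun h : Conf M Nc =>
            cfc f (𝓜.hamiltonian Z (movedPos r τ h) (movedFeat v τ h)) i j) 0
            (D * Real.exp (-(c * decayScale β gm gp * dist (r i.1) (r j.1)))) (τ i.1) := by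
  obtain ⟨a, C, ha, hC, horb, hham⟩ := 𝓜.exists_hamiltonian_jet h𝓜 hN h𝔪 B
  set s : ℝ := Nb * packingConst (a / 4) 𝔪 with hs
  have hs0 : 0 ≤ s := mul_nonneg (Nat.cast_nonneg _) (packingConst_nonneg _ _)
  -- The smallness condition of the Combes-Thomas estimate is linear in the rate and in the distance
  -- to the contour. This `c` satisfies it for all scales `θ` at once, with rate `c * θ` and
  -- distance `θ / 4`.
  set c : ℝ := min (a / 2) (a / (32 * C * (s + 1))) with hc
  have hc0 : 0 < c := by positivity
  have hca : c ≤ a / 2 := min_le_left _ _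
  have hcs : C * c * (4 / a) * s ≤ 1 / 8 := by
    have h1 : c ≤ a / (32 * C * (s + 1)) := min_le_right _ _
    calc C * c * (4 / a) * s ≤ C * (a / (32 * C * (s + 1))) * (4 / a) * (s + 1) := by
          gcongr
          linarith
      _ = 1 / 8 := by field_simp; norm_num
  refine ⟨a, C, c / 4, ha, hC, by positivity, by linarith, horb, fun β gm gp hfin => ?_⟩
  have hθ := decayScale_pos hfin
  have hθ1 := decayScale_le_one β gm gp
  set θ := decayScale β gm gp with hθdef
  have hα : c * θ ≤ a / 2 := (mul_le_of_le_one_right hc0.le hθ1).trans hca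
  have hαd : C * (c * θ) * (4 / a) * s ≤ θ / 4 / 2 := by
    calc C * (c * θ) * (4 / a) * s = (C * c * (4 / a) * s) * θ := by ring
      _ ≤ 1 / 8 * θ := by gcongr
      _ = _ := by ring
  have hrep : ∀ f : ℝ → ℝ, ∃ D, 0 ≤ D ∧
      (f = fermiDirac β μ ∨ (f = fun x => √(fermiDirac β μ x)) ∨
        (β ≠ ⊤ ∧ f = fun x => fermiEntropy (fermiDirac β μ x)) →
      ∀ {ι E : Type} [Fintype ι] [DecidableEq ι] [NormedAddCommGroup E]
      [NormedSpace ℝ E] {p : ι → R3} {H : E → Matrix ι ι ℝ} {η : ℝ} {τ : ι → ℝ},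
      (∀ h, (H h).IsHermitian) → spectrum ℝ (H 0) ⊆ allowedSet (C * s) μ gm gp →
      (∀ i, ∑ j, Real.exp (-(a / 4 * dist (p i) (p j))) ≤ s) →
      (∀ i, ∑ j, Real.exp (-(c * θ / 4 * dist (p i) (p j))) ≤
        Nb * packingConst (c * θ / 4) 𝔪) →
      0 ≤ η → N * η ≤ c * θ / 4 → (∀ i, 0 ≤ τ i) →
      (∀ i j, τ j ≤ τ i * Real.exp (η * dist (p i) (p j))) →
      (∀ i j, JetBound N (fun h => H h i j) 0 (C * Real.exp (-(a * dist (p i) (p j)))) (τ i)) →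
      ∀ i j, JetBound N (fun h => cfc f (H h) i j) 0
        (D * Real.exp (-(c * θ / 2 * dist (p i) (p j)))) (τ i)) := by
    intro f
    by_cases hf : f = fermiDirac β μ ∨ (f = fun x => √(fermiDirac β μ x)) ∨
        (β ≠ ⊤ ∧ f = fun x => fermiEntropy (fermiDirac β μ x))
    · have h1 : HasResolventRep (allowedSet (C * s) μ gm gp) (θ / 4) fun x => (f x : ℂ) := by
        rcases hf with rfl | rfl | ⟨hβ, rfl⟩
        · exact hasResolventRep_fermiDirac hfin
        · exact hasResolventRep_sqrt_fermiDirac hfin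
        · exact hasResolventRep_fermiEntropy hfin hβ
      obtain ⟨D, hD, h2⟩ := h1.exists_jetBound N (s' := Nb * packingConst (c * θ / 4) 𝔪) ha
        (by positivity) hα hC.le hαd
      exact ⟨D, hD, fun _ => h2⟩
    · exact ⟨0, le_rfl, fun h => absurd h hf⟩
  choose D hD hjet using hrep
  refine ⟨D (fermiDirac β μ) + D (fun x => √(fermiDirac β μ x)) +
    D (fun x => fermiEntropy (fermiDirac β μ x)),
    add_nonneg (add_nonneg (hD _) (hD _)) (hD _), ?_⟩
  intro M Z r v hr hv hgm hgp η τ hη hNη hτ i j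
  have hη' : N * η ≤ a := hNη.trans (by
    have : c / 4 * θ ≤ c * θ := by gcongr; linarith
    linarith)
  have hH := hham M Z r v hr hv η τ hη hη' hτ
  refine ⟨(hH i j).1, fun f hf => ?_⟩
  have hexp : ∀ {x y : ℝ} (i : Fin M × Fin Nb), x ≤ y →
      ∑ j : Fin M × Fin Nb, Real.exp (-(y * dist (r i.1) (r j.1))) ≤
        ∑ j : Fin M × Fin Nb, Real.exp (-(x * dist (r i.1) (r j.1))) := fun i hxy => by
    gcongr
  have hs1 : ∀ i : Fin M × Fin Nb,
      ∑ j : Fin M × Fin Nb, Real.exp (-(a / 4 * dist (r i.1) (r j.1))) ≤ s := fun i =>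
    sum_exp_neg_dist_prod_le (by positivity) h𝔪 hr _
  -- Row sums bound the spectrum independently of `M`, so one bounded contour serves all
  -- configurations with the given gaps.
  have hspec : spectrum ℝ (𝓜.hamiltonian Z r v) ⊆ allowedSet (C * s) μ gm gp := by
    rw [hgm, hgp]
    refine TBModel.spectrum_subset_allowedSet fun x hx => ?_
    refine Matrix.abs_le_of_mem_spectrum (by positivity)
      (k := fun i j => C * Real.exp (-(a * dist (r i.1) (r j.1))))
      (fun i j => by simpa using (hH i j).2.norm_le) (fun i j => by rw [dist_comm]) (fun i => ?_) hx
    rw [← Finset.mul_sum]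
    gcongr
    exact (hexp i (by linarith)).trans (hs1 i)
  have h3 := hjet f hf (p := fun i : Fin M × Fin Nb => r i.1)
    (H := fun h : Conf M Nc => 𝓜.hamiltonian Z (movedPos r τ h) (movedFeat v τ h))
    (τ := fun i => τ i.1) (η := η) (fun h => 𝓜.hamiltonian_isHermitian Z _ _)
    (by rw [movedPos_zero, movedFeat_zero]; exact hspec) hs1
    (fun i => sum_exp_neg_dist_prod_le (by positivity) h𝔪 hr _) hη
    (hNη.trans (le_of_eq (by ring))) (fun i => (hτ.pos _).le) (fun i j => hτ.le_mul _ _)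
    (fun i j => (hH i j).2) i j
  refine h3.mono_const ?_ (hτ.pos _).le
  have hDf : D f ≤ D (fermiDirac β μ) + D (fun x => √(fermiDirac β μ x)) +
      D (fun x => fermiEntropy (fermiDirac β μ x)) := by
    have h1 := hD (fermiDirac β μ)
    have h2 := hD (fun x => √(fermiDirac β μ x))
    have h3 := hD (fun x => fermiEntropy (fermiDirac β μ x))
    rcases hf with rfl | rfl | ⟨-, rfl⟩ <;> linarith
  have hD' := hD f
  refine mul_le_mul hDf (Real.exp_le_exp.2 (neg_le_neg ?_)) (Real.exp_pos _).le (hD'.trans hDf)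
  refine mul_le_mul_of_nonneg_right ?_ dist_nonneg
  linarith [mul_pos hc0 hθ]

end HamiltonianFunction

/-! ### From weighted displacements to mixed derivatives -/

section Conversion

open Filter Topology

variable {M Nc N : ℕ} {r : Fin M → R3} {v : Fin M → Fin Nc → ℝ} {τ : Fin M → ℝ}
  {f : (Fin M → R3) → (Fin M → Fin Nc → ℝ) → ℝ} {c : ℝ}

/-- The diagonal rescaling of displacements. -/
noncomputable def confScale (τ : Fin M → ℝ) : Conf M Nc →L[ℝ] Conf M Nc :=
  (ContinuousLinearMap.pi fun k => τ k • (ContinuousLinearMap.proj k).comp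
      (ContinuousLinearMap.fst ℝ (Fin M → R3) (Fin M → Fin Nc → ℝ))).prod
    (ContinuousLinearMap.pi fun k => τ k • (ContinuousLinearMap.proj k).comp
      (ContinuousLinearMap.snd ℝ (Fin M → R3) (Fin M → Fin Nc → ℝ)))

theorem confScale_apply (τ : Fin M → ℝ) (p : Conf M Nc) :
    confScale τ p = (fun k => τ k • p.1 k, fun k => τ k • p.2 k) := rfl

/-- The inverse substitution, which expresses the original function through the rescaled one. -/
theorem eq_moved_confScale (hτ : ∀ k, 0 < τ k) (p : Conf M Nc) :
    f p.1 p.2 = (fun h => f (movedPos r τ h) (movedFeat v τ h))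
      (-confScale (fun k => (τ k)⁻¹) (r, v) + confScale (fun k => (τ k)⁻¹) p) := by
  have h0 : ∀ k, τ k ≠ 0 := fun k => (hτ k).ne'
  have h1 : movedPos r τ (-confScale (fun k => (τ k)⁻¹) (r, v) +
      confScale (fun k => (τ k)⁻¹) p) = p.1 := by
    ext1 k
    simp [movedPos, confScale_apply, smul_smul, h0 k]
  have h2 : movedFeat v τ (-confScale (fun k => (τ k)⁻¹) (r, v) +
      confScale (fun k => (τ k)⁻¹) p) = p.2 := by
    ext1 k
    simp [movedFeat, confScale_apply, smul_smul, h0 k]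
  simp only [h1, h2]

theorem JetBound.contDiffAt_of_moved (hτ : ∀ k, 0 < τ k)
    (h : JetBound N (fun h => f (movedPos r τ h) (movedFeat v τ h)) 0 c 1) :
    ContDiffAt ℝ N (fun p : Conf M Nc => f p.1 p.2) (r, v) := by
  have h1 := funext fun p : Conf M Nc => eq_moved_confScale (f := f) (r := r) (v := v) hτ p
  rw [h1]
  refine ContDiffAt.comp (r, v) (g := fun h => f (movedPos r τ h) (movedFeat v τ h)) ?_
    (contDiffAt_const.add (confScale _).contDiff.contDiffAt)
  rw [neg_add_cancel]
  exact h.contDiffAt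

theorem confScale_single (k : Fin M) (h : R3 × (Fin Nc → ℝ)) :
    confScale τ (Pi.single k h.1, Pi.single k h.2) =
      τ k • ((Pi.single k h.1, Pi.single k h.2) : Conf M Nc) := by
  rw [confScale_apply, Prod.smul_mk]
  congr 1 <;>
  · ext1 l
    by_cases hl : l = k
    · subst hl; simp
    · simp [hl]

theorem norm_single_single (k : Fin M) (h : R3 × (Fin Nc → ℝ)) :
    ‖((Pi.single k h.1, Pi.single k h.2) : Conf M Nc)‖ = ‖h‖ := by
  rw [Prod.norm_def, Prod.norm_def, Pi.norm_single, Pi.norm_single]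

/-- A displacement of atom `k` alone is shortened by `(τ k)⁻¹` under the inverse substitution, and
an iterated derivative is multilinear; this produces the product of inverse weights. -/
theorem JetBound.abs_iteratedFDeriv_le_of_moved (hτ : ∀ k, 0 < τ k)
    (h : JetBound N (fun h => f (movedPos r τ h) (movedFeat v τ h)) 0 c 1) {j : ℕ} (hj : j ≤ N)
    (k : Fin j → Fin M) : MixedDerivBound f j k r v (c * ∏ i, (τ (k i))⁻¹) := by
  intro w
  have h1 := funext fun p : Conf M Nc => eq_moved_confScale (f := f) (r := r) (v := v) hτ p
  have h2 := JetBound.iteratedFDeriv_comp_affine (x := ((r, v) : Conf M Nc)) (n := j)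
    (g := fun h => f (movedPos r τ h) (movedFeat v τ h))
    (-confScale (fun k => (τ k)⁻¹) (r, v)) (confScale fun k => (τ k)⁻¹)
    (by rw [neg_add_cancel]; exact h.contDiffAt.of_le (by exact_mod_cast hj))
  rw [neg_add_cancel] at h2
  rw [h1, h2, ContinuousMultilinearMap.compContinuousLinearMap_apply,
    ← Real.norm_eq_abs]
  refine (ContinuousMultilinearMap.le_opNorm _ _).trans ?_
  have h3 : ∀ i, ‖confScale (fun k => (τ k)⁻¹)
      ((Pi.single (k i) (w i).1, Pi.single (k i) (w i).2) : Conf M Nc)‖ =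
      (τ (k i))⁻¹ * ‖w i‖ := fun i => by
    rw [confScale_single, norm_smul, norm_single_single, Real.norm_of_nonneg
      (inv_nonneg.2 (hτ _).le)]
  rw [Finset.prod_congr rfl (fun (i : Fin j) _ => h3 i), Finset.prod_mul_distrib, ← mul_assoc]
  have h4 := h.bound j hj
  rw [one_pow, mul_one] at h4
  have h5 : 0 ≤ ∏ i, (τ (k i))⁻¹ := Finset.prod_nonneg fun i _ => inv_nonneg.2 (hτ _).le
  gcongr

theorem JetBound.norm_partial_le_of_moved (hτ : ∀ k, 0 < τ k)
    (h : JetBound N (fun h => f (movedPos r τ h) (movedFeat v τ h)) 0 c 1) (hN : 1 ≤ N)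
    (k : Fin M) : ‖partialPos f k r v‖ + ‖partialFeat f k r v‖ ≤ 2 * c * (τ k)⁻¹ := by
  have hd := ((h.contDiffAt_of_moved hτ).differentiableAt (by
    simp; lia)).hasFDerivAt
  have hc := h.nonneg
  have hb := h.abs_iteratedFDeriv_le_of_moved hτ hN (fun _ : Fin 1 => k)
  simp only [MixedDerivBound, Finset.univ_unique, Fin.default_eq_zero, Finset.prod_const,
    Finset.card_singleton, pow_one, iteratedFDeriv_one_apply] at hb
  have h1 : partialPos f k r v = (fderiv ℝ (fun p : Conf M Nc => f p.1 p.2) (r, v)).comp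
      ((ContinuousLinearMap.inl ℝ _ _).comp (ContinuousLinearMap.single ℝ (fun _ => R3) k)) := by
    have e : HasFDerivAt (fun s : R3 => ((Function.update r k s, v) : Conf M Nc))
        ((ContinuousLinearMap.inl ℝ _ _).comp (ContinuousLinearMap.single ℝ (fun _ => R3) k))
        (r k) := by
      have := (hasFDerivAt_update (𝕜 := ℝ) r (i := k) (r k)).prodMk
        (hasFDerivAt_const v (r k))
      refine this.congr_fderiv (ContinuousLinearMap.ext fun x => Prod.ext (funext fun l => ?_) rfl)
      by_cases hl : l = k
      · subst hl; simp
      · simp [hl]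
    refine (HasFDerivAt.comp (r k) (g := fun p : Conf M Nc => f p.1 p.2) ?_ e).fderiv
    simpa using hd
  have h2 : partialFeat f k r v = (fderiv ℝ (fun p : Conf M Nc => f p.1 p.2) (r, v)).comp
      ((ContinuousLinearMap.inr ℝ _ _).comp
        (ContinuousLinearMap.single ℝ (fun _ => Fin Nc → ℝ) k)) := by
    have e : HasFDerivAt (fun s : Fin Nc → ℝ => ((r, Function.update v k s) : Conf M Nc))
        ((ContinuousLinearMap.inr ℝ _ _).comp
          (ContinuousLinearMap.single ℝ (fun _ => Fin Nc → ℝ) k)) (v k) := by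
      have := (hasFDerivAt_const r (v k)).prodMk (hasFDerivAt_update (𝕜 := ℝ) v (i := k) (v k))
      refine this.congr_fderiv (ContinuousLinearMap.ext fun x => Prod.ext rfl (funext fun l => ?_))
      by_cases hl : l = k
      · subst hl; simp
      · simp [hl]
    refine (HasFDerivAt.comp (v k) (g := fun p : Conf M Nc => f p.1 p.2) ?_ e).fderiv
    simpa using hd
  have h3 : ‖partialPos f k r v‖ ≤ c * (τ k)⁻¹ := by
    rw [h1]
    refine ContinuousLinearMap.opNorm_le_bound _ (mul_nonneg hc (inv_nonneg.2 (hτ k).le))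
      fun x => ?_
    have := hb fun _ => (x, 0)
    simpa [Prod.norm_def] using this
  have h4 : ‖partialFeat f k r v‖ ≤ c * (τ k)⁻¹ := by
    rw [h2]
    refine ContinuousLinearMap.opNorm_le_bound _ (mul_nonneg hc (inv_nonneg.2 (hτ k).le))
      fun x => ?_
    have := hb fun _ => (0, x)
    simpa [Prod.norm_def] using this
  linarith

end Conversion

/-! ### Locality of the band energies and of the atomic densities -/

section Local

variable {S : Type*} {Nb Nc N : ℕ} {𝓜 : TBModel S Nb Nc}

theorem Matrix.cfc_apply_symm {ι : Type*} [Fintype ι] [DecidableEq ι] (f : ℝ → ℝ)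
    (H : Matrix ι ι ℝ) (i j : ι) : cfc f H i j = cfc f H j i := by
  have h : IsSelfAdjoint (cfc f H) := cfc_predicate f H
  have := congrFun (congrFun h j) i
  simpa [Matrix.star_apply] using this

/-- The spectrum is finite, so every function is continuous on it and the calculus composes, even
for the step function at `β = ∞`. -/
theorem TBModel.cfc_fermiEntropy_fermiMatrix {M : ℕ} (Z : Fin M → S) (β : ℝ≥0∞) (μ : ℝ)
    (r : Fin M → R3) (v : Fin M → Fin Nc → ℝ) :
    cfc fermiEntropy (𝓜.fermiMatrix Z β μ r v) =
      cfc (fun x => fermiEntropy (fermiDirac β μ x)) (𝓜.hamiltonian Z r v) := by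
  have hH : IsSelfAdjoint (𝓜.hamiltonian Z r v) := 𝓜.hamiltonian_isHermitian Z r v
  have hfin : (spectrum ℝ (𝓜.hamiltonian Z r v)).Finite := Matrix.finite_real_spectrum
  exact (cfc_comp' fermiEntropy (fermiDirac β μ) (𝓜.hamiltonian Z r v)
    ((hfin.image _).continuousOn _) (hfin.continuousOn _) hH).symm

/-- Weighted jets of the matrix `F(H)` and of related ones, on which all locality estimates are
based. -/
structure FermiJets {M : ℕ} (𝓜 : TBModel S Nb Nc) (Z : Fin M → S) (β : ℝ≥0∞) (μ : ℝ)
    (r : Fin M → R3) (v : Fin M → Fin Nc → ℝ) (N : ℕ) (a C D b η : ℝ) (τ : Fin M → ℝ) : Prop where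
  weight : IsWeight r η τ
  H0 : ∀ i j, JetBound N (fun h : Conf M Nc => 𝓜.H0 Z (movedPos r τ h) i j) 0
    (C * Real.exp (-(a * dist (r i.1) (r j.1)))) (τ i.1)
  fermi : ∀ i j, JetBound N (fun h : Conf M Nc =>
      𝓜.fermiMatrix Z β μ (movedPos r τ h) (movedFeat v τ h) i j) 0
    (D * Real.exp (-(b * dist (r i.1) (r j.1)))) (τ i.1)
  sqrt : ∀ i j, JetBound N (fun h : Conf M Nc =>
      cfc (fun x => √(fermiDirac β μ x))
        (𝓜.hamiltonian Z (movedPos r τ h) (movedFeat v τ h)) i j) 0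
    (D * Real.exp (-(b * dist (r i.1) (r j.1)))) (τ i.1)
  entropy : β ≠ ⊤ → ∀ i j, JetBound N (fun h : Conf M Nc =>
      cfc fermiEntropy (𝓜.fermiMatrix Z β μ (movedPos r τ h) (movedFeat v τ h)) i j) 0
    (D * Real.exp (-(b * dist (r i.1) (r j.1)))) (τ i.1)

variable {M : ℕ} {Z : Fin M → S} {β : ℝ≥0∞} {μ a C D b η 𝔪 : ℝ} {r : Fin M → R3}
  {v : Fin M → Fin Nc → ℝ} {τ : Fin M → ℝ}

/-- In the diagonal entries of `(H₀ - μ) F` the decay of `H₀` alone makes the intermediate sum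
converge, so `F` only has to be bounded. -/
theorem FermiJets.jetBound_bandSiteEnergy (hF : FermiJets 𝓜 Z β μ r v N a C D b η τ) (ha : 0 < a)
    (hC : 0 ≤ C) (hD : 0 ≤ D) (hb : 0 ≤ b) (h𝔪 : 0 < 𝔪)
    (hr : ∀ i j, i ≠ j → 𝔪 ≤ dist (r i) (r j)) (ℓ : Fin M) :
    JetBound N (fun h : Conf M Nc =>
        𝓜.bandSiteEnergy Z β μ ℓ (movedPos r τ h) (movedFeat v τ h)) 0
      (Nb * ((C + |μ|) * D * (Nb * packingConst a 𝔪) * 2 ^ N + (β⁻¹).toReal * D)) (τ ℓ) := by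
  have hτ := hF.weight
  have h1 : ∀ i j, JetBound N (fun h : Conf M Nc =>
      (𝓜.H0 Z (movedPos r τ h) - μ • (1 : Matrix (Fin M × Fin Nb) (Fin M × Fin Nb) ℝ)) i j) 0
      ((C + |μ|) * Real.exp (-(a * dist (r i.1) (r j.1)))) (τ i.1) := fun i j => by
    have hc := JetBound.const (N := N) (-(μ • (1 : Matrix (Fin M × Fin Nb) (Fin M × Fin Nb) ℝ)) i j)
      (0 : Conf M Nc) (hτ.pos i.1).le
    refine ((hF.H0 i j).add hc).mono_const ?_ (hτ.pos _).le
    rw [add_mul]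
    gcongr
    by_cases hij : i = j
    · subst hij; simp
    · simp [hij]; positivity
  have h2 : ∀ i j, JetBound N (fun h : Conf M Nc =>
      (𝓜.H0 Z (movedPos r τ h) - μ • (1 : Matrix (Fin M × Fin Nb) (Fin M × Fin Nb) ℝ)) i j *
        𝓜.fermiMatrix Z β μ (movedPos r τ h) (movedFeat v τ h) j i) 0
      ((C + |μ|) * D * Real.exp (-(a * dist (r i.1) (r j.1))) * 2 ^ N) (τ i.1) := fun i j => by
    have h3 : JetBound N (fun h : Conf M Nc =>
        𝓜.fermiMatrix Z β μ (movedPos r τ h) (movedFeat v τ h) j i) 0 D (τ i.1) := by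
      -- The entry `(j, i)` comes with scale `τ j`; symmetry of `F` gives it scale `τ i`, as wanted.
      have e : (fun h : Conf M Nc => 𝓜.fermiMatrix Z β μ (movedPos r τ h) (movedFeat v τ h) j i) =
          fun h => 𝓜.fermiMatrix Z β μ (movedPos r τ h) (movedFeat v τ h) i j :=
        funext fun h => Matrix.cfc_apply_symm _ _ _ _
      rw [e]
      refine (hF.fermi i j).mono_const (mul_le_of_le_one_right hD ?_) (hτ.pos _).le
      exact Real.exp_le_one_iff.2 (neg_nonpos.2 (by positivity))
    have h4 := (h1 i j).mul h3
    rw [← two_mul] at h4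
    exact (h4.absorb one_le_two (hτ.pos _).le).mono_const (le_of_eq (by ring)) (hτ.pos _).le
  have h5 : ∀ i, JetBound N (fun h : Conf M Nc =>
      (β⁻¹).toReal * cfc fermiEntropy
        (𝓜.fermiMatrix Z β μ (movedPos r τ h) (movedFeat v τ h)) i i) 0
      ((β⁻¹).toReal * D) (τ i.1) := fun i => by
    by_cases hβ : β = ⊤
    · simp only [hβ, ENNReal.inv_top, ENNReal.toReal_zero, zero_mul]
      simpa using JetBound.const (N := N) (0 : ℝ) (0 : Conf M Nc) (hτ.pos i.1).le
    · have := (hF.entropy hβ i i).const_mul (hτ.pos _).le (β⁻¹).toReal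
      rw [abs_of_nonneg ENNReal.toReal_nonneg] at this
      simpa using this
  have h6 : ∀ i : Fin M × Fin Nb, JetBound N (fun h : Conf M Nc =>
      𝓜.bandMatrix Z β μ (movedPos r τ h) (movedFeat v τ h) i i) 0
      ((C + |μ|) * D * (Nb * packingConst a 𝔪) * 2 ^ N + (β⁻¹).toReal * D) (τ i.1) := fun i => by
    have h7 := (JetBound.sum Finset.univ fun j _ => h2 i j).add (h5 i)
    refine (h7.mono_const ?_ (hτ.pos _).le).congr (Filter.Eventually.of_forall fun h => ?_)
    · gcongr
      rw [← Finset.sum_mul, ← Finset.mul_sum]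
      gcongr
      exact sum_exp_neg_dist_prod_le ha h𝔪 hr _
    · simp only [TBModel.bandMatrix, Matrix.add_apply, Matrix.mul_apply, Matrix.smul_apply,
        smul_eq_mul]
  have h8 := JetBound.sum (N := N) (x := (0 : Conf M Nc)) (t := τ ℓ) Finset.univ (g := fun (b : Fin Nb) (h : Conf M Nc) =>
    𝓜.bandMatrix Z β μ (movedPos r τ h) (movedFeat v τ h) (ℓ, b) (ℓ, b)) fun b _ => h6 (ℓ, b)
  refine h8.mono_const (le_of_eq ?_) (hτ.pos _).le
  rw [Finset.sum_const, Finset.card_univ, Fintype.card_fin, nsmul_eq_mul]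

/-- All decay comes from the two orbitals at `x`: half of their rate pays for the weights, as
`r_{ℓk}` is at most the sum of the distances from `x`. The rest gives decay about `r ℓ` and the
convergent sum over `k`. -/
theorem FermiJets.jetBound_siteDensity (hF : FermiJets 𝓜 Z β μ r v N a C D b η τ) (ha : 0 < a)
    (horb : ∀ s b, ExpLocalised N C a (𝓜.orbital s b))
    (hC : 0 ≤ C) (hD : 0 ≤ D) (hb : 0 ≤ b) (hη : 0 ≤ η) (hNη : N * η ≤ a / 2) (h𝔪 : 0 < 𝔪)
    (hr : ∀ i j, i ≠ j → 𝔪 ≤ dist (r i) (r j)) (ℓ : Fin M) (x : R3) :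
    JetBound N (fun h : Conf M Nc =>
        𝓜.siteDensity Z β μ ℓ (movedPos r τ h) (movedFeat v τ h) x) 0
      (2 * (Nb * (C ^ 2 * D * 3 ^ N * (Nb * packingConst (a / 2) 𝔪))) *
        Real.exp (-(a / 2 * dist x (r ℓ)))) (τ ℓ) := by
  have hτ := hF.weight
  have hφ : ∀ i : Fin M × Fin Nb, JetBound N (fun h : Conf M Nc => 𝓜.phi Z (movedPos r τ h) i x) 0
      (C * Real.exp (-(a * dist x (r i.1)))) (τ i.1) := fun i => by
    have := jetBound_centred (horb (Z i.1) i.2) hτ i.1 x (0 : Conf M Nc)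
    rwa [movedPos_zero] at this
  have h1 : ∀ i j : Fin M × Fin Nb, JetBound N (fun h : Conf M Nc =>
      𝓜.phi Z (movedPos r τ h) i x *
        𝓜.fermiMatrix Z β μ (movedPos r τ h) (movedFeat v τ h) i j *
        𝓜.phi Z (movedPos r τ h) j x) 0
      (C ^ 2 * D * 3 ^ N * Real.exp (-(a / 2 * dist x (r i.1))) *
        Real.exp (-(a / 2 * dist x (r j.1)))) (τ i.1) := fun i j => by
    have h2 := ((hφ i).mul (hF.fermi i j)).mul (hφ j)
    have p1 := hτ.pos i.1
    have p2 := hτ.pos j.1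
    have d0 : 0 ≤ dist x (r i.1) + dist x (r j.1) := by positivity
    have hd : dist (r i.1) (r j.1) ≤ dist x (r i.1) + dist x (r j.1) := dist_triangle_left _ _ _
    have h3 := h2.absorb_exp (by positivity) p1.le (K := 3)
      (s := η * (dist x (r i.1) + dist x (r j.1))) (by norm_num) (by positivity) (by
        have e1 : τ j.1 ≤ τ i.1 * Real.exp (η * (dist x (r i.1) + dist x (r j.1))) :=
          (hτ.le_mul i.1 j.1).trans (by gcongr)
        have e2 : τ i.1 ≤ τ i.1 * Real.exp (η * (dist x (r i.1) + dist x (r j.1))) :=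
          le_mul_of_one_le_right p1.le (Real.one_le_exp (by positivity))
        linarith)
    refine h3.mono_const ?_ p1.le
    have e3 : Real.exp (-(b * dist (r i.1) (r j.1))) ≤ 1 :=
      Real.exp_le_one_iff.2 (neg_nonpos.2 (by positivity))
    calc _ ≤ C * Real.exp (-(a * dist x (r i.1))) * (D * 1) *
          (C * Real.exp (-(a * dist x (r j.1)))) * 3 ^ N *
          Real.exp (a / 2 * (dist x (r i.1) + dist x (r j.1))) := by
            gcongr ?_ * Real.exp ?_
            · gcongr
            · rw [← mul_assoc]; gcongr
      _ = C ^ 2 * D * 3 ^ N * (Real.exp (-(a * dist x (r i.1))) *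
          Real.exp (-(a * dist x (r j.1))) *
          Real.exp (a / 2 * (dist x (r i.1) + dist x (r j.1)))) := by ring
      _ = C ^ 2 * D * 3 ^ N * (Real.exp (-(a / 2 * dist x (r i.1))) *
          Real.exp (-(a / 2 * dist x (r j.1)))) := by
            rw [← Real.exp_add, ← Real.exp_add, ← Real.exp_add]
            ring_nf
      _ ≤ _ := le_of_eq (by ring)
  have h4 := (JetBound.sum Finset.univ fun (k : Fin M) _ => JetBound.sum Finset.univ
    fun (α : Fin Nb) _ => JetBound.sum Finset.univ fun (γ : Fin Nb) _ =>
      h1 (ℓ, α) (k, γ)).const_mul (hτ.pos ℓ).le 2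
  refine h4.mono_const ?_ (hτ.pos _).le
  rw [abs_two, mul_assoc 2]
  gcongr
  simp only [← Finset.mul_sum, Finset.sum_const, Finset.card_univ, Fintype.card_fin, nsmul_eq_mul]
  have := sum_exp_neg_dist_le (half_pos ha) h𝔪 hr x
  have e : 0 ≤ C ^ 2 * D * 3 ^ N * Real.exp (-(a / 2 * dist x (r ℓ))) := by positivity
  calc _ = Nb * (C ^ 2 * D * 3 ^ N * (Nb *
      ∑ k, Real.exp (-(a / 2 * dist x (r k))))) * Real.exp (-(a / 2 * dist x (r ℓ))) := by ring
    _ ≤ _ := by gcongr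

end Local

/-! ### The exchange-correlation energy density as a function of the orbital amplitudes -/

section Exc

open Filter Topology

theorem tendsto_norm_rpow_nhds_zero {V : Type*} [NormedAddCommGroup V] (K : ℝ) :
    Tendsto (fun q : V => K * ‖q‖ ^ (2 / 3 : ℝ)) (𝓝 0) (𝓝 0) := by
  have h1 : Continuous fun q : V => K * ‖q‖ ^ (2 / 3 : ℝ) :=
    continuous_const.mul (continuous_norm.rpow_const fun _ => Or.inr (by norm_num))
  have := h1.tendsto 0
  simpa [Real.zero_rpow (by norm_num : (2 / 3 : ℝ) ≠ 0)] using this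

/-- At the origin `f` is `o(|q|)` and its derivative tends to zero, so the singular point is
removable. This is applied to `q ↦ exc (2 |q|²)` and then to its derivative. -/
theorem contDiff_one_of_punctured {V W : Type*} [NormedAddCommGroup V] [NormedSpace ℝ V]
    [NormedAddCommGroup W] [NormedSpace ℝ W] {f : V → W} {K : ℝ}
    (hf : ∀ q, ‖q‖ ≤ 1 → ‖f q‖ ≤ K * ‖q‖ ^ (2 / 3 : ℝ) * ‖q‖)
    (hd : ∀ q, q ≠ 0 → DifferentiableAt ℝ f q)
    (hb : ∀ q, q ≠ 0 → ‖q‖ ≤ 1 → ‖fderiv ℝ f q‖ ≤ K * ‖q‖ ^ (2 / 3 : ℝ))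
    (hc : ∀ q, q ≠ 0 → ContinuousAt (fderiv ℝ f) q) :
    ContDiff ℝ 1 f ∧ fderiv ℝ f 0 = 0 := by
  have hev : ∀ᶠ q : V in 𝓝 0, ‖q‖ ≤ 1 := by
    filter_upwards [Metric.closedBall_mem_nhds (0 : V) one_pos] with q hq
    simpa using hq
  have hf0 : f 0 = 0 := by simpa using hf 0 (by simp)
  have h0 : HasFDerivAt f (0 : V →L[ℝ] W) 0 := by
    rw [hasFDerivAt_iff_isLittleO]
    simp only [hf0, sub_zero, _root_.zero_apply]
    have h1 : f =O[𝓝 0] fun q : V => K * ‖q‖ ^ (2 / 3 : ℝ) * ‖q‖ := by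
      refine Asymptotics.IsBigO.of_bound 1 (hev.mono fun q hq => ?_)
      rw [one_mul]
      exact (hf q hq).trans (le_abs_self _)
    have h2 : (fun q : V => K * ‖q‖ ^ (2 / 3 : ℝ)) =o[𝓝 0] fun _ => (1 : ℝ) :=
      (Asymptotics.isLittleO_one_iff ℝ).2 (tendsto_norm_rpow_nhds_zero K)
    have h3 := h1.trans_isLittleO (h2.mul_isBigO (Asymptotics.isBigO_refl (fun q : V => ‖q‖) (𝓝 0)))
    simp only [one_mul] at h3
    exact h3.of_norm_right
  refine ⟨contDiff_one_iff_fderiv.2 ⟨fun q => ?_, continuous_iff_continuousAt.2 fun q => ?_⟩,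
    h0.fderiv⟩
  · by_cases hq : q = 0
    · rw [hq]; exact h0.differentiableAt
    · exact hd q hq
  · by_cases hq : q = 0
    · rw [hq, ContinuousAt, h0.fderiv, tendsto_zero_iff_norm_tendsto_zero]
      refine squeeze_zero' (Eventually.of_forall fun _ => norm_nonneg _)
        (hev.mono fun q hq => ?_) (tendsto_norm_rpow_nhds_zero K)
      by_cases hq0 : q = 0
      · simp [hq0, h0.fderiv, Real.zero_rpow (by norm_num : (2 / 3 : ℝ) ≠ 0)]
      · exact hb q hq0 hq
    · exact hc q hq

variable {exc : ℝ → ℝ}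

theorem AdmissibleExc.apply_zero (h : AdmissibleExc exc) : exc 0 = 0 := by
  obtain ⟨c₁, c₂, δ, -, -, hδ, h1⟩ := h.near_zero
  have := h1 0 le_rfl hδ
  rw [Real.zero_rpow (by norm_num), mul_zero, mul_zero] at this
  linarith

theorem AdmissibleExc.exists_abs_deriv_le (h : AdmissibleExc exc) :
    ∃ C, 0 ≤ C ∧ ∀ ρ, 0 < ρ → |deriv exc ρ| ≤ C * ρ ^ (1 / 3 : ℝ) := by
  obtain ⟨C, hC⟩ := h.deriv_bound
  refine ⟨C, ?_, fun ρ hρ => abs_le.2 ⟨(hC ρ hρ).1, (hC ρ hρ).2.trans ?_⟩⟩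
  · have := hC 1 one_pos
    rw [Real.one_rpow] at this
    linarith
  · have := hC ρ hρ
    linarith

theorem AdmissibleExc.differentiableAt (h : AdmissibleExc exc) {ρ : ℝ} (hρ : 0 < ρ) :
    DifferentiableAt ℝ exc ρ := h.differentiableOn.differentiableAt (Ioi_mem_nhds hρ)

theorem AdmissibleExc.tendsto_zero (h : AdmissibleExc exc) : Tendsto exc (𝓝[>] 0) (𝓝 0) := by
  obtain ⟨c₁, c₂, δ, hc₁, -, hδ, h1⟩ := h.near_zero
  have h2 : Continuous fun ρ : ℝ => c₂ * ρ ^ (4 / 3 : ℝ) :=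
    continuous_const.mul (continuous_id.rpow_const fun _ => Or.inr (by norm_num))
  have h3 := (h2.tendsto 0).mono_left (nhdsWithin_le_nhds (s := Set.Ioi 0))
  rw [Real.zero_rpow (by norm_num), mul_zero] at h3
  refine squeeze_zero_norm' ?_ h3
  filter_upwards [Ioo_mem_nhdsGT hδ] with ρ hρ
  have := h1 ρ hρ.1.le hρ.2
  have h0 : 0 ≤ c₁ * ρ ^ (4 / 3 : ℝ) := mul_nonneg hc₁.le (Real.rpow_nonneg hρ.1.le _)
  rw [Real.norm_eq_abs, abs_of_nonpos (by linarith)]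
  exact this.2

/-- Mean value inequality on `[s, ρ]`, followed by `s → 0`; the behaviour near zero gives the limit
`exc s → 0`. -/
theorem AdmissibleExc.abs_le (h : AdmissibleExc exc) {C : ℝ} (hC0 : 0 ≤ C)
    (hC : ∀ ρ, 0 < ρ → |deriv exc ρ| ≤ C * ρ ^ (1 / 3 : ℝ)) {ρ : ℝ} (hρ : 0 ≤ ρ) :
    |exc ρ| ≤ C * ρ ^ (1 / 3 : ℝ) * ρ := by
  rcases hρ.eq_or_lt with rfl | hρ
  · simp [h.apply_zero]
  have h1 : ∀ᶠ s in 𝓝[>] (0 : ℝ), |exc ρ - exc s| ≤ C * ρ ^ (1 / 3 : ℝ) * ρ := by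
    filter_upwards [Ioo_mem_nhdsGT hρ] with s hs
    have := (convex_Icc s ρ).norm_image_sub_le_of_norm_deriv_le (f := exc)
      (C := C * ρ ^ (1 / 3 : ℝ)) (x := s) (y := ρ)
      (fun x hx => h.differentiableAt (hs.1.trans_le hx.1))
      (fun x hx => (hC x (hs.1.trans_le hx.1)).trans (mul_le_mul_of_nonneg_left
        (Real.rpow_le_rpow (hs.1.le.trans hx.1) hx.2 (by norm_num)) hC0))
      ⟨le_rfl, hs.2.le⟩ ⟨hs.2.le, le_rfl⟩
    refine this.trans ?_
    have h0 := Real.rpow_nonneg hρ.le (1 / 3)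
    gcongr
    rw [Real.norm_eq_abs, abs_of_nonneg (by linarith [hs.2])]
    linarith [hs.1]
  have h2 := (h.tendsto_zero.const_sub (exc ρ)).abs
  rw [sub_zero] at h2
  exact le_of_tendsto h2 h1

/-- `q ↦ exc (2 |q|²)` is `N` times continuously differentiable on every inner product space, with
derivatives bounded by `|q| ^ (2/3)` on bounded sets. -/
def ExcSmooth (exc : ℝ → ℝ) (N : ℕ) : Prop :=
  ∀ R : ℝ, ∃ K, 0 ≤ K ∧ ∀ (V : Type) [NormedAddCommGroup V] [InnerProductSpace ℝ V],
    ContDiff ℝ N (fun q : V => exc (2 * ‖q‖ ^ 2)) ∧ ∀ n ≤ N, ∀ q : V, ‖q‖ ≤ R →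
      ‖iteratedFDeriv ℝ n (fun q : V => exc (2 * ‖q‖ ^ 2)) q‖ ≤ K * ‖q‖ ^ (2 / 3 : ℝ)

theorem Real.rpow_third_two_mul_sq_le {s : ℝ} (hs : 0 ≤ s) :
    (2 * s ^ 2) ^ (1 / 3 : ℝ) ≤ 2 * s ^ (2 / 3 : ℝ) := by
  rw [Real.mul_rpow (by norm_num) (by positivity), ← Real.rpow_natCast_mul hs]
  have h1 : (2 : ℝ) ^ (1 / 3 : ℝ) ≤ 2 := by
    conv_rhs => rw [← Real.rpow_one 2]
    exact Real.rpow_le_rpow_of_exponent_le (by norm_num) (by norm_num)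
  have h2 : ((2 : ℕ) : ℝ) * (1 / 3) = 2 / 3 := by norm_num
  rw [h2]
  gcongr

/-! ### Smoothness of the energy density at zero amplitude -/

section Amplitude

theorem two_mul_norm_sq_pos {V : Type*} [NormedAddCommGroup V] {q : V} (hq : q ≠ 0) : 0 < 2 * ‖q‖ ^ 2 := by
  have := norm_pos_iff.2 hq
  positivity

variable {V : Type*} [NormedAddCommGroup V] [InnerProductSpace ℝ V]

/-- The real inner product as a continuous bilinear form. -/
noncomputable def innerCLM (V : Type*) [NormedAddCommGroup V] [InnerProductSpace ℝ V] :
    V →L[ℝ] V →L[ℝ] ℝ :=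
  LinearMap.mkContinuous₂ (innerₗ V) 1 fun x y => by
    simpa using abs_real_inner_le_norm x y

theorem innerCLM_apply (q : V) : innerCLM V q = innerSL ℝ q := by
  ext x
  simp [innerCLM]

theorem hasFDerivAt_two_mul_norm_sq (q : V) :
    HasFDerivAt (fun q : V => 2 * ‖q‖ ^ 2) ((4 : ℝ) • innerSL ℝ q) q := by
  have := (hasStrictFDerivAt_norm_sq q).hasFDerivAt.const_mul 2
  refine this.congr_fderiv ?_
  ext x
  simp
  ring

theorem AdmissibleExc.hasFDerivAt_of_ne_zero (h : AdmissibleExc exc) {q : V} (hq : q ≠ 0) :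
    HasFDerivAt (fun q : V => exc (2 * ‖q‖ ^ 2))
      ((4 * deriv exc (2 * ‖q‖ ^ 2)) • innerSL ℝ q) q := by
  have := (h.differentiableAt (two_mul_norm_sq_pos hq)).hasDerivAt.comp_hasFDerivAt q
    (hasFDerivAt_two_mul_norm_sq q)
  refine this.congr_fderiv ?_
  rw [smul_smul, mul_comm]

/-- The derivative is `4 exc' (2 |q|²) ⟨q, ·⟩`, and `|exc' ρ| ≤ C ρ ^ (1/3)` makes it of size `|q| ^
(5/3)`. The `8` is `4` times the `2` that bounds `2 ^ (1/3)`. -/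
theorem AdmissibleExc.exists_contDiff_one (h : AdmissibleExc exc) : ∃ C, 0 ≤ C ∧
    ∀ (V : Type) [NormedAddCommGroup V] [InnerProductSpace ℝ V],
      ContDiff ℝ 1 (fun q : V => exc (2 * ‖q‖ ^ 2)) ∧
      (fderiv ℝ fun q : V => exc (2 * ‖q‖ ^ 2)) 0 = 0 ∧
      ∀ q : V, |exc (2 * ‖q‖ ^ 2)| ≤ C * ‖q‖ ^ (2 / 3 : ℝ) * ‖q‖ ^ 2 ∧
        ‖fderiv ℝ (fun q : V => exc (2 * ‖q‖ ^ 2)) q‖ ≤ C * ‖q‖ ^ (2 / 3 : ℝ) * ‖q‖ := by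
  obtain ⟨C, hC0, hC⟩ := h.exists_abs_deriv_le
  refine ⟨8 * C, by positivity, fun V _ _ => ?_⟩
  have b0 : ∀ q : V, |exc (2 * ‖q‖ ^ 2)| ≤ 8 * C * ‖q‖ ^ (2 / 3 : ℝ) * ‖q‖ ^ 2 := fun q => by
    refine (h.abs_le hC0 hC (by positivity)).trans ?_
    have h1 := Real.rpow_third_two_mul_sq_le (norm_nonneg q)
    have h2 := Real.rpow_nonneg (norm_nonneg q) (2 / 3)
    calc C * (2 * ‖q‖ ^ 2) ^ (1 / 3 : ℝ) * (2 * ‖q‖ ^ 2)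
        ≤ C * (2 * ‖q‖ ^ (2 / 3 : ℝ)) * (2 * ‖q‖ ^ 2) := by gcongr
      _ = 4 * C * ‖q‖ ^ (2 / 3 : ℝ) * ‖q‖ ^ 2 := by ring
      _ ≤ _ := by gcongr; norm_num
  have b1 : ∀ q : V, q ≠ 0 → ‖fderiv ℝ (fun q : V => exc (2 * ‖q‖ ^ 2)) q‖ ≤
      8 * C * ‖q‖ ^ (2 / 3 : ℝ) * ‖q‖ := fun q hq => by
    rw [(h.hasFDerivAt_of_ne_zero hq).fderiv, norm_smul, innerSL_apply_norm, norm_mul,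
      Real.norm_eq_abs, Real.norm_eq_abs, abs_of_pos (four_pos : (0 : ℝ) < 4)]
    have h1 := Real.rpow_third_two_mul_sq_le (norm_nonneg q)
    calc 4 * |deriv exc (2 * ‖q‖ ^ 2)| * ‖q‖
        ≤ 4 * (C * (2 * ‖q‖ ^ (2 / 3 : ℝ))) * ‖q‖ := by
          gcongr
          exact (hC _ (two_mul_norm_sq_pos hq)).trans (by gcongr)
      _ = _ := by ring
  have key := contDiff_one_of_punctured (f := fun q : V => exc (2 * ‖q‖ ^ 2)) (K := 8 * C)
    (fun q hq => (b0 q).trans (by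
      have h2 := Real.rpow_nonneg (norm_nonneg q) (2 / 3)
      rw [pow_two, ← mul_assoc]
      exact mul_le_of_le_one_right (by positivity) hq))
    (fun q hq => (h.hasFDerivAt_of_ne_zero hq).differentiableAt)
    (fun q hq hq1 => (b1 q hq).trans (by
      have h2 := Real.rpow_nonneg (norm_nonneg q) (2 / 3)
      exact mul_le_of_le_one_right (by positivity) hq1))
    (fun q hq => by
      have h1 : (fderiv ℝ fun q : V => exc (2 * ‖q‖ ^ 2)) =ᶠ[𝓝 q]
          fun q => (4 * deriv exc (2 * ‖q‖ ^ 2)) • innerSL ℝ q := by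
        filter_upwards [isOpen_ne.mem_nhds hq] with x hx
        exact (h.hasFDerivAt_of_ne_zero hx).fderiv
      refine ContinuousAt.congr ?_ h1.symm
      have h2 : ContinuousAt (deriv exc) (2 * ‖q‖ ^ 2) :=
        (h.differentiableOn_deriv.differentiableAt
          (Ioi_mem_nhds (two_mul_norm_sq_pos hq))).continuousAt
      have h3 : ContinuousAt (fun q : V => deriv exc (2 * ‖q‖ ^ 2)) q :=
        ContinuousAt.comp (f := fun q : V => 2 * ‖q‖ ^ 2) h2 (by fun_prop)
      exact (continuousAt_const.mul h3).smul (innerSL ℝ).continuous.continuousAt)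
  refine ⟨key.1, key.2, fun q => ⟨b0 q, ?_⟩⟩
  by_cases hq : q = 0
  · simp [hq, key.2]
  · exact b1 q hq

theorem AdmissibleExc.excSmooth_one (h : AdmissibleExc exc) : ExcSmooth exc 1 := by
  obtain ⟨C, hC, hV⟩ := h.exists_contDiff_one
  intro R
  -- The surplus powers `|q|²` and `|q|` in the bounds are replaced by a constant on the ball of
  -- radius `R`.
  refine ⟨C * (|R| + 1) ^ 2, by positivity, fun V _ _ => ?_⟩
  obtain ⟨h1, -, h2⟩ := hV V
  refine ⟨by exact_mod_cast h1, fun n hn q hq => ?_⟩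
  have hqR : ‖q‖ ≤ |R| + 1 := hq.trans ((le_abs_self R).trans (by linarith))
  have h3 := Real.rpow_nonneg (norm_nonneg q) (2 / 3)
  have hR := abs_nonneg R
  have h4 : ‖q‖ ^ 2 ≤ (|R| + 1) ^ 2 := by gcongr
  have h5 : ‖q‖ ≤ (|R| + 1) ^ 2 := by nlinarith
  rw [mul_right_comm]
  interval_cases n
  · rw [norm_iteratedFDeriv_zero]
    exact (h2 q).1.trans (by gcongr)
  · rw [norm_iteratedFDeriv_one]
    exact (h2 q).2.trans (by gcongr)

/-- The second derivative is `4 exc' ⟨x, y⟩ + 16 exc'' ⟨q, x⟩ ⟨q, y⟩`. The singularity `ρ ^ (-2/3)`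
of `exc''` is of size `|q| ^ (-4/3)`, and the two factors `q` turn it into `|q| ^ (2/3)`. -/
theorem AdmissibleExc.excSmooth_two (h : AdmissibleExc exc) (h2 : SecondOrderExc exc) :
    ExcSmooth exc 2 := by
  obtain ⟨C₁, hC₁, hV⟩ := h.exists_contDiff_one
  obtain ⟨C₀, hC₀, hd⟩ := h.exists_abs_deriv_le
  obtain ⟨hc, C₂, hC₂⟩ := h2
  set K := C₁ + 8 * C₀ + 16 * |C₂| with hK
  have hK0 : 0 ≤ K := by positivity
  intro R
  refine ⟨K * (|R| + 1) ^ 2, by positivity, fun V _ _ => ?_⟩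
  obtain ⟨h1, h10, h1b⟩ := hV V
  set E := fun q : V => exc (2 * ‖q‖ ^ 2) with hE
  have hsm : ∀ q : V, q ≠ 0 → ContDiffAt ℝ 2 E q := fun q hq => by
    refine ContDiffAt.comp (f := fun q : V => 2 * ‖q‖ ^ 2) (g := exc) q
      (hc.contDiffAt (Ioi_mem_nhds (two_mul_norm_sq_pos hq))) ?_
    exact contDiffAt_const.mul (contDiff_norm_sq ℝ).contDiffAt
  have hD2 : ∀ q : V, q ≠ 0 → HasFDerivAt (fderiv ℝ E)
      ((4 * deriv exc (2 * ‖q‖ ^ 2)) • innerCLM V +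
        ((16 * deriv (deriv exc) (2 * ‖q‖ ^ 2)) • innerSL ℝ q).smulRight (innerSL ℝ q)) q := by
    intro q hq
    have e1 : (fderiv ℝ E) =ᶠ[𝓝 q] fun q => (4 * deriv exc (2 * ‖q‖ ^ 2)) • innerSL ℝ q := by
      filter_upwards [isOpen_ne.mem_nhds hq] with x hx
      exact (h.hasFDerivAt_of_ne_zero hx).fderiv
    have e2 : HasFDerivAt (fun q : V => 4 * deriv exc (2 * ‖q‖ ^ 2))
        ((16 * deriv (deriv exc) (2 * ‖q‖ ^ 2)) • innerSL ℝ q) q := by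
      have e3 := (h.differentiableOn_deriv.differentiableAt
        (Ioi_mem_nhds (two_mul_norm_sq_pos hq))).hasDerivAt.comp_hasFDerivAt q
        (hasFDerivAt_two_mul_norm_sq q)
      refine (e3.const_mul 4).congr_fderiv ?_
      rw [smul_smul, smul_smul]
      congr 1
      ring
    have e4 := e2.smul (innerCLM V).hasFDerivAt (x := q)
    simp only [innerCLM_apply] at e4
    exact e4.congr_of_eventuallyEq e1
  have b2 : ∀ q : V, q ≠ 0 → ‖fderiv ℝ (fderiv ℝ E) q‖ ≤ K * ‖q‖ ^ (2 / 3 : ℝ) := by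
    intro q hq
    have hq0 := norm_pos_iff.2 hq
    have h3 := Real.rpow_third_two_mul_sq_le (norm_nonneg q)
    have h4 := Real.rpow_nonneg (norm_nonneg q) (2 / 3)
    have a1 : 4 * |deriv exc (2 * ‖q‖ ^ 2)| ≤ 8 * C₀ * ‖q‖ ^ (2 / 3 : ℝ) := by
      calc 4 * |deriv exc (2 * ‖q‖ ^ 2)| ≤ 4 * (C₀ * (2 * ‖q‖ ^ (2 / 3 : ℝ))) := by
            gcongr
            exact (hd _ (two_mul_norm_sq_pos hq)).trans (by gcongr)
        _ = _ := by ring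
    have a2 : 16 * |deriv (deriv exc) (2 * ‖q‖ ^ 2)| * ‖q‖ * ‖q‖ ≤
        16 * |C₂| * ‖q‖ ^ (2 / 3 : ℝ) := by
      have e1 : (2 * ‖q‖ ^ 2) ^ (-(2 / 3) : ℝ) ≤ (‖q‖ ^ 2) ^ (-(2 / 3) : ℝ) :=
        Real.rpow_le_rpow_of_nonpos (by positivity) (by nlinarith) (by norm_num)
      have e2 : (‖q‖ ^ 2) ^ (-(2 / 3) : ℝ) * (‖q‖ * ‖q‖) = ‖q‖ ^ (2 / 3 : ℝ) := by
        rw [← Real.rpow_natCast_mul hq0.le, ← pow_two, ← Real.rpow_natCast, ← Real.rpow_add hq0]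
        norm_num
      have e3 : |deriv (deriv exc) (2 * ‖q‖ ^ 2)| ≤ |C₂| * (‖q‖ ^ 2) ^ (-(2 / 3) : ℝ) := by
        refine (hC₂ _ (two_mul_norm_sq_pos hq)).trans ?_
        have := Real.rpow_nonneg (two_mul_norm_sq_pos hq).le (-(2 / 3))
        exact mul_le_mul (le_abs_self _) e1 this (abs_nonneg _)
      calc 16 * |deriv (deriv exc) (2 * ‖q‖ ^ 2)| * ‖q‖ * ‖q‖
          ≤ 16 * (|C₂| * (‖q‖ ^ 2) ^ (-(2 / 3) : ℝ)) * ‖q‖ * ‖q‖ := by gcongr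
        _ = 16 * |C₂| * ((‖q‖ ^ 2) ^ (-(2 / 3) : ℝ) * (‖q‖ * ‖q‖)) := by ring
        _ = _ := by rw [e2]
    have a3 : 8 * C₀ * ‖q‖ ^ (2 / 3 : ℝ) + 16 * |C₂| * ‖q‖ ^ (2 / 3 : ℝ) ≤
        K * ‖q‖ ^ (2 / 3 : ℝ) := by
      rw [← add_mul, hK]
      gcongr
      linarith
    refine ContinuousLinearMap.opNorm_le_bound₂ _ (mul_nonneg hK0 h4) fun x y => ?_
    have a4 : fderiv ℝ (fderiv ℝ E) q x y = 4 * deriv exc (2 * ‖q‖ ^ 2) * inner ℝ x y +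
        16 * deriv (deriv exc) (2 * ‖q‖ ^ 2) * inner ℝ q x * inner ℝ q y := by
      rw [(hD2 q hq).fderiv]
      simp [innerCLM_apply]
    rw [a4]
    calc _ ≤ 4 * |deriv exc (2 * ‖q‖ ^ 2)| * (‖x‖ * ‖y‖) +
          16 * |deriv (deriv exc) (2 * ‖q‖ ^ 2)| * (‖q‖ * ‖x‖) * (‖q‖ * ‖y‖) := by
          refine norm_add_le_of_le ?_ ?_
          · rw [norm_mul, norm_mul, Real.norm_eq_abs, Real.norm_eq_abs, Real.norm_eq_abs,
              abs_of_pos (four_pos : (0 : ℝ) < 4)]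
            gcongr
            exact abs_real_inner_le_norm x y
          · rw [norm_mul, norm_mul, norm_mul, Real.norm_eq_abs, Real.norm_eq_abs,
              Real.norm_eq_abs, Real.norm_eq_abs, abs_of_pos (by norm_num : (0 : ℝ) < 16)]
            gcongr
            · exact abs_real_inner_le_norm q x
            · exact abs_real_inner_le_norm q y
      _ = (4 * |deriv exc (2 * ‖q‖ ^ 2)| +
          16 * |deriv (deriv exc) (2 * ‖q‖ ^ 2)| * ‖q‖ * ‖q‖) * (‖x‖ * ‖y‖) := by ring
      _ ≤ K * ‖q‖ ^ (2 / 3 : ℝ) * (‖x‖ * ‖y‖) := by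
          gcongr
          linarith
      _ = _ := by ring
  have hC1K : C₁ ≤ K := by rw [hK]; linarith [abs_nonneg C₂]
  have key := contDiff_one_of_punctured (f := fderiv ℝ E) (K := K)
    (fun q _ => (h1b q).2.trans (by
      have h4 := Real.rpow_nonneg (norm_nonneg q) (2 / 3)
      gcongr))
    (fun q hq => (hD2 q hq).differentiableAt) (fun q hq _ => b2 q hq)
    (fun q hq => (((hsm q hq).fderiv_right (m := 1) (by norm_num)).fderiv_right
      (m := 0) (by norm_num)).continuousAt)
  refine ⟨?_, fun n hn q hq => ?_⟩
  · have : ContDiff ℝ (1 + 1) E := contDiff_succ_iff_fderiv.2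
      ⟨h1.differentiable one_ne_zero, by simp, key.1⟩
    simpa [one_add_one_eq_two] using this
  have hqR : ‖q‖ ≤ |R| + 1 := hq.trans ((le_abs_self R).trans (by linarith))
  have h3 := Real.rpow_nonneg (norm_nonneg q) (2 / 3)
  have hR := abs_nonneg R
  have h4 : ‖q‖ ^ 2 ≤ (|R| + 1) ^ 2 := by gcongr
  have h5 : ‖q‖ ≤ (|R| + 1) ^ 2 := by nlinarith
  rw [mul_right_comm]
  interval_cases n
  · rw [norm_iteratedFDeriv_zero]
    exact (h1b q).1.trans (by gcongr)
  · rw [norm_iteratedFDeriv_one]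
    exact (h1b q).2.trans (by gcongr)
  · rw [← norm_iteratedFDeriv_fderiv, norm_iteratedFDeriv_one]
    have h6 : 1 ≤ (|R| + 1) ^ 2 := by nlinarith
    have h7 : ‖fderiv ℝ (fderiv ℝ E) q‖ ≤ K * ‖q‖ ^ (2 / 3 : ℝ) := by
      by_cases hq0 : q = 0
      · refine ContinuousLinearMap.opNorm_le_bound₂ _ (mul_nonneg hK0 h3) fun x y => ?_
        rw [hq0, key.2]
        simp only [_root_.zero_apply, norm_zero]
        positivity
      · exact b2 q hq0
    exact h7.trans (le_mul_of_one_le_right (mul_nonneg hK0 h3) h6)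

end Amplitude

end Exc

/-! ### Locality of the exchange-correlation energies -/

section ExcLocal

open Filter Topology

variable {S : Type*} {Nb Nc N : ℕ} {𝓜 : TBModel S Nb Nc}

/-- The amplitudes `√F(H) φ(x)`, whose squared norm is half the density. -/
noncomputable def TBModel.amplitude {M : ℕ} (𝓜 : TBModel S Nb Nc) (Z : Fin M → S) (β : ℝ≥0∞)
    (μ : ℝ) (r : Fin M → R3) (v : Fin M → Fin Nc → ℝ) (x : R3) :
    EuclideanSpace ℝ (Fin M × Fin Nb) :=
  WithLp.toLp 2 (cfc (fun x => √(fermiDirac β μ x)) (𝓜.hamiltonian Z r v) *ᵥ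
    fun i => 𝓜.phi Z r i x)

/-- `√F(H)` is symmetric with square `F(H)`. -/
theorem TBModel.density_eq {M : ℕ} (Z : Fin M → S) (β : ℝ≥0∞) (μ : ℝ) (r : Fin M → R3)
    (v : Fin M → Fin Nc → ℝ) (x : R3) :
    𝓜.density Z β μ r v x = 2 * ‖𝓜.amplitude Z β μ r v x‖ ^ 2 := by
  have hfin : (spectrum ℝ (𝓜.hamiltonian Z r v)).Finite := Matrix.finite_real_spectrum
  set Q := cfc (fun x => √(fermiDirac β μ x)) (𝓜.hamiltonian Z r v) with hQ
  have h1 : 𝓜.fermiMatrix Z β μ r v = Q * Q := by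
    rw [hQ, ← cfc_mul _ _ _ (hfin.continuousOn _) (hfin.continuousOn _), TBModel.fermiMatrix]
    congr 1
    ext x
    exact (Real.mul_self_sqrt (fermiDirac_nonneg _ _ _)).symm
  have h2 : Qᵀ = Q := by
    ext i j
    exact Matrix.cfc_apply_symm _ _ _ _
  rw [TBModel.density, TBModel.amplitude, h1, ← hQ, EuclideanSpace.norm_sq_eq,
    ← Matrix.mulVec_mulVec, Matrix.dotProduct_mulVec, ← Matrix.mulVec_transpose, h2]
  congr 1
  simp only [dotProduct, Real.norm_eq_abs, pow_two, abs_mul_abs_self]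

/-- The Euclidean norm is bounded crudely by the sum over components; this is harmless since the
entries decay in both indices. -/
theorem jetBound_toLp_mulVec {ι E : Type*} [Fintype ι] [NormedAddCommGroup E]
    [NormedSpace ℝ E] {Q : E → Matrix ι ι ℝ} {φ : E → ι → ℝ} {x₀ : E} {c : ι → ι → ℝ} {t : ℝ}
    (h : ∀ i j, JetBound N (fun h => Q h i j * φ h j) x₀ (c i j) t) (ht : 0 ≤ t) :
    JetBound N (fun h => (WithLp.toLp 2 (Q h *ᵥ φ h) : EuclideanSpace ℝ ι)) x₀
      (∑ i, ∑ j, c i j) t := by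
  classical
  let L : ι → ℝ →L[ℝ] EuclideanSpace ℝ ι := fun i =>
    (ContinuousLinearMap.id ℝ ℝ).smulRight (EuclideanSpace.single i 1)
  have hL : ∀ i, ‖L i‖ ≤ 1 := fun i =>
    ContinuousLinearMap.opNorm_le_bound _ zero_le_one fun x => by simp [L, norm_smul]
  have h1 : ∀ i, JetBound N (fun h => L i (∑ j, Q h i j * φ h j)) x₀ (∑ j, c i j) t := fun i => by
    have h2 := JetBound.sum Finset.univ fun j _ => h i j
    exact (h2.clm (L i)).mono_const (mul_le_of_le_one_left h2.nonneg (hL i)) ht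
  refine (JetBound.sum Finset.univ fun i _ => h1 i).congr (Eventually.of_forall fun h => ?_)
  ext k
  simp [L, Matrix.mulVec, dotProduct, Pi.single_apply]

/-- The factor `A ^ (2/3)` preserves, at two thirds of the rate, the spatial decay of the amplitude.
-/
theorem JetBound.exc_comp {exc : ℝ → ℝ} {E V : Type} [NormedAddCommGroup E] [NormedSpace ℝ E]
    [NormedAddCommGroup V] [InnerProductSpace ℝ V] {K R : ℝ} (hK0 : 0 ≤ K)
    (hE : ContDiff ℝ N fun q : V => exc (2 * ‖q‖ ^ 2))
    (hK : ∀ n ≤ N, ∀ q : V, ‖q‖ ≤ R →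
      ‖iteratedFDeriv ℝ n (fun q : V => exc (2 * ‖q‖ ^ 2)) q‖ ≤ K * ‖q‖ ^ (2 / 3 : ℝ))
    {q : E → V} {h : E} {A T : ℝ} (hq : JetBound N q h A T) (hAR : A ≤ R) (hT : 0 ≤ T) :
    JetBound N (fun h => exc (2 * ‖q h‖ ^ 2)) h
      (N.factorial * (K * A ^ (2 / 3 : ℝ)) * (1 + R) ^ N) T := by
  have hA := hq.nonneg
  have h1 := hq.comp hE (C := K * A ^ (2 / 3 : ℝ)) (fun n hn =>
    (hK n hn (q h) (hq.norm_le.trans hAR)).trans (mul_le_mul_of_nonneg_left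
      (Real.rpow_le_rpow (norm_nonneg _) hq.norm_le (by norm_num)) hK0)) hT
  refine (h1.mono le_rfl (by positivity) (t' := (1 + R) * T) (by gcongr)).absorb (by linarith) hT

theorem Real.mul_exp_neg_rpow {A s p : ℝ} (hA : 0 ≤ A) :
    (A * Real.exp (-s)) ^ p = A ^ p * Real.exp (-(p * s)) := by
  rw [Real.mul_rpow hA (Real.exp_pos _).le, ← Real.exp_mul]
  congr 2
  ring

variable {M : ℕ} {Z : Fin M → S} {β : ℝ≥0∞} {μ a C D b η 𝔪 : ℝ} {r : Fin M → R3}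
  {v : Fin M → Fin Nc → ℝ} {τ : Fin M → ℝ}

/-- At points of the cell of `ℓ` both hypotheses on `x` hold. All weights are then paid for by
distances from `x`, so the jet has scale `1`, and closeness to any atom forces closeness to `r ℓ`.
-/
theorem FermiJets.jetBound_amplitude (hF : FermiJets 𝓜 Z β μ r v N a C D b η τ)
    (horb : ∀ s b, ExpLocalised N C a (𝓜.orbital s b))
    (hC : 0 ≤ C) (hD : 0 ≤ D) (hb : 0 < b) (hba : b ≤ a) (hη : 0 ≤ η) (hNη : N * η ≤ b / 8)
    (h𝔪 : 0 < 𝔪) (hr : ∀ i j, i ≠ j → 𝔪 ≤ dist (r i) (r j)) {ℓ : Fin M} {x : R3}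
    (hτx : ∀ k, τ k ≤ Real.exp (2 * η * dist x (r k)))
    (hℓ : ∀ k, dist x (r ℓ) ≤ 3 * dist x (r k)) :
    JetBound N (fun h : Conf M Nc => 𝓜.amplitude Z β μ (movedPos r τ h) (movedFeat v τ h) x) 0
      (C * D * 2 ^ N * (Nb * packingConst (b / 8) 𝔪) * (Nb * packingConst (b / 4) 𝔪) *
        Real.exp (-(b / 24 * dist x (r ℓ)))) 1 := by
  have hτ := hF.weight
  have hφ : ∀ i : Fin M × Fin Nb, JetBound N (fun h : Conf M Nc => 𝓜.phi Z (movedPos r τ h) i x) 0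
      (C * Real.exp (-(a * dist x (r i.1)))) (τ i.1) := fun i => by
    have := jetBound_centred (horb (Z i.1) i.2) hτ i.1 x (0 : Conf M Nc)
    rwa [movedPos_zero] at this
  refine (jetBound_toLp_mulVec (c := fun i j => C * D * 2 ^ N *
    Real.exp (-(b / 24 * dist x (r ℓ))) * (Real.exp (-(b / 8 * dist x (r i.1))) *
      Real.exp (-(b / 4 * dist x (r j.1))))) (fun i j => ?_) zero_le_one).mono_const ?_ zero_le_one
  · have d1 : 0 ≤ dist x (r i.1) := dist_nonneg
    have d2 : 0 ≤ dist x (r j.1) := dist_nonneg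
    have d3 : 0 ≤ dist (r i.1) (r j.1) := dist_nonneg
    have p1 := hτ.pos i.1
    have p2 := hτ.pos j.1
    have h3 := ((hF.sqrt i j).mul (hφ j)).absorb_exp (t := 1) (K := 2)
      (s := 2 * η * (dist x (r i.1) + dist x (r j.1))) (by positivity) zero_le_one (by norm_num)
      (by positivity) (by
        have e1 : τ i.1 ≤ Real.exp (2 * η * (dist x (r i.1) + dist x (r j.1))) :=
          (hτx _).trans (Real.exp_le_exp.2 (by gcongr; linarith))
        have e2 : τ j.1 ≤ Real.exp (2 * η * (dist x (r i.1) + dist x (r j.1))) :=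
          (hτx _).trans (Real.exp_le_exp.2 (by gcongr; linarith))
        linarith)
    refine h3.mono_const ?_ zero_le_one
    have hd : dist x (r i.1) ≤ dist (r i.1) (r j.1) + dist x (r j.1) := by
      rw [add_comm, dist_comm (r i.1)]; exact dist_triangle _ _ _
    have hi := hℓ i.1
    calc _ = C * D * 2 ^ N * (Real.exp (-(b * dist (r i.1) (r j.1))) *
          Real.exp (-(a * dist x (r j.1))) *
          Real.exp (N * (2 * η * (dist x (r i.1) + dist x (r j.1))))) := by ring
      _ ≤ C * D * 2 ^ N * (Real.exp (-(b / 24 * dist x (r ℓ))) *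
          (Real.exp (-(b / 8 * dist x (r i.1))) * Real.exp (-(b / 4 * dist x (r j.1))))) := by
          simp only [← Real.exp_add]
          refine mul_le_mul_of_nonneg_left (Real.exp_le_exp.2 ?_) (by positivity)
          -- The weights cost `b / 4` on both distances from `x`. Half of `b r_{ij} + b |x - r_j|`
          -- is converted into `b |x - r_i| / 2`, so at least `b / 4` of each distance survives; of
          -- that for `i`, one half is turned into `b / 24` about `r ℓ`.
          have e1 : N * (2 * η * (dist x (r i.1) + dist x (r j.1))) ≤
              b / 4 * (dist x (r i.1) + dist x (r j.1)) := by
            calc _ = 2 * (N * η) * (dist x (r i.1) + dist x (r j.1)) := by ring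
              _ ≤ 2 * (b / 8) * (dist x (r i.1) + dist x (r j.1)) := by gcongr
              _ = _ := by ring
          have e2 : b * dist x (r j.1) ≤ a * dist x (r j.1) := by gcongr
          have e3 : b * dist x (r i.1) ≤ b * (dist (r i.1) (r j.1) + dist x (r j.1)) := by gcongr
          have e4 : b * dist x (r ℓ) ≤ b * (3 * dist x (r i.1)) := by gcongr
          have e5 : 0 ≤ b * dist (r i.1) (r j.1) := by positivity
          linarith
      _ = _ := by ring
  · simp only [← Finset.mul_sum]
    rw [← Finset.sum_mul]
    have s1 := sum_exp_neg_dist_prod_le (Nb := Nb) (by positivity : 0 < b / 8) h𝔪 hr x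
    have s2 := sum_exp_neg_dist_prod_le (Nb := Nb) (by positivity : 0 < b / 4) h𝔪 hr x
    have s3 : 0 ≤ (Nb : ℝ) * packingConst (b / 8) 𝔪 :=
      mul_nonneg (Nat.cast_nonneg _) (packingConst_nonneg _ _)
    calc _ ≤ C * D * 2 ^ N * Real.exp (-(b / 24 * dist x (r ℓ))) *
          ((Nb * packingConst (b / 8) 𝔪) * (Nb * packingConst (b / 4) 𝔪)) := by gcongr
      _ = _ := by ring

/-- A qualitative companion at nearby displacements and all `x`, with constants depending on the
configuration. It only dominates the integrand. -/
theorem FermiJets.exists_jetBound_amplitude_near (hF : FermiJets 𝓜 Z β μ r v N a C D b η τ)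
    (horb : ∀ s b, ExpLocalised N C a (𝓜.orbital s b)) (ha : 0 ≤ a) (hC : 0 ≤ C) (ℓ : Fin M) :
    ∃ A T : ℝ, 0 ≤ A ∧ 1 ≤ T ∧ ∀ᶠ h₀ : Conf M Nc in 𝓝 0,
      (∀ x, JetBound N
        (fun h : Conf M Nc => 𝓜.amplitude Z β μ (movedPos r τ h) (movedFeat v τ h) x) h₀
        (A * Real.exp (-(a * dist x (r ℓ)))) T) ∧
      ∀ x, ContDiffAt ℝ N (fun p : R3 × Conf M Nc =>
        𝓜.amplitude Z β μ (movedPos r τ p.2) (movedFeat v τ p.2) p.1) (x, h₀) := by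
  have hτ := hF.weight
  choose c hc0 hc using fun i j => JetBound.eventually_of_contDiffAt (hF.sqrt i j).contDiffAt
  set T := 1 + ∑ k, τ k with hT
  have hτT : ∀ k, 1 + τ k ≤ T := fun k => by
    have := Finset.single_le_sum (f := τ) (fun i _ => (hτ.pos i).le) (Finset.mem_univ k)
    linarith
  have hT1 : 1 ≤ T := by
    have := Finset.sum_nonneg fun i (_ : i ∈ Finset.univ) => (hτ.pos i).le
    linarith
  refine ⟨∑ i, ∑ j, c i j * (C * Real.exp (a * (dist (r ℓ) (r j.1) + τ j.1))), T,
    Finset.sum_nonneg fun i _ => Finset.sum_nonneg fun j _ => by have := hc0 i j; positivity,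
    hT1, ?_⟩
  have hball : ∀ᶠ h : Conf M Nc in 𝓝 0, ‖h‖ ≤ 1 := by
    filter_upwards [Metric.closedBall_mem_nhds (0 : Conf M Nc) one_pos] with q hq
    simpa using hq
  filter_upwards [eventually_all.2 fun i => eventually_all.2 fun j => hc i j, hball]
    with h₀ hQ hh
  refine ⟨fun x => ?_, fun x => ?_⟩
  · refine (jetBound_toLp_mulVec (c := fun i j => c i j *
      (C * Real.exp (a * (dist (r ℓ) (r j.1) + τ j.1))) * Real.exp (-(a * dist x (r ℓ))))
      (fun i j => ?_) (zero_le_one.trans hT1)).mono_const ?_ (zero_le_one.trans hT1)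
    · have h1 := (hQ i j).mul (jetBound_centred (horb (Z j.1) j.2) hτ j.1 x h₀)
      have h0 := hc0 i j
      refine h1.mono ?_ (by have := hτ.pos j.1; positivity) (hτT _)
      rw [mul_assoc, mul_assoc C, ← Real.exp_add]
      gcongr
      have d1 : dist (movedPos r τ h₀ j.1) (r j.1) ≤ τ j.1 := by
        rw [movedPos, dist_eq_norm, add_sub_cancel_left, norm_smul,
          Real.norm_of_nonneg (hτ.pos _).le]
        exact mul_le_of_le_one_right (hτ.pos _).le
          (((norm_le_pi_norm _ _).trans (norm_fst_le h₀)).trans hh)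
      have d2 : dist x (r ℓ) ≤ dist x (movedPos r τ h₀ j.1) +
          (dist (movedPos r τ h₀ j.1) (r j.1) + dist (r j.1) (r ℓ)) :=
        (dist_triangle _ _ _).trans (add_le_add_right (dist_triangle _ _ _) _)
      rw [dist_comm (r j.1)] at d2
      nlinarith
    · simp only [← Finset.sum_mul]
      exact le_rfl
  · rw [contDiffAt_euclidean]
    intro i
    simp only [TBModel.amplitude, Matrix.mulVec, dotProduct]
    refine ContDiffAt.sum fun j _ => ?_
    refine ContDiffAt.mul ?_ (contDiff_centred (horb (Z j.1) j.2) j.1).contDiffAt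
    exact ContDiffAt.comp (x, h₀) (g := fun h : Conf M Nc => cfc (fun x => √(fermiDirac β μ x))
      (𝓜.hamiltonian Z (movedPos r τ h) (movedFeat v τ h)) i j) (hQ i j).contDiffAt contDiffAt_snd

/-- The rate `b / 36` is two thirds of the rate `b / 24` of the amplitudes. -/
theorem FermiJets.jetBound_integral_exc (hF : FermiJets 𝓜 Z β μ r v N a C D b η τ) {R K : ℝ}
    (horb : ∀ s b, ExpLocalised N C a (𝓜.orbital s b)) (hexc : ExcSmooth 𝓜.exc N)
    (hC : 0 ≤ C) (hD : 0 ≤ D) (hb : 0 < b) (hba : b ≤ a) (hη : 0 ≤ η) (hNη : N * η ≤ b / 8)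
    (h𝔪 : 0 < 𝔪) (hr : ∀ i j, i ≠ j → 𝔪 ≤ dist (r i) (r j))
    (hR : R = C * D * 2 ^ N * (Nb * packingConst (b / 8) 𝔪) * (Nb * packingConst (b / 4) 𝔪))
    (hK0 : 0 ≤ K) (hK : ∀ (V : Type) [NormedAddCommGroup V] [InnerProductSpace ℝ V],
      ContDiff ℝ N (fun q : V => 𝓜.exc (2 * ‖q‖ ^ 2)) ∧ ∀ n ≤ N, ∀ q : V, ‖q‖ ≤ R →
      ‖iteratedFDeriv ℝ n (fun q : V => 𝓜.exc (2 * ‖q‖ ^ 2)) q‖ ≤ K * ‖q‖ ^ (2 / 3 : ℝ))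
    {ℓ : Fin M} {s : Set R3} (hs : MeasurableSet s)
    (hτx : ∀ x ∈ s, ∀ k, τ k ≤ Real.exp (2 * η * dist x (r k)))
    (hℓ : ∀ x ∈ s, ∀ k, dist x (r ℓ) ≤ 3 * dist x (r k)) :
    JetBound N (fun h : Conf M Nc => ∫ x in s,
        𝓜.exc (𝓜.density Z β μ (movedPos r τ h) (movedFeat v τ h) x)) 0
      (N.factorial * (K * R ^ (2 / 3 : ℝ)) * (1 + R) ^ N * expIntegral (b / 36)) 1 := by
  simp only [TBModel.density_eq]
  have ha : 0 < a := hb.trans_le hba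
  have hR0 : 0 ≤ R := by
    rw [hR]
    have := packingConst_nonneg (b / 8) 𝔪
    have := packingConst_nonneg (b / 4) 𝔪
    positivity
  obtain ⟨A, T, hA, hT, hnear⟩ := hF.exists_jetBound_amplitude_near horb ha.le hC ℓ
  obtain ⟨K', hK'0, hK'⟩ := hexc A
  set V := EuclideanSpace ℝ (Fin M × Fin Nb)
  refine JetBound.integral (m := volume.restrict s) hnear
    (J := fun x h => 𝓜.exc (2 * ‖𝓜.amplitude Z β μ (movedPos r τ h) (movedFeat v τ h) x‖ ^ 2))
    (b := fun x => N.factorial * (K' * A ^ (2 / 3 : ℝ)) * (1 + A) ^ N * T ^ N *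
      Real.exp (-(2 / 3 * a * dist x (r ℓ))))
    (c := fun x => N.factorial * (K * R ^ (2 / 3 : ℝ)) * (1 + R) ^ N *
      Real.exp (-(b / 36 * dist x (r ℓ)))) ?_ ?_ ?_ ?_ ?_ ?_ zero_le_one
  · intro x h hh
    exact ContDiffAt.comp (x, h) (g := fun q : V => 𝓜.exc (2 * ‖q‖ ^ 2))
      (hK V).1.contDiffAt (hh.2 x)
  · refine Eventually.of_forall fun x h hh n hn => ?_
    have h1 := JetBound.exc_comp hK'0 (hK' V).1 (hK' V).2 (hh.1 x)
      (mul_le_of_le_one_right hA (Real.exp_le_one_iff.2 (neg_nonpos.2 (by positivity))))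
      (zero_le_one.trans hT)
    refine (h1.bound n hn).trans ?_
    rw [Real.mul_exp_neg_rpow hA, ← mul_assoc (2 / 3 : ℝ)]
    have h2 : T ^ n ≤ T ^ N := pow_le_pow_right₀ hT hn
    have h3 := Real.rpow_nonneg hA (2 / 3)
    calc _ ≤ N.factorial * (K' * (A ^ (2 / 3 : ℝ) *
          Real.exp (-(2 / 3 * a * dist x (r ℓ))))) * (1 + A) ^ N * T ^ N := by gcongr
      _ = _ := by ring
  · exact ((integrable_exp_neg_mul_dist (by positivity) (r ℓ)).const_mul _).integrableOn
  · refine (ae_restrict_iff' hs).2 (Eventually.of_forall fun x hx => ?_)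
    have h1 := hF.jetBound_amplitude horb hC hD hb hba hη hNη h𝔪 hr (hτx x hx) (hℓ x hx)
    rw [← hR] at h1
    have h2 := JetBound.exc_comp hK0 (hK V).1 (hK V).2 h1
      (mul_le_of_le_one_right hR0 (Real.exp_le_one_iff.2 (neg_nonpos.2 (by positivity))))
      zero_le_one
    rw [Real.mul_exp_neg_rpow hR0, ← mul_assoc (2 / 3 : ℝ)] at h2
    exact h2.mono_const (le_of_eq (by ring_nf)) zero_le_one
  · exact ((integrable_exp_neg_mul_dist (by positivity) (r ℓ)).const_mul _).integrableOn
  · have h3 := Real.rpow_nonneg hR0 (2 / 3)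
    rw [← integral_exp_neg_mul_dist _ (r ℓ), ← integral_const_mul]
    refine setIntegral_le_integral
      ((integrable_exp_neg_mul_dist (by positivity) (r ℓ)).const_mul _)
      (Eventually.of_forall fun x => ?_)
    simp only [Pi.zero_apply]
    positivity

end ExcLocal

/-! ### Convergence of the integrals in the free energy -/

section Coulomb

open Filter Topology

/-- The singular part of the Coulomb kernel. -/
noncomputable def coulombSingular (z : R3) : ℝ :=
  (Metric.ball (0 : R3) 1).indicator (fun z => ‖z‖⁻¹) z

theorem coulombSingular_nonneg (z : R3) : 0 ≤ coulombSingular z :=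
  Set.indicator_nonneg (fun _ _ => inv_nonneg.2 (norm_nonneg _)) z

theorem integrable_coulombSingular : Integrable coulombSingular := by
  refine (integrable_indicator_iff measurableSet_ball).2 ?_
  refine integrableOn_ball_of_norm_le_rpow (C := 1) (α := 1) (by simp) (by simp)
    (Eventually.of_forall fun x => ?_) (by fun_prop)
  rw [norm_inv, norm_norm, Real.rpow_neg_one, one_mul]

theorem inv_norm_le_one_add_coulombSingular (z : R3) : ‖z‖⁻¹ ≤ 1 + coulombSingular z := by
  by_cases hz : z ∈ Metric.ball (0 : R3) 1
  · rw [coulombSingular, Set.indicator_of_mem hz]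
    linarith
  · have h1 : 1 ≤ ‖z‖ := by simpa using hz
    linarith [coulombSingular_nonneg z, inv_le_one_of_one_le₀ h1]

variable {ρ : R3 → ℝ} {A : ℝ}

/-- Away from the singularity the kernel is at most `1` and integrability of `ρ` suffices; near it
the kernel is integrable and boundedness of `ρ` suffices. -/
theorem norm_div_le_coulomb (hA : ∀ x, |ρ x| ≤ A) (x y : R3) :
    ‖ρ y / ‖x - y‖‖ ≤ |ρ y| + A * coulombSingular (x - y) := by
  rw [norm_div, norm_norm, Real.norm_eq_abs, div_eq_mul_inv]
  calc |ρ y| * ‖x - y‖⁻¹ ≤ |ρ y| * (1 + coulombSingular (x - y)) := by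
        gcongr
        exact inv_norm_le_one_add_coulombSingular _
    _ = |ρ y| + |ρ y| * coulombSingular (x - y) := by ring
    _ ≤ _ := by
        have := coulombSingular_nonneg (x - y)
        gcongr
        exact hA y

theorem integrable_coulomb_majorant (hρ : Integrable ρ) (x : R3) :
    Integrable fun y => |ρ y| + A * coulombSingular (x - y) :=
  hρ.abs.add ((integrable_coulombSingular.comp_sub_left x).const_mul A)

theorem integrable_div_norm_sub (hρ : Integrable ρ) (hA : ∀ x, |ρ x| ≤ A) (x : R3) :
    Integrable fun y => ρ y / ‖x - y‖ := by
  refine (integrable_coulomb_majorant (A := A) hρ x).mono' ?_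
    (Eventually.of_forall fun y => norm_div_le_coulomb hA x y)
  have h1 : Measurable fun y : R3 => ‖x - y‖⁻¹ := by fun_prop
  simp only [div_eq_mul_inv]
  exact hρ.aestronglyMeasurable.mul h1.aestronglyMeasurable

theorem abs_coulombPotential_le (hρ : Integrable ρ) (hA : ∀ x, |ρ x| ≤ A) (x : R3) :
    |coulombPotential ρ x| ≤ (∫ y, |ρ y|) + A * ∫ z, coulombSingular z := by
  refine (norm_integral_le_of_norm_le (integrable_coulomb_majorant (A := A) hρ x)
    (Eventually.of_forall fun y => norm_div_le_coulomb hA x y)).trans (le_of_eq ?_)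
  rw [integral_add hρ.abs ((integrable_coulombSingular.comp_sub_left x).const_mul A),
    integral_const_mul, integral_sub_left_eq_self coulombSingular volume x]

theorem integrable_mul_coulombPotential (hm : Measurable ρ) (hρ : Integrable ρ)
    (hA : ∀ x, |ρ x| ≤ A) : Integrable fun x => ρ x * coulombPotential ρ x := by
  refine hρ.mul_bdd (c := (∫ y, |ρ y|) + A * ∫ z, coulombSingular z) ?_
    (Eventually.of_forall fun x => abs_coulombPotential_le hρ hA x)
  have h1 : Measurable (Function.uncurry fun x y : R3 => ρ y / ‖x - y‖) := by
    unfold Function.uncurry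
    fun_prop
  exact (h1.stronglyMeasurable.integral_prod_right (ν := (volume : Measure R3))).aestronglyMeasurable

end Coulomb

/-! ### Decomposition of the free energy -/

section Decomposition

open Filter Topology

variable {S : Type*} {Nb Nc ν M : ℕ} {𝓜 : TBModel S Nb Nc}

theorem TBModel.Admissible.continuous_phi (h : 𝓜.Admissible ν) (Z : Fin M → S) (r : Fin M → R3)
    (i : Fin M × Fin Nb) : Continuous (𝓜.phi Z r i) := by
  obtain ⟨c, η, -, -, hφ⟩ := h.orbital
  exact (hφ (Z i.1) i.2).1.continuous.comp (by fun_prop)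

theorem TBModel.Admissible.continuous_density (h : 𝓜.Admissible ν) (Z : Fin M → S) (β : ℝ≥0∞)
    (μ : ℝ) (r : Fin M → R3) (v : Fin M → Fin Nc → ℝ) : Continuous (𝓜.density Z β μ r v) := by
  have := h.continuous_phi Z r
  unfold TBModel.density
  simp only [dotProduct, Matrix.mulVec]
  fun_prop

theorem TBModel.density_nonneg (Z : Fin M → S) (β : ℝ≥0∞) (μ : ℝ) (r : Fin M → R3)
    (v : Fin M → Fin Nc → ℝ) (x : R3) : 0 ≤ 𝓜.density Z β μ r v x := by
  rw [TBModel.density_eq]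
  positivity

/-- The constants depend on the configuration; only convergence of the integrals is at stake. -/
theorem TBModel.Admissible.exists_density_le (h : 𝓜.Admissible ν) (Z : Fin M → S) (β : ℝ≥0∞)
    (μ : ℝ) (r : Fin M → R3) (v : Fin M → Fin Nc → ℝ) :
    ∃ A a : ℝ, 0 ≤ A ∧ 0 < a ∧ ∀ x, 𝓜.density Z β μ r v x ≤ A * Real.exp (-(a * ‖x‖)) := by
  obtain ⟨c, a, hc, ha, hφ⟩ := h.orbital
  have b1 : ∀ i x, |𝓜.phi Z r i x| ≤ c * Real.exp (a * ‖r i.1‖) * Real.exp (-(a * ‖x‖)) := by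
    intro i x
    refine ((hφ (Z i.1) i.2).jetBound (x - r i.1)).norm_le.trans ?_
    rw [mul_assoc, ← Real.exp_add]
    gcongr
    have := norm_sub_norm_le x (r i.1)
    nlinarith
  have b2 : ∀ i x, |𝓜.phi Z r i x| ≤ c := by
    intro i x
    refine ((hφ (Z i.1) i.2).jetBound (x - r i.1)).norm_le.trans ?_
    exact mul_le_of_le_one_right hc.le (Real.exp_le_one_iff.2 (neg_nonpos.2 (by positivity)))
  set F := 𝓜.fermiMatrix Z β μ r v with hF
  refine ⟨2 * ∑ i, (c * Real.exp (a * ‖r i.1‖)) * ∑ j, |F i j| * c, a, by positivity, ha,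
    fun x => ?_⟩
  rw [TBModel.density, ← hF, mul_assoc]
  gcongr
  rw [Finset.sum_mul]
  refine Finset.sum_le_sum fun i _ => ?_
  calc _ ≤ |𝓜.phi Z r i x| * |(F *ᵥ fun i => 𝓜.phi Z r i x) i| := by
        rw [← abs_mul]; exact le_abs_self _
    _ ≤ (c * Real.exp (a * ‖r i.1‖) * Real.exp (-(a * ‖x‖))) * ∑ j, |F i j| * c := by
        refine mul_le_mul (b1 i x) ?_ (abs_nonneg _) (by positivity)
        refine (Finset.abs_sum_le_sum_abs _ _).trans (Finset.sum_le_sum fun j _ => ?_)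
        rw [abs_mul]
        gcongr
        exact b2 j x
    _ = _ := by ring

theorem TBModel.density_eq_sum_siteDensity (Z : Fin M → S) (β : ℝ≥0∞) (μ : ℝ) (r : Fin M → R3)
    (v : Fin M → Fin Nc → ℝ) (x : R3) :
    𝓜.density Z β μ r v x = ∑ ℓ, 𝓜.siteDensity Z β μ ℓ r v x := by
  simp only [TBModel.density, TBModel.siteDensity, dotProduct, Matrix.mulVec,
    Fintype.sum_prod_type, ← Finset.mul_sum]
  congr 1
  refine Finset.sum_congr rfl fun ℓ _ => ?_
  rw [Finset.sum_comm]
  refine Finset.sum_congr rfl fun a _ => ?_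
  rw [Finset.mul_sum]
  refine Finset.sum_congr rfl fun k _ => ?_
  rw [Finset.mul_sum]
  exact Finset.sum_congr rfl fun b _ => by ring

theorem TBModel.Admissible.decomposes (h : 𝓜.Admissible ν) (Z : Fin M → S) (β : ℝ≥0∞) (μ : ℝ)
    {r : Fin M → R3} {𝒩 : Fin M → Set R3} (h𝒩 : IsSitePartition r 𝒩) (r' : Fin M → R3)
    (v' : Fin M → Fin Nc → ℝ) : 𝓜.Decomposes Z β μ 𝒩 r' v' := by
  obtain ⟨A, a, hA, ha, hρA⟩ := h.exists_density_le Z β μ r' v'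
  have hcont := h.continuous_density Z β μ r' v'
  have hnn := 𝓜.density_nonneg Z β μ r' v'
  have hρeq := 𝓜.density_eq Z β μ r' v'
  have hsum := 𝓜.density_eq_sum_siteDensity Z β μ r' v'
  set ρ := 𝓜.density Z β μ r' v' with hρ
  have hb : ∀ x, |ρ x| ≤ A := fun x => by
    rw [abs_of_nonneg (hnn x)]
    exact (hρA x).trans
      (mul_le_of_le_one_right hA (Real.exp_le_one_iff.2 (neg_nonpos.2 (by positivity))))
  have hint : Integrable ρ :=
    ((integrable_exp_neg_mul_norm ha).const_mul A).mono' hcont.aestronglyMeasurable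
      (Eventually.of_forall fun x => by rw [Real.norm_eq_abs, abs_of_nonneg (hnn x)]; exact hρA x)
  have hcoul := integrable_div_norm_sub hint hb
  have hnuc : Integrable fun x => ρ x * 𝓜.nuclearPotential Z r' x := by
    have h1 : (fun x => ρ x * 𝓜.nuclearPotential Z r' x) =
        fun x => -∑ i, 𝓜.charge (Z i) * (ρ x / ‖r' i - x‖) := by
      ext x
      rw [TBModel.nuclearPotential, mul_neg, Finset.mul_sum]
      congr 1
      refine Finset.sum_congr rfl fun i _ => ?_
      rw [norm_sub_rev]
      ring
    rw [h1]
    exact (integrable_finsetSum _ fun i _ => (hcoul (r' i)).const_mul _).neg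
  have hhar := integrable_mul_coulombPotential hcont.measurable hint hb
  have hexc : Integrable fun x => 𝓜.exc (ρ x) := by
    obtain ⟨C, hC0, hC⟩ := h.exc.exists_abs_deriv_le
    refine (hint.const_mul (C * A ^ (1 / 3 : ℝ))).mono' ?_ (Eventually.of_forall fun x => ?_)
    -- Measurability is obtained through the amplitudes, of which the integrand is a continuous
    -- function.
    · obtain ⟨K, -, hK⟩ := h.exc.excSmooth_one 0
      have h1 := (hK (EuclideanSpace ℝ (Fin M × Fin Nb))).1.continuous
      have h2 : Continuous fun x => 𝓜.amplitude Z β μ r' v' x := by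
        have := h.continuous_phi Z r'
        unfold TBModel.amplitude
        refine (PiLp.continuous_toLp 2 _).comp (continuous_pi fun i => ?_)
        simp only [Matrix.mulVec, dotProduct]
        fun_prop
      have h3 : (fun x => 𝓜.exc (ρ x)) = fun x => 𝓜.exc (2 * ‖𝓜.amplitude Z β μ r' v' x‖ ^ 2) :=
        funext fun x => by rw [hρeq]
      rw [h3]
      exact (h1.comp h2).aestronglyMeasurable
    · refine (h.exc.abs_le hC0 hC (hnn x)).trans ?_
      have h1 := hnn x
      have h2 := (abs_le.1 (hb x)).2
      gcongr
  refine ⟨hnuc, hcoul, hhar, hexc, ?_, hsum⟩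
  have h1 : ∫ x, 𝓜.exc (ρ x) = ∑ ℓ, ∫ x in 𝒩 ℓ, 𝓜.exc (ρ x) := by
    rw [← setIntegral_univ, ← h𝒩.cover]
    exact integral_iUnion_fintype h𝒩.measurableSet h𝒩.disjoint fun i => hexc.integrableOn
  have h2 : (𝓜.bandMatrix Z β μ r' v').trace = ∑ ℓ, 𝓜.bandSiteEnergy Z β μ ℓ r' v' := by
    simp only [Matrix.trace, Matrix.diag_apply, Fintype.sum_prod_type, TBModel.bandSiteEnergy]
  have h3 : Integrable fun x =>
      ρ x * 𝓜.nuclearPotential Z r' x + 1 / 2 * (ρ x * coulombPotential ρ x) :=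
    hnuc.add (hhar.const_mul _)
  rw [TBModel.freeEnergy, TBModel.electrostatic, ← hρ, integral_add h3 hexc, h1, h2]
  simp only [TBModel.siteEnergy, Finset.sum_add_distrib, ← hρ]
  ring

/-- Voronoi cells with ties given to the smallest index, so that they are disjoint. A point of the
cell of `ℓ` is no farther from `r ℓ` than from `r m`, and the triangle inequality gives the factor
`1 / 2`. -/
theorem exists_isSitePartition (hM : 0 < M) (r : Fin M → R3) : ∃ 𝒩, IsSitePartition r 𝒩 := by
  refine ⟨fun ℓ => {x | ∀ m, dist (r ℓ) x < dist (r m) x ∨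
    (dist (r ℓ) x = dist (r m) x ∧ ℓ ≤ m)}, ?_, ?_, ?_, ?_⟩
  · intro ℓ
    have hd : ∀ m, Measurable fun x => dist (r m) x := fun m => by fun_prop
    rw [Set.ofPred_forall]
    refine MeasurableSet.iInter fun m => ?_
    exact (measurableSet_lt (hd ℓ) (hd m)).union
      ((measurableSet_eq_fun (hd ℓ) (hd m)).inter (MeasurableSet.const _))
  · intro ℓ m hne
    refine Set.disjoint_left.2 fun x h1 h2 => ?_
    rcases h1 m with h3 | h3 <;> rcases h2 ℓ with h4 | h4
    · exact lt_asymm h3 h4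
    · exact h3.ne' h4.1
    · exact h4.ne' h3.1
    · exact hne (le_antisymm h3.2 h4.2)
  · refine Set.eq_univ_of_forall fun x => ?_
    -- The lexicographic minimum of distance and index selects the cell containing `x`.
    obtain ⟨ℓ, -, hℓ⟩ := Finset.exists_min_image Finset.univ
      (fun m : Fin M => toLex (dist (r m) x, m)) ⟨⟨0, hM⟩, Finset.mem_univ _⟩
    refine Set.mem_iUnion.2 ⟨ℓ, fun m => ?_⟩
    simpa [Prod.Lex.le_iff] using hℓ m (Finset.mem_univ _)
  · intro ℓ m x hx
    have h1 : dist (r ℓ) x ≤ dist (r m) x := by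
      rcases hx m with h | h
      · exact h.le
      · exact h.1.le
    have := dist_triangle_right (r ℓ) (r m) x
    linarith

end Decomposition

/-! ### The locality theorem -/

section Main

variable {S : Type*} {Nb Nc ν N M : ℕ} {𝓜 : TBModel S Nb Nc}

theorem IsSitePartition.exp_le {r : Fin M → R3} {𝒩 : Fin M → Set R3} (h : IsSitePartition r 𝒩)
    {η : ℝ} (hη : 0 ≤ η) {ℓ : Fin M} {x : R3} (hx : x ∈ 𝒩 ℓ) (k : Fin M) :
    Real.exp (η * dist (r ℓ) (r k)) ≤ Real.exp (2 * η * dist x (r k)) := by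
  have := h.dist_ge ℓ k x hx
  rw [dist_comm (r k)] at this
  refine Real.exp_le_exp.2 ?_
  nlinarith

/-- `r_{ℓk}` is at most twice the distance from `x` to `r k`. -/
theorem IsSitePartition.dist_le {r : Fin M → R3} {𝒩 : Fin M → Set R3} (h : IsSitePartition r 𝒩)
    {ℓ : Fin M} {x : R3} (hx : x ∈ 𝒩 ℓ) (k : Fin M) :
    dist x (r ℓ) ≤ 3 * dist x (r k) := by
  have h1 := h.dist_ge ℓ k x hx
  have h2 := dist_triangle_right x (r ℓ) (r k)
  rw [dist_comm (r k)] at h1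
  linarith

/-- Uniform bounds for the weighted jets of site energies and atomic densities. -/
theorem TBModel.Admissible.exists_site_jets (h𝓜 : 𝓜.Admissible ν) (hN : N + 1 ≤ ν) (μ : ℝ)
    {𝔪 : ℝ} (h𝔪 : 0 < 𝔪) (B : ℝ) :
    ∃ (c : ℝ) (C : ℝ≥0∞ → ℝ≥0∞ → ℝ≥0∞ → ℝ), 0 < c ∧
    ∀ (M : ℕ) (Z : Fin M → S) (r : Fin M → R3) (v : Fin M → Fin Nc → ℝ) (β gm gp : ℝ≥0∞),
      (∀ i j, i ≠ j → 𝔪 ≤ dist (r i) (r j)) → ‖v‖ ≤ B →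
      gm = 𝓜.gapMinus Z μ r v → gp = 𝓜.gapPlus Z μ r v → FiniteTempOrGap β gm gp →
      ∀ (η : ℝ) (ℓ : Fin M) (τ : Fin M → ℝ), η = c * decayScale β gm gp →
      (τ = fun k => Real.exp (η * dist (r ℓ) (r k))) →
        JetBound N (fun h : Conf M Nc =>
          𝓜.bandSiteEnergy Z β μ ℓ (movedPos r τ h) (movedFeat v τ h)) 0 (C β gm gp) 1 ∧
        (∀ x, JetBound N (fun h : Conf M Nc =>
          𝓜.siteDensity Z β μ ℓ (movedPos r τ h) (movedFeat v τ h) x) 0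
          (C β gm gp * Real.exp (-((N + 1) * η * dist x (r ℓ)))) 1) ∧
        (ExcSmooth 𝓜.exc N → ∀ 𝒩, IsSitePartition r 𝒩 → JetBound N (fun h : Conf M Nc =>
          𝓜.siteEnergy Z β μ 𝒩 ℓ (movedPos r τ h) (movedFeat v τ h)) 0 (C β gm gp) 1) := by
  obtain ⟨a, C, c, ha, hC, hc, hca, horb, hjets⟩ := 𝓜.exists_matrixFunction_jet h𝓜 hN μ h𝔪 B
  -- The constant is fixed before the configuration, so it depends on `β` and the gaps only. The
  -- divisor `8 (N + 1)` makes `(N + 1) η` one eighth of the matrix decay rate `b`: enough to pay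
  -- for `N` derivatives and to leave rate `(N + 1) η` in `x` for the densities.
  suffices H : ∀ β gm gp : ℝ≥0∞, ∃ C' : ℝ, FiniteTempOrGap β gm gp →
      ∀ (M : ℕ) (Z : Fin M → S) (r : Fin M → R3) (v : Fin M → Fin Nc → ℝ),
      (∀ i j, i ≠ j → 𝔪 ≤ dist (r i) (r j)) → ‖v‖ ≤ B →
      gm = 𝓜.gapMinus Z μ r v → gp = 𝓜.gapPlus Z μ r v →
      ∀ (η : ℝ) (ℓ : Fin M) (τ : Fin M → ℝ), η = c / (8 * (N + 1)) * decayScale β gm gp →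
      (τ = fun k => Real.exp (η * dist (r ℓ) (r k))) →
        JetBound N (fun h : Conf M Nc =>
          𝓜.bandSiteEnergy Z β μ ℓ (movedPos r τ h) (movedFeat v τ h)) 0 C' 1 ∧
        (∀ x, JetBound N (fun h : Conf M Nc =>
          𝓜.siteDensity Z β μ ℓ (movedPos r τ h) (movedFeat v τ h) x) 0
          (C' * Real.exp (-((N + 1) * η * dist x (r ℓ)))) 1) ∧
        (ExcSmooth 𝓜.exc N → ∀ 𝒩, IsSitePartition r 𝒩 → JetBound N (fun h : Conf M Nc =>
          𝓜.siteEnergy Z β μ 𝒩 ℓ (movedPos r τ h) (movedFeat v τ h)) 0 C' 1) by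
    choose C' hC' using H
    exact ⟨c / (8 * (N + 1)), C', by positivity, fun M Z r v β gm gp hr hv hgm hgp hfin =>
      hC' β gm gp hfin M Z r v hr hv hgm hgp⟩
  intro β gm gp
  by_cases hfin : FiniteTempOrGap β gm gp
  swap
  · exact ⟨0, fun h => absurd h hfin⟩
  obtain ⟨D, hD, hjet⟩ := hjets β gm gp hfin
  have hθ := decayScale_pos hfin
  have hθ1 := decayScale_le_one β gm gp
  set θ := decayScale β gm gp with hθdef
  set b := c * θ with hb
  have hb0 : 0 < b := mul_pos hc hθ
  have hbc : b ≤ c := mul_le_of_le_one_right hc.le hθ1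
  set R := C * D * 2 ^ N * (Nb * packingConst (b / 8) 𝔪) * (Nb * packingConst (b / 4) 𝔪) with hR
  have hK : ∃ K : ℝ, 0 ≤ K ∧ (ExcSmooth 𝓜.exc N → ∀ (V : Type) [NormedAddCommGroup V]
      [InnerProductSpace ℝ V], ContDiff ℝ N (fun q : V => 𝓜.exc (2 * ‖q‖ ^ 2)) ∧
      ∀ n ≤ N, ∀ q : V, ‖q‖ ≤ R →
      ‖iteratedFDeriv ℝ n (fun q : V => 𝓜.exc (2 * ‖q‖ ^ 2)) q‖ ≤ K * ‖q‖ ^ (2 / 3 : ℝ)) := by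
    by_cases he : ExcSmooth 𝓜.exc N
    · obtain ⟨K, hK0, hK⟩ := he R
      exact ⟨K, hK0, fun _ => hK⟩
    · exact ⟨0, le_rfl, fun h => absurd h he⟩
  obtain ⟨K, hK0, hK⟩ := hK
  have p1 := packingConst_nonneg a 𝔪
  have p2 := packingConst_nonneg (a / 2) 𝔪
  have p3 := packingConst_nonneg (b / 8) 𝔪
  have p4 := packingConst_nonneg (b / 4) 𝔪
  have p5 := expIntegral_nonneg (b / 36)
  have hR0 : 0 ≤ R := by positivity
  have p6 := Real.rpow_nonneg hR0 (2 / 3)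
  have p7 : 0 ≤ (β⁻¹).toReal := ENNReal.toReal_nonneg
  set C₁ := Nb * ((C + |μ|) * D * (Nb * packingConst a 𝔪) * 2 ^ N + (β⁻¹).toReal * D) with hC₁
  set C₂ := 2 * (Nb * (C ^ 2 * D * 3 ^ N * (Nb * packingConst (a / 2) 𝔪))) with hC₂
  set C₃ := N.factorial * (K * R ^ (2 / 3 : ℝ)) * (1 + R) ^ N * expIntegral (b / 36) with hC₃
  have q1 : 0 ≤ C₁ := by positivity
  have q2 : 0 ≤ C₂ := by positivity
  have q3 : 0 ≤ C₃ := by positivity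
  refine ⟨C₁ + C₂ + C₃, fun _ M Z r v hr hv hgm hgp η ℓ τ hη hτ => ?_⟩
  have hη0 : 0 ≤ η := by rw [hη]; positivity
  have hNη1 : (N + 1) * η = b / 8 := by
    rw [hη, hb]
    field_simp
  have hNη : N * η ≤ b / 8 := by linarith
  have hw : IsWeight r η τ := hτ ▸ isWeight_exp r hη0 ℓ
  -- Site quantities of `ℓ` have jets at scale `τ ℓ`, which is therefore `1`.
  have hτℓ : τ ℓ = 1 := by simp [hτ]
  have hF : FermiJets 𝓜 Z β μ r v N a C D b η τ := by
    have hj := hjet M Z r v hr hv hgm hgp η τ hη0 (hNη.trans (by linarith)) hw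
    refine ⟨hw, fun i j => (hj i j).1, fun i j => (hj i j).2 _ (Or.inl rfl),
      fun i j => (hj i j).2 _ (Or.inr (Or.inl rfl)), fun hβ i j => ?_⟩
    simp only [TBModel.cfc_fermiEntropy_fermiMatrix]
    exact (hj i j).2 _ (Or.inr (Or.inr ⟨hβ, rfl⟩))
  have j1 := hF.jetBound_bandSiteEnergy ha hC.le hD hb0.le h𝔪 hr ℓ
  rw [hτℓ, ← hC₁] at j1
  refine ⟨j1.mono_const (by linarith) zero_le_one, fun x => ?_, fun hexc 𝒩 h𝒩 => ?_⟩
  · have j2 := hF.jetBound_siteDensity ha horb hC.le hD hb0.le hη0 (by linarith) h𝔪 hr ℓ x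
    rw [hτℓ, ← hC₂] at j2
    refine j2.mono_const ?_ zero_le_one
    refine mul_le_mul (by linarith) (Real.exp_le_exp.2 (neg_le_neg ?_)) (Real.exp_pos _).le
      (by positivity)
    exact mul_le_mul_of_nonneg_right (by linarith) dist_nonneg
  · have j3 := hF.jetBound_integral_exc horb hexc hC.le hD hb0 (by linarith) hη0 hNη h𝔪 hr hR hK0
      (hK hexc) (h𝒩.measurableSet ℓ) (fun x hx k => by rw [hτ]; exact h𝒩.exp_le hη0 hx k)
      (fun x hx k => h𝒩.dist_le hx k)
    exact (j1.add j3).mono_const (by linarith) zero_le_one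

theorem MixedDerivBound.mono {f : (Fin M → R3) → (Fin M → Fin Nc → ℝ) → ℝ} {j : ℕ}
    {k : Fin j → Fin M} {r : Fin M → R3} {v : Fin M → Fin Nc → ℝ} {A A' : ℝ}
    (h : MixedDerivBound f j k r v A) (hA : A ≤ A') : MixedDerivBound f j k r v A' := fun w =>
  (h w).trans (mul_le_mul_of_nonneg_right hA (Finset.prod_nonneg fun _ _ => norm_nonneg _))

end Main

theorem mainTheorem1 {S : Type*} {Nb Nc ν : ℕ} (hν : 2 ≤ ν) (𝓜 : TBModel S Nb Nc)
    (h𝓜 : 𝓜.Admissible ν) (μ 𝔪 B : ℝ) (h𝔪 : 0 < 𝔪) :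
    -- decomposition and locality of first derivatives
    (∃ η C : ℝ≥0∞ → ℝ≥0∞ → ℝ≥0∞ → ℝ, IsDecayRate η ∧
      ∀ (M : ℕ) (Z : Fin M → S) (r : Fin M → R3) (v : Fin M → Fin Nc → ℝ) (β gm gp : ℝ≥0∞),
        0 < M → (∀ i j, i ≠ j → 𝔪 ≤ dist (r i) (r j)) → ‖v‖ ≤ B →
        gm = 𝓜.gapMinus Z μ r v → gp = 𝓜.gapPlus Z μ r v → FiniteTempOrGap β gm gp →
        (∃ 𝒩, IsSitePartition r 𝒩) ∧
        (∀ 𝒩, IsSitePartition r 𝒩 →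
          (∀ r' v', 𝓜.Decomposes Z β μ 𝒩 r' v') ∧
          ∀ ℓ k,
            DifferentiableAt ℝ (fun p : (Fin M → R3) × (Fin M → Fin Nc → ℝ) =>
              𝓜.siteEnergy Z β μ 𝒩 ℓ p.1 p.2) (r, v) ∧
            ‖partialPos (𝓜.siteEnergy Z β μ 𝒩 ℓ) k r v‖ +
              ‖partialFeat (𝓜.siteEnergy Z β μ 𝒩 ℓ) k r v‖ ≤
              C β gm gp * Real.exp (-η β gm gp * dist (r ℓ) (r k))) ∧
        ∀ ℓ k x,
          DifferentiableAt ℝ (fun p : (Fin M → R3) × (Fin M → Fin Nc → ℝ) =>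
            𝓜.siteDensity Z β μ ℓ p.1 p.2 x) (r, v) ∧
          ‖partialPos (fun r' v' => 𝓜.siteDensity Z β μ ℓ r' v' x) k r v‖ +
            ‖partialFeat (fun r' v' => 𝓜.siteDensity Z β μ ℓ r' v' x) k r v‖ ≤
            C β gm gp * Real.exp (-η β gm gp *
              (dist x (r ℓ) + dist (r ℓ) (r k) + dist (r k) x))) ∧
    -- locality of higher derivatives
    (∀ j : ℕ, 1 ≤ j → j + 1 ≤ ν →
      ∃ η C : ℝ≥0∞ → ℝ≥0∞ → ℝ≥0∞ → ℝ, IsDecayRate η ∧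
      ∀ (M : ℕ) (Z : Fin M → S) (r : Fin M → R3) (v : Fin M → Fin Nc → ℝ) (β gm gp : ℝ≥0∞),
        0 < M → (∀ i j, i ≠ j → 𝔪 ≤ dist (r i) (r j)) → ‖v‖ ≤ B →
        gm = 𝓜.gapMinus Z μ r v → gp = 𝓜.gapPlus Z μ r v → FiniteTempOrGap β gm gp →
        ∀ (ℓ : Fin M) (k : Fin j → Fin M),
          (ContDiffAt ℝ j (fun p : (Fin M → R3) × (Fin M → Fin Nc → ℝ) =>
              𝓜.bandSiteEnergy Z β μ ℓ p.1 p.2) (r, v) ∧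
            MixedDerivBound (𝓜.bandSiteEnergy Z β μ ℓ) j k r v
              (C β gm gp * Real.exp (-η β gm gp * ∑ i, dist (r ℓ) (r (k i))))) ∧
          (j = 2 → SecondOrderExc 𝓜.exc → ∀ 𝒩, IsSitePartition r 𝒩 →
            ContDiffAt ℝ j (fun p : (Fin M → R3) × (Fin M → Fin Nc → ℝ) =>
              𝓜.siteEnergy Z β μ 𝒩 ℓ p.1 p.2) (r, v) ∧
            MixedDerivBound (𝓜.siteEnergy Z β μ 𝒩 ℓ) j k r v
              (C β gm gp * Real.exp (-η β gm gp * ∑ i, dist (r ℓ) (r (k i))))) ∧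
          ∀ x,
            ContDiffAt ℝ j (fun p : (Fin M → R3) × (Fin M → Fin Nc → ℝ) =>
              𝓜.siteDensity Z β μ ℓ p.1 p.2 x) (r, v) ∧
            MixedDerivBound (fun r' v' => 𝓜.siteDensity Z β μ ℓ r' v' x) j k r v
              (C β gm gp * Real.exp (-η β gm gp *
                (dist x (r ℓ) + ∑ i, (dist (r ℓ) (r (k i)) + dist (r (k i)) x))))) := by
  have hprod : ∀ {M : ℕ} {r : Fin M → R3} {η : ℝ} {ℓ : Fin M} {j : ℕ} (k : Fin j → Fin M),
      ∏ i, (Real.exp (η * dist (r ℓ) (r (k i))))⁻¹ =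
        Real.exp (-(η * ∑ i, dist (r ℓ) (r (k i)))) := fun k => by
    simp only [← Real.exp_neg]
    rw [← Real.exp_sum, Finset.sum_neg_distrib, Finset.mul_sum]
  refine ⟨?_, fun j hj hjν => ?_⟩
  · obtain ⟨c, C, hc, H⟩ := h𝓜.exists_site_jets (N := 1) hν μ h𝔪 B
    -- Half of the rate is given up for the term `|r_k - x|`, which is at most `r_{ℓk} + |x - r_ℓ|`.
    -- The factor `2` in the constant accounts for the sum of the two partial derivatives.
    refine ⟨fun β gm gp => c / 2 * decayScale β gm gp, fun β gm gp => 2 * C β gm gp,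
      isDecayRate_const_mul (by positivity), ?_⟩
    intro M Z r v β gm gp hM hr hv hgm hgp hfin
    have hη := mul_pos hc (decayScale_pos hfin)
    have H1 := fun ℓ => H M Z r v β gm gp hr hv hgm hgp hfin _ ℓ _ rfl rfl
    have hτ : ∀ ℓ k : Fin M, 0 < Real.exp (c * decayScale β gm gp * dist (r ℓ) (r k)) :=
      fun ℓ k => Real.exp_pos _
    refine ⟨exists_isSitePartition hM r, fun 𝒩 h𝒩 => ⟨fun r' v' => h𝓜.decomposes Z β μ h𝒩 r' v',
      fun ℓ k => ?_⟩, fun ℓ k x => ?_⟩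
    · have h1 := (H1 ℓ).2.2 h𝓜.exc.excSmooth_one 𝒩 h𝒩
      refine ⟨(h1.contDiffAt_of_moved (hτ ℓ)).differentiableAt (by simp), ?_⟩
      refine (h1.norm_partial_le_of_moved (hτ ℓ) le_rfl k).trans ?_
      have h0 := h1.nonneg
      rw [← Real.exp_neg]
      gcongr
      have := dist_nonneg (x := r ℓ) (y := r k)
      nlinarith
    · have h1 := (H1 ℓ).2.1 x
      refine ⟨(h1.contDiffAt_of_moved
        (f := fun r' v' => 𝓜.siteDensity Z β μ ℓ r' v' x) (hτ ℓ)).differentiableAt (by simp), ?_⟩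
      refine (h1.norm_partial_le_of_moved
        (f := fun r' v' => 𝓜.siteDensity Z β μ ℓ r' v' x) (hτ ℓ) le_rfl k).trans ?_
      have h0 := (H1 ℓ).1.nonneg
      rw [← Real.exp_neg, mul_assoc, mul_assoc (C β gm gp), ← Real.exp_add, ← mul_assoc]
      refine mul_le_mul_of_nonneg_left (Real.exp_le_exp.2 ?_) (by positivity)
      have h2 : dist (r k) x ≤ dist (r ℓ) (r k) + dist x (r ℓ) := by
        rw [dist_comm (r ℓ) (r k), dist_comm x]; exact dist_triangle _ _ _
      have := mul_le_mul_of_nonneg_left h2 hη.le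
      have h3 := mul_nonneg hη.le (dist_nonneg (x := x) (y := r ℓ))
      push_cast
      linarith
  · obtain ⟨c, C, hc, H⟩ := h𝓜.exists_site_jets hjν μ h𝔪 B
    refine ⟨fun β gm gp => c / 2 * decayScale β gm gp, C,
      isDecayRate_const_mul (by positivity), ?_⟩
    intro M Z r v β gm gp hM hr hv hgm hgp hfin ℓ k
    have hη := mul_pos hc (decayScale_pos hfin)
    obtain ⟨H1, H2, H3⟩ := H M Z r v β gm gp hr hv hgm hgp hfin _ ℓ _ rfl rfl
    have hτ : ∀ k : Fin M, 0 < Real.exp (c * decayScale β gm gp * dist (r ℓ) (r k)) :=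
      fun k => Real.exp_pos _
    have h0 := H1.nonneg
    have hsum : 0 ≤ ∑ i, dist (r ℓ) (r (k i)) := Finset.sum_nonneg fun _ _ => dist_nonneg
    have hle : C β gm gp * ∏ i, (Real.exp (c * decayScale β gm gp * dist (r ℓ) (r (k i))))⁻¹ ≤
        C β gm gp * Real.exp (-(c / 2 * decayScale β gm gp) * ∑ i, dist (r ℓ) (r (k i))) := by
      rw [hprod]
      gcongr
      nlinarith
    refine ⟨⟨H1.contDiffAt_of_moved hτ, (H1.abs_iteratedFDeriv_le_of_moved hτ le_rfl k).mono hle⟩,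
      fun hj2 hexc 𝒩 h𝒩 => ?_, fun x => ?_⟩
    · have h3 := H3 (by rw [hj2]; exact h𝓜.exc.excSmooth_two hexc) 𝒩 h𝒩
      exact ⟨h3.contDiffAt_of_moved hτ, (h3.abs_iteratedFDeriv_le_of_moved hτ le_rfl k).mono hle⟩
    · have h2 := H2 x
      refine ⟨h2.contDiffAt_of_moved (f := fun r' v' => 𝓜.siteDensity Z β μ ℓ r' v' x) hτ,
        (h2.abs_iteratedFDeriv_le_of_moved
          (f := fun r' v' => 𝓜.siteDensity Z β μ ℓ r' v' x) hτ le_rfl k).mono ?_⟩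
      rw [hprod, mul_assoc, ← Real.exp_add]
      refine mul_le_mul_of_nonneg_left (Real.exp_le_exp.2 ?_) h0
      -- The triangle inequality for each of the `j` atoms uses `|x - r_ℓ|` altogether `j` times;
      -- with the term already present this is covered by the decay `(j + 1) η` of the density.
      have h4 : ∑ i, dist (r (k i)) x ≤ ∑ i, dist (r ℓ) (r (k i)) + j * dist x (r ℓ) := by
        have : ∑ i, dist (r (k i)) x ≤ ∑ i : Fin j, (dist (r ℓ) (r (k i)) + dist x (r ℓ)) :=
          Finset.sum_le_sum fun i _ => by
            rw [dist_comm (r ℓ), dist_comm x]; exact dist_triangle _ _ _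
        simpa [Finset.sum_add_distrib] using this
      rw [Finset.sum_add_distrib]
      have h5 : (0 : ℝ) ≤ j * dist x (r ℓ) := by positivity
      have h6 : 0 ≤ dist x (r ℓ) := dist_nonneg
      have e1 := mul_le_mul_of_nonneg_left h4 hη.le
      have e2 := mul_nonneg hη.le h5
      have e3 := mul_nonneg hη.le h6
      linarith
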